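/- Let $G$ be a finite nonempty simple graph that is distance-hereditary, i.e. every connected induced subgraph $H$ of $G$ satisfies $d_H(u,v)=d_G(u,v)$ for all $u,v\in V(H)$. Write $\operatorname{tww}(G)$ for its twin-width: the least $d$ such that $G$ can be reduced to a single vertex by successive contractions of pairs of vertices, all trigraphs of the sequence (including the first and the last) having maximum red degree at most $d$. Here the edges of $G$ are black, and contracting $u,v$ to a new vertex $x$ joins $x$ to another vertex $y$ by a black edge if both $uy$ and $vy$ are black edges, by no edge if $y$ is adjacent to neither $u$ nor $v$, and by a red edge otherwise. (A) $G$ is asteroidal triple-free (AT-free) if and only if it is a permutation graph, and $$\operatorname{tww}(G)=\begin{cases}0 & \text{if } G \text{ is a cograph (has no induced } P_4),\\ 1 & \text{if } G \text{ is not a cograph and is AT-free},\\ 2&\text{otherwise.}\end{cases}$$ (B) A graph-labelled tree is a finite tree in which each internal node $x$ is labelled by a graph whose vertices (marker vertices) are in bijection with the tree edges at $x$; its accessibility graph has the leaves of the tree as vertices, two leaves being adjacent if, at every node of the tree path joining them, the marker vertices of the two path edges at that node are adjacent in the label. (For a one-vertex graph the tree is a single vertex, regarded as a leaf.) The (canonical)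 split decomposition of a connected graph $C$ is the graph-labelled tree with accessibility graph $C$ in which every internal node has degree at least $3$ and is labelled by a clique, a star, or a graph without a split (a bipartition of the vertices into two parts with at least two vertices each such that the edges between the parts form a biclique), no two clique nodes are adjacent, and no tree edge joins the centre of a star node to a non-central marker vertex of another star node. A star node $x$ points to a tree edge $e$ (respectively to a path $P$ of the tree not containing $x$) if the tree edge at $x$ corresponding to the centre of the star is the first edge of the tree path from $x$ through $e$ (respectively from $x$ to $P$). Every connected component of $G$ has a split decomposition, and for any choice of split decompositions of the components: * if, for each component with at least two vertices, there is an edge of its split decomposition to which all star nodes point, then $\operatorname{tww}(G)=0$; * if this fails, but for each component there is a path of its split decomposition to which all star nodes outside the path point, then $\operatorname{tww}(G)=1$; * otherwise $\operatorname{tww}(G)=2$. -/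

import Mathlib

universe u

/-! ### Trigraphs and twin-width -/

/-- A trigraph whose vertices are taken from a type `V`: a finite vertex set together with disjoint
sets of black and red edges between its vertices. -/
@[ext]
structure Trigraph (V : Type u) where
  verts : Finset V
  black : SimpleGraph V
  red : SimpleGraph V
  black_mem : ∀ ⦃a b : V⦄, black.Adj a b → a ∈ verts
  red_mem : ∀ ⦃a b : V⦄, red.Adj a b → a ∈ verts
  black_disjoint_red : Disjoint black red

namespace Trigraph

variable {V : Type u}

/-- A finite graph, seen as a trigraph without red edges. -/
noncomputable def ofGraph [Finite V] (G : SimpleGraph V) : Trigraph V where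
  verts := Set.finite_univ.toFinset
  black := G
  red := ⊥
  black_mem := by simp
  red_mem := by simp
  black_disjoint_red := disjoint_bot_right

/-- Adjacency in the underlying graph (black or red edge). -/
def Adj (H : Trigraph V) (a b : V) : Prop := H.black.Adj a b ∨ H.red.Adj a b

open Classical in
/-- The trigraph obtained by contracting two distinct vertices `u` and `v`. The vertex created by
the contraction is called `u` again, and `v` disappears. -/
noncomputable def contract (H : Trigraph V) (u v : V) (hu : u ∈ H.verts) :
    Trigraph V where
  verts := H.verts.erase v
  black := SimpleGraph.fromRel fun a b ↦ a ≠ v ∧ b ≠ v ∧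
    ((a ≠ u ∧ b ≠ u ∧ H.black.Adj a b) ∨ (a = u ∧ H.black.Adj u b ∧ H.black.Adj v b))
  red := SimpleGraph.fromRel fun a b ↦ a ≠ v ∧ b ≠ v ∧
    ((a ≠ u ∧ b ≠ u ∧ H.red.Adj a b) ∨
      (a = u ∧ (H.Adj u b ∨ H.Adj v b) ∧ ¬(H.black.Adj u b ∧ H.black.Adj v b)))
  black_mem := by
    intro a b h
    have h1 := H.black_mem (a := a) (b := b)
    have h2 := H.black_mem (a := a) (b := u)
    simp only [SimpleGraph.fromRel_adj] at h
    have := H.black.adj_comm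
    grind
  red_mem := by
    intro a b h
    have h1 := fun b ↦ H.black_mem (a := a) (b := b)
    have h2 := fun b ↦ H.red_mem (a := a) (b := b)
    simp only [SimpleGraph.fromRel_adj, Adj] at h
    have := H.black.adj_comm
    have := H.red.adj_comm
    grind
  black_disjoint_red := by
    rw [SimpleGraph.disjoint_left]
    intro a b h h'
    have hd := SimpleGraph.disjoint_left.1 H.black_disjoint_red a b
    simp only [SimpleGraph.fromRel_adj, Adj] at h h'
    have := H.black.adj_comm
    have := H.red.adj_comm
    grind

/-- `H'` is obtained from `H` by contracting a pair of distinct vertices of `H`. -/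
def IsContraction (H H' : Trigraph V) : Prop :=
  ∃ (u v : V) (hu : u ∈ H.verts), v ∈ H.verts ∧ u ≠ v ∧ H' = H.contract u v hu

/-- Every vertex has red degree at most `d`. -/
def RedDegreeLE (H : Trigraph V) (d : ℕ) : Prop :=
  ∀ v ∈ H.verts, (H.red.neighborSet v).ncard ≤ d

end Trigraph

namespace SimpleGraph

variable {V : Type u}

/-- `H n, …, H 1`, with `n` the number of vertices of `G`, is a `d`-sequence of `G`: it starts at
`G`, each term is a contraction of the one before it, it ends in a trigraph with a single vertex,
and all its trigraphs have maximum red degree at most `d`. -/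
def IsContractionSequence [Finite V] (G : SimpleGraph V) (d : ℕ) (H : ℕ → Trigraph V) : Prop :=
  H (Nat.card V) = Trigraph.ofGraph G ∧
  (H 1).verts.card = 1 ∧
  (∀ i, 1 ≤ i → i < Nat.card V → (H (i + 1)).IsContraction (H i)) ∧
  ∀ i, 1 ≤ i → i ≤ Nat.card V → (H i).RedDegreeLE d

/-- The twin-width of a finite nonempty graph: the least `d` such that it has a `d`-sequence. -/
noncomputable def twinWidth [Finite V] (G : SimpleGraph V) : ℕ :=
  sInf {d : ℕ | ∃ H : ℕ → Trigraph V, G.IsContractionSequence d H}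

/-! ### Graph classes -/

/-- Every connected induced subgraph preserves distances. -/
def IsDistanceHereditary (G : SimpleGraph V) : Prop :=
  ∀ S : Set V, (G.induce S).Connected →
    ∀ u v : S, (G.induce S).dist u v = G.dist (u : V) (v : V)

/-- A cograph is a graph with no induced path on four vertices. -/
def IsCograph (G : SimpleGraph V) : Prop := IsEmpty (pathGraph 4 ↪g G)

/-- There is a path from `a` to `b` that does not dominate `c`: no vertex of the path is equal or
adjacent to `c`. -/
def PathNotDominating (G : SimpleGraph V) (a b c : V) : Prop :=
  ∃ p : G.Walk a b, p.IsPath ∧ ∀ w ∈ p.support, w ≠ c ∧ ¬G.Adj w c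

/-- Three vertices each two of which are joined by a path that does not dominate the third. -/
def IsAsteroidalTriple (G : SimpleGraph V) (a b c : V) : Prop :=
  a ≠ b ∧ a ≠ c ∧ b ≠ c ∧
  G.PathNotDominating a b c ∧ G.PathNotDominating a c b ∧ G.PathNotDominating b c a

/-- Asteroidal triple-free graphs. -/
def IsATFree (G : SimpleGraph V) : Prop := ∀ a b c : V, ¬G.IsAsteroidalTriple a b c

/-- A permutation graph: for two linear orderings of the vertices, the edges are exactly the pairs
that the two orderings put in opposite orders. -/
def IsPermutationGraph (G : SimpleGraph V) : Prop :=
  ∃ σ τ : V ≃ Fin (Nat.card V), ∀ a b : V,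
    G.Adj a b ↔ (σ a < σ b ∧ τ b < τ a) ∨ (σ b < σ a ∧ τ a < τ b)

/-- A split: a bipartition into two sides with at least two vertices each, such that the edges
between the sides form a biclique. -/
def IsSplit (G : SimpleGraph V) (A B : Set V) : Prop :=
  B = Aᶜ ∧ A.Nontrivial ∧ B.Nontrivial ∧
  ∃ A' ⊆ A, ∃ B' ⊆ B, ∀ a ∈ A, ∀ b ∈ B, G.Adj a b ↔ a ∈ A' ∧ b ∈ B'

end SimpleGraph

/-! ### Graph-labelled trees and split decompositions -/

/-- A finite graph-labelled tree with leaf set `L` (the vertices `Sum.inl l`) and internal nodes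
`Sum.inr x`. A node is labelled by a graph whose marker vertices correspond to the tree edges at
that node; the marker vertex of the tree edge from `x` to `w` is written as the neighbour `w`.
A leaf has degree one, except in the tree with a single vertex. -/
structure GraphLabelledTree (L : Type u) where
  Node : Type
  finite_node : Finite Node
  tree : SimpleGraph (L ⊕ Node)
  isTree : tree.IsTree
  leaf_degree : ∀ l : L, (tree.neighborSet (Sum.inl l)).ncard ≤ 1
  node_degree : ∀ x : Node, 2 ≤ (tree.neighborSet (Sum.inr x)).ncard
  label : ∀ x : Node, SimpleGraph (tree.neighborSet (Sum.inr x))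

namespace GraphLabelledTree

variable {L : Type u} (D : GraphLabelledTree L)

/-- For any two consecutive tree edges `w x` and `x w'` of the walk, their marker vertices are
adjacent in the label of `x`. -/
def WalkAccessible {a b : L ⊕ D.Node} (p : D.tree.Walk a b) : Prop :=
  ∀ (x : D.Node) (w w' : D.tree.neighborSet (Sum.inr x)),
    [(w : L ⊕ D.Node), Sum.inr x, (w' : L ⊕ D.Node)] <:+: p.support → (D.label x).Adj w w'

/-- The accessibility graph: two leaves are adjacent if the path of the tree that joins them
passes through adjacent marker vertices at each of its nodes. -/
def accessibilityGraph : SimpleGraph L where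
  Adj l m := l ≠ m ∧
    ∃ p : D.tree.Walk (Sum.inl l) (Sum.inl m), p.IsPath ∧ D.WalkAccessible p
  symm := by
    refine ⟨?_⟩
    rintro l m ⟨hne, p, hp, h⟩
    refine ⟨hne.symm, p.reverse, hp.reverse, fun x w w' hw ↦ ?_⟩
    refine (h x w' w ?_).symm
    rw [SimpleGraph.Walk.support_reverse] at hw
    simpa using List.reverse_infix.2 hw
  loopless := ⟨fun l h ↦ h.1 rfl⟩

/-- The node `x` is labelled by a clique. -/
def IsClique (x : D.Node) : Prop := D.label x = ⊤

/-- The node `x` is labelled by a star with centre the marker vertex of the tree edge from `x`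
to `c`. -/
def IsStarWithCentre (x : D.Node) (c : D.tree.neighborSet (Sum.inr x)) : Prop :=
  D.label x = SimpleGraph.starGraph c

/-- The node `x` is labelled by a star. -/
def IsStar (x : D.Node) : Prop := ∃ c, D.IsStarWithCentre x c

/-- `D` is the canonical split decomposition of `G`: its accessibility graph is `G`, every node has
degree at least three and its label is a clique, a star, or a graph without splits, no two clique
nodes are adjacent, and no tree edge joins the centre of one star node to a non-central marker
vertex of another star node. -/
structure IsSplitDecompositionOf (G : SimpleGraph L) : Prop where
  accessibilityGraph_eq : D.accessibilityGraph = G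
  three_le_degree : ∀ x : D.Node, 3 ≤ (D.tree.neighborSet (Sum.inr x)).ncard
  label_type : ∀ x : D.Node,
    D.IsClique x ∨ D.IsStar x ∨ ∀ A B, ¬(D.label x).IsSplit A B
  clique_reduced : ∀ x y : D.Node, D.tree.Adj (Sum.inr x) (Sum.inr y) →
    D.IsClique x → ¬D.IsClique y
  star_reduced : ∀ (x y : D.Node) (c : D.tree.neighborSet (Sum.inr x))
    (c' : D.tree.neighborSet (Sum.inr y)), D.IsStarWithCentre x c → D.IsStarWithCentre y c' →
    (c : L ⊕ D.Node) = Sum.inr y → (c' : L ⊕ D.Node) = Sum.inr x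

/-- A star node `x` with centre `c` points to the tree edge `e`: the paths of the tree from `x`
through `e` start with the tree edge from `x` to `c`. -/
def PointsToEdge (x : D.Node) (c : D.tree.neighborSet (Sum.inr x)) (e : Sym2 (L ⊕ D.Node)) :
    Prop :=
  ∃ (y : L ⊕ D.Node) (p : D.tree.Walk (Sum.inr x) y),
    p.IsPath ∧ e ∈ p.edges ∧ p.snd = (c : L ⊕ D.Node)

/-- A star node `x` with centre `c`, not on the path `q`, points to `q`: the paths of the tree
from `x` to `q` start with the tree edge from `x` to `c`. -/
def PointsToPath (x : D.Node) (c : D.tree.neighborSet (Sum.inr x)) {a b : L ⊕ D.Node}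
    (q : D.tree.Walk a b) : Prop :=
  ∃ y ∈ q.support, ∃ p : D.tree.Walk (Sum.inr x) y, p.IsPath ∧ p.snd = (c : L ⊕ D.Node)

/-- All star nodes point to a common tree edge. -/
def StarsPointToEdge : Prop :=
  ∃ e ∈ D.tree.edgeSet, ∀ x c, D.IsStarWithCentre x c → D.PointsToEdge x c e

/-- All star nodes that are not on a certain path of the tree point to that path. -/
def StarsPointToPath : Prop :=
  ∃ (a b : L ⊕ D.Node) (q : D.tree.Walk a b), q.IsPath ∧
    ∀ x c, D.IsStarWithCentre x c → Sum.inr x ∉ q.support → D.PointsToPath x c q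

end GraphLabelledTree

/-! Contraction sequences are treated as successive coarsenings of a partition of the vertices
(`Reducible`); `exists_isContractionSequence_iff` translates back to trigraphs. In this form they
can be pulled back along embeddings and along quotients by twins.

Everything rests on the dichotomy `IsDistanceHereditary.isThread_or_hasAsteroid`. A thread is a
sequence of cographs in which each vertex sees all or none of the earlier vertices that are still
active. Sweeping along it, with one active and one inactive part, costs red degree one, and
inserting its vertices one by one into two linear orders gives a permutation diagram. An asteroid is
one of four small induced graphs; it contains an asteroidal triple, and an exhaustive search shows
that it has no sequence of red degree one. Permutation graphs are AT-free, so the two alternatives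
are exactly AT-free and not AT-free. Red degree two always suffices: a distance-hereditary graph has
twins or a vertex of degree at most one (`exists_twins_or_pendant`), and along such an elimination
each surviving vertex carries one part that keeps its adjacencies and one part that has none left.
Cographs are contracted by twins without red edges, and an induced path on four vertices excludes
red degree zero.

The split decomposition decides between the alternatives. A label without a split cannot occur
beyond cliques and stars, because labels embed in the graph and twins or a pendant vertex give a
split. Induced paths on four vertices correspond to pairs of stars that do not point to each other
(`AwayPair`), so the graph is a cograph if and only if all stars point to a common edge. If the
stars off some path point to it, the leaves in their order along the path form a thread. Otherwise,
a longest away pair and a star violating the condition for its path surround a median node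
(`IsTripod`), and the three possible labels of that node, relative to the three branches, give the
asteroids. Decompositions exist because a twin or a pendant vertex can be added to the tree as a new
leaf, with a new node where the tree would not stay reduced. -/

namespace SimpleGraph

/-! ### Contraction sequences as coarsenings of partitions -/

section Reducible

variable {V W ι : Type*}

/-- The parts of `x` and `y` in the partition `r` are different and joined by a red edge. -/
def RedAdj (G : SimpleGraph V) (r : Setoid V) (x y : V) : Prop :=
  ¬r x y ∧ (∃ a b, r x a ∧ r y b ∧ G.Adj a b) ∧ ∃ a b, r x a ∧ r y b ∧ ¬G.Adj a b

/-- The trigraph of the partition `r` has red degree at most `d`. -/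
def RedLE (d : ℕ) (G : SimpleGraph V) (r : Setoid V) : Prop :=
  ∀ x, ∃ s : Finset V, s.card ≤ d ∧ ∀ y, G.RedAdj r x y → ∃ z ∈ s, r z y

/-- The partition obtained from `r` by merging the parts of `x` and `y`. -/
def mergeParts (r : Setoid V) (x y : V) : Setoid V where
  r a b := r a b ∨ (r a x ∧ r b y) ∨ (r a y ∧ r b x)
  iseqv := by
    have h1 : ∀ {a b}, r a b → r b a := fun h ↦ r.symm' h
    have h2 : ∀ {a b c}, r a b → r b c → r a c := fun h h' ↦ r.trans' h h'
    refine ⟨fun a ↦ Or.inl (r.refl' a), fun h ↦ ?_, fun h h' ↦ ?_⟩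
    · rcases h with h | ⟨h, h'⟩ | ⟨h, h'⟩
      exacts [Or.inl (h1 h), Or.inr (Or.inr ⟨h', h⟩), Or.inr (Or.inl ⟨h', h⟩)]
    · rcases h with h | ⟨h, k⟩ | ⟨h, k⟩ <;> rcases h' with h' | ⟨h', k'⟩ | ⟨h', k'⟩
      · exact Or.inl (h2 h h')
      · exact Or.inr (Or.inl ⟨h2 h h', k'⟩)
      · exact Or.inr (Or.inr ⟨h2 h h', k'⟩)
      · exact Or.inr (Or.inl ⟨h, h2 (h1 h') k⟩)
      · exact Or.inr (Or.inl ⟨h, k'⟩)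
      · exact Or.inl (h2 h (h1 k'))
      · exact Or.inr (Or.inr ⟨h, h2 (h1 h') k⟩)
      · exact Or.inl (h2 h (h1 k'))
      · exact Or.inr (Or.inr ⟨h, k'⟩)

theorem mergeParts_apply (r : Setoid V) (x y a b : V) :
    mergeParts r x y a b ↔ r a b ∨ (r a x ∧ r b y) ∨ (r a y ∧ r b x) := Iff.rfl

/-- The partition `r` of the vertices can be coarsened to the trivial partition by merging two
parts at a time, all trigraphs on the way having red degree at most `d`. -/
inductive Reducible (d : ℕ) (G : SimpleGraph V) : Setoid V → Prop
  | top {r : Setoid V} (h : ∀ x y, r x y) : Reducible d G r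
  | merge {r : Setoid V} (x y : V) (h : RedLE d G r) (h' : Reducible d G (mergeParts r x y)) :
      Reducible d G r

theorem Reducible.redLE {d : ℕ} {G : SimpleGraph V} {r : Setoid V} (h : Reducible d G r) :
    RedLE d G r := by
  cases h with
  | top h => exact fun x ↦ ⟨∅, by simp, fun y hy ↦ (hy.1 (h x y)).elim⟩
  | merge _ _ h _ => exact h

/-- Parts joined by a red edge in `G` have images in different parts of `r`, where `f` preserves
edges and non-edges, so these parts are joined by a red edge in `H`. -/
theorem RedLE.comap {d : ℕ} {G : SimpleGraph V} {H : SimpleGraph W} (f : V → W)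
    (hf : ∀ a b, f a ≠ f b → (G.Adj a b ↔ H.Adj (f a) (f b))) {r : Setoid W}
    (h : RedLE d H r) : RedLE d G (r.comap f) := by
  classical
  intro x
  obtain ⟨s, hs, hs'⟩ := h (f x)
  -- A part that meets the image of `f` is represented by a vertex mapped into it; for other parts
  -- the value is irrelevant and `x` is a default.
  have : ∀ z : W, ∃ v : V, (∃ y, r z (f y)) → r z (f v) := fun z ↦ by
    by_cases hz : ∃ y, r z (f y)
    · obtain ⟨y, hy⟩ := hz
      exact ⟨y, fun _ ↦ hy⟩
    · exact ⟨x, fun h ↦ (hz h).elim⟩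
  choose g hg using this
  refine ⟨s.image g, Finset.card_image_le.trans hs, fun y hy ↦ ?_⟩
  have hne : ∀ a b, r (f x) (f a) → r (f y) (f b) → f a ≠ f b := by
    intro a b ha hb hab
    apply hy.1
    rw [Setoid.comap_rel]
    rw [hab] at ha
    exact r.trans' ha (r.symm' hb)
  have : H.RedAdj r (f x) (f y) := by
    obtain ⟨h1, ⟨a, b, ha, hb, hab⟩, ⟨a', b', ha', hb', hab'⟩⟩ := hy
    exact ⟨h1, ⟨f a, f b, ha, hb, (hf a b (hne a b ha hb)).1 hab⟩,
      ⟨f a', f b', ha', hb', fun h ↦ hab' ((hf a' b' (hne a' b' ha' hb')).2 h)⟩⟩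
  obtain ⟨z, hz, hzy⟩ := hs' (f y) this
  exact ⟨g z, Finset.mem_image_of_mem g hz, r.trans' (r.symm' (hg z ⟨y, hzy⟩)) hzy⟩

/-- Contraction sequences can be pulled back along a map under which the adjacency of vertices with
distinct images depends only on the images; such a map is an embedding or the quotient by
modules. -/
theorem Reducible.comap {d : ℕ} {G : SimpleGraph V} {H : SimpleGraph W} (f : V → W)
    (hf : ∀ a b, f a ≠ f b → (G.Adj a b ↔ H.Adj (f a) (f b))) {r : Setoid W}
    (h : Reducible d H r) : Reducible d G (r.comap f) := by
  induction h with
  | top h => exact .top fun x y ↦ h _ _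
  | @merge r x y h _ ih =>
    -- A merge involving a part that misses the image of `f` is invisible in `G` and is skipped.
    by_cases hxy : (∃ a, r x (f a)) ∧ ∃ b, r y (f b)
    · obtain ⟨⟨a, ha⟩, b, hb⟩ := hxy
      refine .merge a b (h.comap f hf) ?_
      convert ih using 1
      ext c e
      have h1 : ∀ c, r (f c) (f a) ↔ r (f c) x := fun c ↦
        ⟨fun h ↦ r.trans' h (r.symm' ha), fun h ↦ r.trans' h ha⟩
      have h2 : ∀ c, r (f c) (f b) ↔ r (f c) y := fun c ↦
        ⟨fun h ↦ r.trans' h (r.symm' hb), fun h ↦ r.trans' h hb⟩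
      simp only [mergeParts_apply, Setoid.comap_rel, h1, h2]
    · convert ih using 1
      ext c e
      simp only [mergeParts_apply, Setoid.comap_rel]
      refine ⟨Or.inl, ?_⟩
      rintro (h | ⟨h, h'⟩ | ⟨h, h'⟩)
      · exact h
      · exact (hxy ⟨⟨c, r.symm' h⟩, ⟨e, r.symm' h'⟩⟩).elim
      · exact (hxy ⟨⟨e, r.symm' h'⟩, ⟨c, r.symm' h⟩⟩).elim

theorem Reducible.of_embedding {d : ℕ} {G : SimpleGraph V} {H : SimpleGraph W} (f : G ↪g H)
    (h : Reducible d H ⊥) : Reducible d G ⊥ := by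
  have := h.comap f fun a b _ ↦ (f.map_rel_iff (a := a) (b := b)).symm
  convert this using 1
  ext a b
  simp [Setoid.comap_rel]

theorem RedLE.bot {d : ℕ} {G : SimpleGraph V} : RedLE d G ⊥ := by
  refine fun x ↦ ⟨∅, by simp, ?_⟩
  rintro y ⟨-, ⟨a, b, ha, hb, hab⟩, a', b', ha', hb', hab'⟩
  simp only [Setoid.bot_def] at ha hb ha' hb'
  subst ha hb ha' hb'
  exact (hab' hab).elim

/-- Two distinct vertices that have the same neighbours apart from themselves. -/
def AreTwins (G : SimpleGraph V) (u v : V) : Prop :=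
  u ≠ v ∧ ∀ w, w ≠ u → w ≠ v → (G.Adj u w ↔ G.Adj v w)

/-- Merging twins creates no red edge: the quotient is `G` without `v`, and the remaining sequence
is pulled back along the retraction that sends `v` to `u`. -/
theorem Reducible.of_twins {d : ℕ} {G : SimpleGraph V} {u v : V} (h : G.AreTwins u v)
    (hr : Reducible d (G.induce {x | x ≠ v}) ⊥) : Reducible d G ⊥ := by
  classical
  refine .merge u v .bot ?_
  have := hr.comap (V := V) (G := G) (fun x ↦ if hx : x = v then ⟨u, h.1⟩ else ⟨x, hx⟩) ?_
  · convert this using 1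
    ext a b
    have := h.1
    simp only [mergeParts_apply, Setoid.comap_rel, Setoid.bot_def]
    grind
  · intro a b hab
    have := h.1
    have := h.2
    have := G.adj_comm
    simp only [comap_adj, Function.Embedding.subtype_apply]
    grind

/-- Red degrees can be bounded on labels. Labels that are not attained do no harm, as the sets `s`
only have to contain the red neighbours. -/
theorem redLE_ker {d : ℕ} {G : SimpleGraph V} (f : V → ι)
    (h : ∀ i, ∃ s : Finset ι, s.card ≤ d ∧ ∀ j, i ≠ j → (∃ a b, f a = i ∧ f b = j ∧ G.Adj a b) →
      (∃ a b, f a = i ∧ f b = j ∧ ¬G.Adj a b) → j ∈ s) : RedLE d G (Setoid.ker f) := by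
  classical
  intro x
  obtain ⟨s, hs, hs'⟩ := h (f x)
  have : ∀ i : ι, ∃ v : V, (∃ y, f y = i) → f v = i := fun i ↦ by
    by_cases hz : ∃ y, f y = i
    · obtain ⟨y, hy⟩ := hz
      exact ⟨y, fun _ ↦ hy⟩
    · exact ⟨x, fun h ↦ (hz h).elim⟩
  choose g hg using this
  refine ⟨s.image g, Finset.card_image_le.trans hs, fun y hy ↦ ⟨g (f y), ?_, hg (f y) ⟨y, rfl⟩⟩⟩
  apply Finset.mem_image_of_mem
  obtain ⟨h1, ⟨a, b, ha, hb, hab⟩, a', b', ha', hb', hab'⟩ := hy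
  exact hs' _ h1 ⟨a, b, ha.symm, hb.symm, hab⟩ ⟨a', b', ha'.symm, hb'.symm, hab'⟩

/-- Merging the label classes `p` and `q`, either of which may be empty. -/
theorem Reducible.of_relabel {d : ℕ} {G : SimpleGraph V} {f g : V → ι} (p q : ι)
    (hg : ∀ x, (f x = p → g x = q) ∧ (f x ≠ p → g x = f x)) (h : RedLE d G (Setoid.ker f))
    (hr : Reducible d G (Setoid.ker g)) : Reducible d G (Setoid.ker f) := by
  -- If one of the classes is empty, at most a name changes and the partition is the same.
  by_cases hpq : (∃ x, f x = p) ∧ ∃ y, f y = q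
  · obtain ⟨⟨x, hx⟩, y, hy⟩ := hpq
    refine .merge x y h ?_
    convert hr using 1
    ext a b
    simp only [mergeParts_apply, Setoid.ker_def]
    have := hg a
    have := hg b
    by_cases f a = p <;> by_cases f b = p <;> grind
  · convert hr using 1
    ext a b
    simp only [Setoid.ker_def]
    have := hg a
    have := hg b
    by_cases f a = p <;> by_cases f b = p <;> grind

theorem Reducible.mono {d e : ℕ} (hde : d ≤ e) {G : SimpleGraph V} {r : Setoid V}
    (h : Reducible d G r) : Reducible e G r := by
  induction h with
  | top h => exact .top h
  | merge x y h _ ih =>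
    exact .merge x y (fun x ↦ let ⟨s, hs, hs'⟩ := h x; ⟨s, hs.trans hde, hs'⟩) ih

end Reducible

/-! ### From partitions to trigraphs and back -/

section Bridge

variable {V : Type*} [Finite V]

/-- The trigraph of a partition whose parts are named by vertices: the part of `x` is `f x`. -/
noncomputable def quotientTrigraph (G : SimpleGraph V) (f : V → V) : Trigraph V where
  verts := (Set.finite_range f).toFinset
  black :=
    { Adj := fun a b ↦ a ≠ b ∧ (a ∈ Set.range f ∧ b ∈ Set.range f) ∧
        ∀ x y, f x = a → f y = b → G.Adj x y
      symm := ⟨fun _ _ h ↦ ⟨h.1.symm, h.2.1.symm, fun x y hx hy ↦ (h.2.2 y x hy hx).symm⟩⟩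
      loopless := ⟨fun _ h ↦ h.1 rfl⟩ }
  red :=
    { Adj := fun a b ↦ a ≠ b ∧ (∃ x y, f x = a ∧ f y = b ∧ G.Adj x y) ∧
        ∃ x y, f x = a ∧ f y = b ∧ ¬G.Adj x y
      symm := ⟨fun _ _ ⟨h, ⟨x, y, hx, hy, hxy⟩, x', y', hx', hy', hxy'⟩ ↦
        ⟨h.symm, ⟨y, x, hy, hx, hxy.symm⟩, ⟨y', x', hy', hx', fun h ↦ hxy' h.symm⟩⟩⟩
      loopless := ⟨fun _ h ↦ h.1 rfl⟩ }
  black_mem := by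
    intro a b h
    simpa using h.2.1.1
  red_mem := by
    rintro a b ⟨-, ⟨x, y, rfl, -⟩, -⟩
    simp
  black_disjoint_red := by
    rw [SimpleGraph.disjoint_left]
    rintro a b h ⟨-, -, x, y, hx, hy, hxy⟩
    exact hxy (h.2.2 x y hx hy)

theorem quotientTrigraph_id (G : SimpleGraph V) :
    G.quotientTrigraph id = Trigraph.ofGraph G := by
  ext a b
  · simp [quotientTrigraph, Trigraph.ofGraph]
  · simp only [quotientTrigraph, Trigraph.ofGraph]
    exact ⟨fun h ↦ h.2.2 a b rfl rfl, fun h ↦ ⟨h.ne, by simp, by rintro _ _ rfl rfl; exact h⟩⟩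
  · simp only [quotientTrigraph, Trigraph.ofGraph, bot_adj, iff_false]
    rintro ⟨-, ⟨x, y, rfl, rfl, h⟩, x', y', hx, hy, h'⟩
    simp only [id] at hx hy
    subst hx hy
    exact h' h

theorem quotientTrigraph_adj (G : SimpleGraph V) (f : V → V) (a b : V) :
    (G.quotientTrigraph f).Adj a b ↔ a ≠ b ∧ ∃ x y, f x = a ∧ f y = b ∧ G.Adj x y := by
  simp only [Trigraph.Adj, quotientTrigraph, Set.mem_range]
  constructor
  · rintro (⟨h, ⟨⟨x, rfl⟩, ⟨y, rfl⟩⟩, h'⟩ | ⟨h, h', -⟩)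
    · exact ⟨h, x, y, rfl, rfl, h' x y rfl rfl⟩
    · exact ⟨h, h'⟩
  · rintro ⟨h, x, y, rfl, rfl, hxy⟩
    by_cases h' : ∀ x' y', f x' = f x → f y' = f y → G.Adj x' y'
    · exact Or.inl ⟨h, ⟨⟨x, rfl⟩, ⟨y, rfl⟩⟩, h'⟩
    · push Not at h'
      exact Or.inr ⟨h, ⟨x, y, rfl, rfl, hxy⟩, h'⟩

-- Since `contract` keeps the name `u` and drops `v`, it acts on naming functions as the relabelling
-- of `v` by `u`.
open Classical in
theorem quotientTrigraph_contract (G : SimpleGraph V) (f : V → V) {u v : V}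
    (hu : u ∈ (G.quotientTrigraph f).verts) (hv : v ∈ (G.quotientTrigraph f).verts) (huv : u ≠ v) :
    (G.quotientTrigraph f).contract u v hu =
      G.quotientTrigraph fun x ↦ if f x = v then u else f x := by
  have hu' : ∃ x, f x = u := by simpa [quotientTrigraph] using hu
  have hv' : ∃ x, f x = v := by simpa [quotientTrigraph] using hv
  set g : V → V := fun x ↦ if f x = v then u else f x with hg
  have hgv : ∀ x, g x ≠ v := fun x ↦ by simp only [hg]; split_ifs <;> assumption
  have hgu : ∀ x, g x = u ↔ f x = u ∨ f x = v := fun x ↦ by simp only [hg]; grind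
  have hgo : ∀ x a, a ≠ u → a ≠ v → (g x = a ↔ f x = a) := fun x a h h' ↦ by
    simp only [hg]; grind
  have symm := G.adj_comm
  ext a b
  · simp only [Trigraph.contract, quotientTrigraph, Finset.mem_erase, Set.Finite.mem_toFinset,
      Set.mem_range]
    by_cases hav : a = v
    · subst hav; simp [hgv]
    · by_cases hau : a = u
      · subst hau
        simp only [hgu, hu', hav, ne_eq, not_false_eq_true, and_self, true_iff]
        obtain ⟨x, hx⟩ := hu'
        exact ⟨x, Or.inl hx⟩
      · simp [hgo _ a hau hav, hav]
  · simp only [Trigraph.contract, SimpleGraph.fromRel_adj, quotientTrigraph, Set.mem_range]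
    by_cases hav : a = v
    · subst hav; simp [hgv]
    by_cases hbv : b = v
    · subst hbv; simp [hgv]
    by_cases hau : a = u
    · subst hau
      by_cases hba : b = a
      · simp [hba]
      simp only [hgo _ b hba hbv, hgu]
      grind
    · by_cases hbu : b = u
      · subst hbu
        simp only [hgo _ a hau hav, hgu]
        grind
      · simp only [hgo _ a hau hav, hgo _ b hbu hbv]
        grind
  · simp only [Trigraph.contract, SimpleGraph.fromRel_adj, quotientTrigraph_adj]
    simp only [quotientTrigraph, Set.mem_range]
    by_cases hav : a = v
    · subst hav; simp [hgv]
    by_cases hbv : b = v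
    · subst hbv; simp [hgv]
    by_cases hau : a = u
    · subst hau
      by_cases hba : b = a
      · simp [hba]
      simp only [hgo _ b hba hbv, hgu]
      grind
    · by_cases hbu : b = u
      · subst hbu
        simp only [hgo _ a hau hav, hgu]
        grind
      · simp only [hgo _ a hau hav, hgo _ b hbu hbv]
        grind

theorem quotientTrigraph_redDegreeLE (G : SimpleGraph V) (f : V → V) (d : ℕ) :
    (G.quotientTrigraph f).RedDegreeLE d ↔ RedLE d G (Setoid.ker f) := by
  classical
  constructor
  · intro h
    have hfin := fun i ↦ Set.toFinite ((G.quotientTrigraph f).red.neighborSet i)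
    refine redLE_ker f fun i ↦ ⟨(hfin i).toFinset, ?_, fun j hij h1 h2 ↦ ?_⟩
    · rw [← Set.ncard_eq_toFinset_card]
      by_cases hi : i ∈ (G.quotientTrigraph f).verts
      · exact h i hi
      · have : (G.quotientTrigraph f).red.neighborSet i = ∅ := by
          ext j
          simp only [mem_neighborSet, Set.mem_empty_iff_false, iff_false]
          exact fun hj ↦ hi ((G.quotientTrigraph f).red_mem hj)
        simp [this]
    · rw [Set.Finite.mem_toFinset]
      exact ⟨hij, h1, h2⟩
  · intro h i hi
    have hi' : ∃ x, f x = i := by simpa [quotientTrigraph] using hi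
    obtain ⟨x, rfl⟩ := hi'
    obtain ⟨s, hs, hs'⟩ := h x
    have : (G.quotientTrigraph f).red.neighborSet (f x) ⊆ ((s.image f : Finset V) : Set V) := by
      rintro j ⟨hij, ⟨a, b, ha, rfl, hab⟩, a', b', ha', hb', hab'⟩
      obtain ⟨z, hz, hzb⟩ := hs' b ⟨hij, ⟨a, b, ha.symm, rfl, hab⟩,
        ⟨a', b', ha'.symm, hb'.symm, hab'⟩⟩
      simp only [Finset.coe_image, Set.mem_image]
      exact ⟨z, hz, hzb⟩
    refine (Set.ncard_le_ncard this (Finset.finite_toSet _)).trans ?_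
    rw [Set.ncard_coe_finset]
    exact Finset.card_image_le.trans hs

/-- Trigraphs are indexed by their number of vertices, so the induction runs upwards from `H 1`. The
naming function has to be arbitrary in it, because it is passed down from `G` by relabelling. -/
theorem IsContractionSequence.reducible {G : SimpleGraph V} {d : ℕ} {H : ℕ → Trigraph V}
    [Nonempty V] (h : G.IsContractionSequence d H) : Reducible d G ⊥ := by
  classical
  obtain ⟨h1, h2, h3, h4⟩ := h
  have key : ∀ i, 1 ≤ i → i ≤ Nat.card V → ∀ f : V → V, H i = G.quotientTrigraph f →
      Reducible d G (Setoid.ker f) := by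
    intro i hi
    induction i, hi using Nat.le_induction with
    | base =>
      intro _ f hf
      rw [hf] at h2
      obtain ⟨a, ha⟩ := Finset.card_eq_one.1 h2
      have : ∀ x, f x = a := fun x ↦ by
        have : f x ∈ (G.quotientTrigraph f).verts := by simp [quotientTrigraph]
        simpa [ha] using this
      exact .top fun x y ↦ by rw [Setoid.ker_def, this, this]
    | succ i hi ih =>
      intro hi' f hf
      obtain ⟨u, v, hu, hv, huv, h⟩ := h3 i hi (by omega)
      simp only [hf] at hu hv h
      rw [quotientTrigraph_contract G f hu hv huv] at h
      refine .of_relabel (g := fun x ↦ if f x = v then u else f x) v u (fun x ↦ by grind) ?_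
        (ih (by omega) _ h)
      rw [← quotientTrigraph_redDegreeLE, ← hf]
      exact h4 _ (by omega) hi'
  have := key (Nat.card V) Nat.card_pos le_rfl id (by rw [h1, quotientTrigraph_id])
  convert this using 1
  ext a b
  simp [Setoid.ker_def]

theorem Reducible.exists_sequence [Nonempty V] {G : SimpleGraph V} {d : ℕ} {r : Setoid V}
    (h : Reducible d G r) (f : V → V) (hf : Setoid.ker f = r) :
    ∃ H : ℕ → Trigraph V, H ((G.quotientTrigraph f).verts.card) = G.quotientTrigraph f ∧
      (H 1).verts.card = 1 ∧
      (∀ i, 1 ≤ i → i < (G.quotientTrigraph f).verts.card → (H (i + 1)).IsContraction (H i)) ∧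
      ∀ i, 1 ≤ i → i ≤ (G.quotientTrigraph f).verts.card → (H i).RedDegreeLE d := by
  classical
  induction h generalizing f with
  | @top r h =>
    have hr : RedLE d G (Setoid.ker f) := hf ▸ (Reducible.top h).redLE
    obtain ⟨x⟩ := ‹Nonempty V›
    have : (G.quotientTrigraph f).verts = {f x} := by
      ext a
      simp only [quotientTrigraph, Set.Finite.mem_toFinset, Set.mem_range, Finset.mem_singleton]
      subst hf
      exact ⟨fun ⟨y, hy⟩ ↦ by rw [← hy]; exact h y x, fun h ↦ ⟨x, h.symm⟩⟩
    have hc : (G.quotientTrigraph f).verts.card = 1 := by simp [this]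
    refine ⟨fun _ ↦ G.quotientTrigraph f, rfl, hc, ?_, ?_⟩
    · intro i hi hi'; omega
    · intro i _ _
      exact (quotientTrigraph_redDegreeLE G f d).2 hr
  | @merge r x y h _ ih =>
    subst hf
    -- Merging a part with itself is not a contraction and contributes no term.
    by_cases hxy : f x = f y
    · refine ih f ?_
      ext a b
      simp only [mergeParts_apply, Setoid.ker_def]
      grind
    · have hu : f x ∈ (G.quotientTrigraph f).verts := by simp [quotientTrigraph]
      have hv : f y ∈ (G.quotientTrigraph f).verts := by simp [quotientTrigraph]
      obtain ⟨H, H1, H2, H3, H4⟩ := ih (fun z ↦ if f z = f y then f x else f z) (by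
        ext a b
        simp only [mergeParts_apply, Setoid.ker_def]
        grind)
      have hq := quotientTrigraph_contract G f hu hv hxy
      rw [← hq] at H1 H3 H4
      have hcard : (G.quotientTrigraph f).verts.card =
          ((G.quotientTrigraph f).contract (f x) (f y) hu).verts.card + 1 := by
        simp only [Trigraph.contract]
        rw [Finset.card_erase_add_one hv]
      have hpos : 1 ≤ ((G.quotientTrigraph f).contract (f x) (f y) hu).verts.card := by
        apply Finset.card_pos.2
        exact ⟨f x, by simp [Trigraph.contract, hu, hxy]⟩
      generalize hn : ((G.quotientTrigraph f).contract (f x) (f y) hu).verts.card = n at *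
      rw [hcard]
      -- The contracted trigraph has `n` vertices, so the sequence given by induction is used up to
      -- `n` and the present trigraph takes the index `n + 1`.
      refine ⟨Function.update H (n + 1) (G.quotientTrigraph f), by simp, ?_, ?_, ?_⟩
      · rw [Function.update_of_ne (by omega)]; exact H2
      · intro i hi hi'
        rw [Function.update_of_ne (by omega : i ≠ n + 1)]
        by_cases hin : i = n
        · subst hin
          simp only [Function.update_self]
          rw [H1]
          exact ⟨f x, f y, hu, hv, hxy, rfl⟩
        · rw [Function.update_of_ne (by omega)]
          exact H3 i hi (by omega)
      · intro i hi hi'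
        by_cases hin : i = n + 1
        · subst hin
          simp only [Function.update_self]
          exact (quotientTrigraph_redDegreeLE G f d).2 h
        · rw [Function.update_of_ne (by omega)]
          exact H4 i hi (by omega)

theorem exists_isContractionSequence_iff [Nonempty V] {G : SimpleGraph V} {d : ℕ} :
    (∃ H, G.IsContractionSequence d H) ↔ Reducible d G ⊥ := by
  constructor
  · rintro ⟨H, h⟩
    exact h.reducible
  · intro h
    obtain ⟨H, h1, h2, h3, h4⟩ := h.exists_sequence id (by
      ext a b; simp [Setoid.ker_def])
    have : (G.quotientTrigraph id).verts.card = Nat.card V := by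
      rw [quotientTrigraph_id, Trigraph.ofGraph, ← Set.ncard_eq_toFinset_card, Set.ncard_univ]
    rw [this] at h1 h3 h4
    exact ⟨H, by rw [h1, quotientTrigraph_id], h2, h3, h4⟩

theorem twinWidth_eq [Nonempty V] {G : SimpleGraph V} {d : ℕ} (h : Reducible d G ⊥)
    (h' : ∀ e, e < d → ¬Reducible e G ⊥) : G.twinWidth = d := by
  unfold twinWidth
  simp only [exists_isContractionSequence_iff]
  apply le_antisymm (Nat.sInf_le h)
  by_contra hlt
  exact h' _ (not_le.1 hlt) (Nat.sInf_mem (s := {d | Reducible d G ⊥}) ⟨d, h⟩)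

end Bridge


/-! ### Lower bounds by exhaustive search -/

section LowerBounds

/-- The parts of `x` and `y` in the partition of `{0, …, n - 1}` with labels `f` are joined by a
red edge. -/
def redTest (n : ℕ) (A : ℕ → ℕ → Bool) (f : ℕ → ℕ) (x y : ℕ) : Bool :=
  f x != f y &&
    ((List.range n).any fun a ↦ f a == f x && (List.range n).any fun b ↦ f b == f y && A a b) &&
    (List.range n).any fun a ↦ f a == f x && (List.range n).any fun b ↦ f b == f y && !A a b

/-- Some part of the partition with labels `f` is incident with `2` red edges, or with `1` if the
flag is not set. -/
def redDegreeTest (n : ℕ) (A : ℕ → ℕ → Bool) (two : Bool) (f : ℕ → ℕ) : Bool :=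
  (List.range n).any fun x ↦ (List.range n).any fun y ↦ redTest n A f x y &&
    (!two || (List.range y).any fun z ↦ f z != f y && redTest n A f x z)

/-- Every way of merging parts of the partition with labels `f` leads, within `k` steps, to a part
of too large red degree. -/
def stuckTest (n : ℕ) (A : ℕ → ℕ → Bool) (two : Bool) : ℕ → (ℕ → ℕ) → Bool
  | 0, f => redDegreeTest n A two f
  | k + 1, f => redDegreeTest n A two f ||
      -- Without this guard the trivial partition, which has no parts left to merge, would count as
      -- stuck.
      (((List.range n).any fun x ↦ f x != f 0) &&
        (List.range n).all fun y ↦ (List.range y).all fun x ↦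
          f x == f y || stuckTest n A two k fun z ↦ if f z = f y then f x else f z)

theorem redTest_redAdj {n : ℕ} {A : ℕ → ℕ → Bool} {G : SimpleGraph (Fin n)}
    (hA : ∀ i j : Fin n, G.Adj i j ↔ A i j = true) {f : ℕ → ℕ} {x y : Fin n}
    (h : redTest n A f x y = true) : G.RedAdj (Setoid.ker fun i : Fin n ↦ f i) x y := by
  simp only [redTest, Bool.and_eq_true, bne_iff_ne, List.any_eq_true, List.mem_range, beq_iff_eq,
    Bool.not_eq_true'] at h
  obtain ⟨⟨h1, a, ha, hax, b, hb, hby, hab⟩, a', ha', hax', b', hb', hby', hab'⟩ := h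
  refine ⟨h1, ⟨⟨a, ha⟩, ⟨b, hb⟩, hax.symm, hby.symm, (hA _ _).2 hab⟩,
    ⟨a', ha'⟩, ⟨b', hb'⟩, hax'.symm, hby'.symm, fun h ↦ ?_⟩
  rw [hA] at h
  simp [hab'] at h

theorem not_redLE_of_redDegreeTest {n : ℕ} {A : ℕ → ℕ → Bool} {G : SimpleGraph (Fin n)}
    (hA : ∀ i j : Fin n, G.Adj i j ↔ A i j = true) {two : Bool} {f : ℕ → ℕ}
    (h : redDegreeTest n A two f = true) :
    ¬RedLE two.toNat G (Setoid.ker fun i : Fin n ↦ f i) := by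
  intro hr
  simp only [redDegreeTest, List.any_eq_true, List.mem_range, Bool.and_eq_true, Bool.or_eq_true,
    Bool.not_eq_true', bne_iff_ne] at h
  obtain ⟨x, hx, y, hy, hxy, h⟩ := h
  obtain ⟨s, hs, hs'⟩ := hr ⟨x, hx⟩
  obtain ⟨z, hz, hzy⟩ := hs' ⟨y, hy⟩ (redTest_redAdj hA (x := ⟨x, hx⟩) (y := ⟨y, hy⟩) hxy)
  rcases h with rfl | ⟨w, hw, hwy, hxw⟩
  · simp only [Bool.toNat_false, nonpos_iff_eq_zero, Finset.card_eq_zero] at hs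
    simp [hs] at hz
  · have hw' : w < n := hw.trans hy
    obtain ⟨z', hz', hzw⟩ := hs' ⟨w, hw'⟩ (redTest_redAdj hA (x := ⟨x, hx⟩) (y := ⟨w, hw'⟩) hxw)
    have : z = z' := Finset.card_le_one.1 (hs.trans (Bool.toNat_le _)) z hz z' hz'
    subst this
    rw [Setoid.ker_def] at hzy hzw
    exact hwy (hzw.symm.trans hzy)

/-- The sequence is followed through the search tree: each merge of different parts is one of those
tried by the test, up to exchanging the two vertices, and a merge of equal parts uses no fuel. -/
theorem not_reducible_of_stuckTest {n : ℕ} {A : ℕ → ℕ → Bool} {G : SimpleGraph (Fin n)}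
    (hA : ∀ i j : Fin n, G.Adj i j ↔ A i j = true) {two : Bool} {r : Setoid (Fin n)}
    (hr : Reducible two.toNat G r) (k : ℕ) (f : ℕ → ℕ) (hf : r = Setoid.ker fun i : Fin n ↦ f i)
    (h : stuckTest n A two k f = true) : False := by
  induction hr generalizing k f with
  | @top r hr =>
    have hred := (Reducible.top (d := two.toNat) (G := G) hr).redLE
    subst hf
    cases k with
    | zero => exact not_redLE_of_redDegreeTest hA h hred
    | succ k =>
      simp only [stuckTest, Bool.or_eq_true, Bool.and_eq_true, List.any_eq_true, bne_iff_ne,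
        List.mem_range] at h
      rcases h with h | ⟨⟨x, hx, hx'⟩, -⟩
      · exact not_redLE_of_redDegreeTest hA h hred
      · exact hx' (hr ⟨x, hx⟩ ⟨0, by omega⟩)
  | @merge r x y hred _ ih =>
    subst hf
    by_cases hxy : f x = f y
    · refine ih k f ?_ h
      ext a b
      simp only [mergeParts_apply, Setoid.ker_def]
      grind
    · cases k with
      | zero => exact not_redLE_of_redDegreeTest hA h hred
      | succ k =>
        simp only [stuckTest, Bool.or_eq_true, Bool.and_eq_true, List.all_eq_true, beq_iff_eq,
          List.mem_range] at h
        rcases h with h | ⟨-, h⟩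
        · exact not_redLE_of_redDegreeTest hA h hred
        · rcases lt_trichotomy (x : ℕ) y with hlt | heq | hlt
          · refine ih k _ ?_ ((h y y.2 x hlt).resolve_left hxy)
            ext a b
            simp only [mergeParts_apply, Setoid.ker_def]
            grind
          · rw [heq] at hxy; exact hxy rfl
          · refine ih k _ ?_ ((h x x.2 y hlt).resolve_left (Ne.symm hxy))
            ext a b
            simp only [mergeParts_apply, Setoid.ker_def]
            grind

/-- The graph with vertices `0, 1, 2`, pendant vertices `3, 4, 5` attached to them, and a vertex
`6`; the flags give the edges `01`, `02`, `12` and `06`, `16`, `26`. -/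
def asteroidAdj (e₁ e₂ e₃ l₁ l₂ l₃ : Bool) (i j : ℕ) : Bool :=
  let m := min i j
  let k := max i j
  (k == m + 3 && m != 3) || (m == 0 && k == 1 && e₁) || (m == 0 && k == 2 && e₂) ||
    (m == 1 && k == 2 && e₃) || (m == 0 && k == 6 && l₁) || (m == 1 && k == 6 && l₂) ||
    (m == 2 && k == 6 && l₃)

/-- In the net every first contraction creates red degree two. In the graphs below this may happen
later; the fuel bounds the number of contractions after which it is certain. -/
theorem stuck_net : stuckTest 6 (asteroidAdj true true true false false false) true 1 id = true := by
  decide +kernel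

theorem stuck_spider :
    stuckTest 7 (asteroidAdj false false false true true true) true 2 id = true := by
  decide +kernel

theorem stuck_square :
    stuckTest 7 (asteroidAdj false true true true true false) true 4 id = true := by
  decide +kernel

theorem stuck_diamond :
    stuckTest 7 (asteroidAdj false true true true true true) true 4 id = true := by
  decide +kernel

theorem stuck_path :
    stuckTest 4 (fun i j ↦ i + 1 == j || j + 1 == i) false 1 id = true := by
  decide +kernel

theorem not_reducible_zero_of_not_isCograph {V : Type*} {G : SimpleGraph V} (h : ¬G.IsCograph) :
    ¬Reducible 0 G ⊥ := by
  intro hr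
  obtain ⟨f⟩ := not_isEmpty_iff.1 h
  refine not_reducible_of_stuckTest (two := false) (fun i j ↦ ?_) (hr.of_embedding f) 1 id ?_
    stuck_path
  · simp [pathGraph_adj]
  · ext a b
    simp [Setoid.ker_def, Fin.ext_iff]

/-- Three pairwise nonadjacent vertices `b i`, each with its own neighbour `a i`. -/
structure HasSpikes {V : Type*} (G : SimpleGraph V) (a b : Fin 3 → V) : Prop where
  adj_iff : ∀ i j, G.Adj (a i) (b j) ↔ i = j
  not_adj : ∀ i j, ¬G.Adj (b i) (b j)

/-- The graph has an induced net, spider, or one of two graphs that arise from a cycle of length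
four, with or without a chord, by attaching three pendant vertices. -/
def HasAsteroid {V : Type*} (G : SimpleGraph V) : Prop :=
  ∃ a b : Fin 3 → V, G.HasSpikes a b ∧ ((G.Adj (a 0) (a 1) ∧ G.Adj (a 0) (a 2) ∧ G.Adj (a 1) (a 2)) ∨
    ∃ l, (∀ i, ¬G.Adj l (b i)) ∧ G.Adj l (a 0) ∧ G.Adj l (a 1) ∧ ¬G.Adj (a 0) (a 1) ∧
      ((G.Adj (a 0) (a 2) ∧ G.Adj (a 1) (a 2)) ∨
        (G.Adj l (a 2) ∧ ¬G.Adj (a 0) (a 2) ∧ ¬G.Adj (a 1) (a 2))))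

variable {V W : Type*}

theorem HasAsteroid.of_embedding {G : SimpleGraph V} {H : SimpleGraph W} (f : G ↪g H)
    (h : G.HasAsteroid) : H.HasAsteroid := by
  obtain ⟨a, b, hab, h⟩ := h
  refine ⟨f ∘ a, f ∘ b, ⟨fun i j ↦ ?_, fun i j ↦ ?_⟩, ?_⟩
  · simpa using hab.adj_iff i j
  · simpa using hab.not_adj i j
  · rcases h with h | ⟨l, h⟩
    · left; simpa using h
    · right; exact ⟨f l, by simpa using h⟩

theorem not_reducible_of_stuck_embedding {G : SimpleGraph V} {n k : ℕ} {A : ℕ → ℕ → Bool}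
    (hs : stuckTest n A true k id = true) (e : Fin n → V) (he : Function.Injective e)
    (hA : ∀ i j : Fin n, i < j → (G.Adj (e i) (e j) ↔ A i j = true)) (hA' : ∀ i j, A i j = A j i)
    (hA'' : ∀ i, A i i = false) : ¬Reducible 1 G ⊥ := by
  intro hr
  have hr' : Reducible 1 (G.comap e) ⊥ := by
    have := hr.comap (G := G.comap e) e fun a b _ ↦ Iff.rfl
    convert this using 1
    ext a b
    simp [Setoid.comap_rel, he.eq_iff]
  refine not_reducible_of_stuckTest (two := true) (fun i j ↦ ?_) hr' k id ?_ hs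
  · rw [comap_adj]
    rcases lt_trichotomy i j with h | rfl | h
    · exact hA i j h
    · simp [hA'']
    · rw [G.adj_comm, hA j i h, hA']
  · ext a b
    simp [Setoid.ker_def, Fin.ext_iff]

theorem asteroidAdj_symm (e₁ e₂ e₃ l₁ l₂ l₃ : Bool) (i j : ℕ) :
    asteroidAdj e₁ e₂ e₃ l₁ l₂ l₃ i j = asteroidAdj e₁ e₂ e₃ l₁ l₂ l₃ j i := by
  simp only [asteroidAdj, min_comm i j, max_comm i j]

theorem asteroidAdj_self (e₁ e₂ e₃ l₁ l₂ l₃ : Bool) (i : ℕ) :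
    asteroidAdj e₁ e₂ e₃ l₁ l₂ l₃ i i = false := by
  simp only [asteroidAdj, min_self, max_self]
  grind

theorem HasSpikes.injective {G : SimpleGraph V} {a b : Fin 3 → V} (h : G.HasSpikes a b) :
    (∀ i j, a i = a j → i = j) ∧ (∀ i j, b i = b j → i = j) ∧ ∀ i j, a i ≠ b j := by
  refine ⟨fun i j hij ↦ ?_, fun i j hij ↦ ?_, fun i j hij ↦ ?_⟩
  · exact (h.adj_iff i j).1 (hij ▸ (h.adj_iff j j).2 rfl)
  · exact (h.adj_iff i j).1 (hij ▸ (h.adj_iff i i).2 rfl)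
  · exact h.not_adj j i (hij ▸ (h.adj_iff i i).2 rfl)

theorem HasAsteroid.not_reducible_one {G : SimpleGraph V} (h : G.HasAsteroid) :
    ¬Reducible 1 G ⊥ := by
  obtain ⟨a, b, hab, h⟩ := h
  obtain ⟨ia, ib, iab⟩ := hab.injective
  have n1 := hab.adj_iff
  have n2 := hab.not_adj
  have n3 := G.adj_comm
  rcases h with ⟨h1, h2, h3⟩ | ⟨l, hl, hl0, hl1, h01, h⟩
  · refine not_reducible_of_stuck_embedding stuck_net ![a 0, a 1, a 2, b 0, b 1, b 2] ?_ ?_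
      (asteroidAdj_symm _ _ _ _ _ _) (asteroidAdj_self _ _ _ _ _ _)
    · intro i j hij
      fin_cases i <;> fin_cases j <;> simp at hij ⊢ <;> grind
    · intro i j hij
      fin_cases i <;> fin_cases j <;> simp [asteroidAdj] at hij ⊢ <;> grind
  · have hla : ∀ i, l ≠ a i := fun i hi ↦ hl i (hi ▸ (n1 i i).2 rfl)
    -- A tip `b i` has only one neighbour among the `a j`, whereas `l` is adjacent to both `a 0` and
    -- `a 1`.
    have hlb : ∀ i, l ≠ b i := fun i hi ↦ by
      rw [hi, n3, n1] at hl0 hl1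
      grind
    have inj : Function.Injective ![a 0, a 1, a 2, b 0, b 1, b 2, l] := by
      intro i j hij
      fin_cases i <;> fin_cases j <;> simp at hij ⊢ <;> grind
    rcases h with ⟨h02, h12⟩ | ⟨hl2, h02, h12⟩
    · by_cases hl2 : G.Adj l (a 2)
      · refine not_reducible_of_stuck_embedding stuck_diamond _ inj ?_
          (asteroidAdj_symm _ _ _ _ _ _) (asteroidAdj_self _ _ _ _ _ _)
        intro i j hij
        fin_cases i <;> fin_cases j <;> simp [asteroidAdj] at hij ⊢ <;> grind
      · refine not_reducible_of_stuck_embedding stuck_square _ inj ?_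
          (asteroidAdj_symm _ _ _ _ _ _) (asteroidAdj_self _ _ _ _ _ _)
        intro i j hij
        fin_cases i <;> fin_cases j <;> simp [asteroidAdj] at hij ⊢ <;> grind
    · refine not_reducible_of_stuck_embedding stuck_spider _ inj ?_
        (asteroidAdj_symm _ _ _ _ _ _) (asteroidAdj_self _ _ _ _ _ _)
      intro i j hij
      fin_cases i <;> fin_cases j <;> simp [asteroidAdj] at hij ⊢ <;> grind

/-- The listed vertices need not be distinct, so the walk is shortened to a path inside its support.
-/
theorem PathNotDominating.of_adj₃ {G : SimpleGraph V} {a b c v w : V} (h1 : G.Adj a v)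
    (h2 : G.Adj v w) (h3 : G.Adj w b) (h : ∀ x ∈ [a, v, w, b], x ≠ c ∧ ¬G.Adj x c) :
    G.PathNotDominating a b c := by
  classical
  refine ⟨(Walk.cons h1 (.cons h2 (.cons h3 .nil))).bypass, Walk.bypass_isPath _, fun x hx ↦ h x ?_⟩
  simpa using Walk.support_bypass_subset_support _ hx

theorem PathNotDominating.of_adj₄ {G : SimpleGraph V} {a b c u v w : V} (h1 : G.Adj a u)
    (h2 : G.Adj u v) (h3 : G.Adj v w) (h4 : G.Adj w b)
    (h : ∀ x ∈ [a, u, v, w, b], x ≠ c ∧ ¬G.Adj x c) :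
    G.PathNotDominating a b c := by
  classical
  refine ⟨(Walk.cons h1 (.cons h2 (.cons h3 (.cons h4 .nil)))).bypass, Walk.bypass_isPath _,
    fun x hx ↦ h x ?_⟩
  simpa using Walk.support_bypass_subset_support _ hx

/-- The tips `b i` form an asteroidal triple: two of them are joined through their neighbours `a i`
and `a j`, by way of `l` where these are not adjacent, and the third tip has no neighbour on this
walk. -/
theorem HasAsteroid.not_isATFree {G : SimpleGraph V} (h : G.HasAsteroid) : ¬G.IsATFree := by
  obtain ⟨a, b, hab, h⟩ := h
  obtain ⟨ia, ib, iab⟩ := hab.injective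
  have n1 := hab.adj_iff
  have n2 := hab.not_adj
  have n3 := G.adj_comm
  have n4 : ∀ i, G.Adj (a i) (b i) := fun i ↦ (n1 i i).2 rfl
  have n5 : ∀ i, G.Adj (b i) (a i) := fun i ↦ (n4 i).symm
  intro hG
  refine hG (b 0) (b 1) (b 2) ⟨by grind, by grind, by grind, ?_⟩
  rcases h with ⟨h1, h2, h3⟩ | ⟨l, hl, hl0, hl1, h01, h⟩
  · exact ⟨.of_adj₃ (n5 0) h1 (n4 1) (by simp; grind), .of_adj₃ (n5 0) h2 (n4 2) (by simp; grind),
      .of_adj₃ (n5 1) h3 (n4 2) (by simp; grind)⟩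
  · have hla : ∀ i, l ≠ a i := fun i hi ↦ hl i (hi ▸ (n1 i i).2 rfl)
    have hlb : ∀ i, l ≠ b i := fun i hi ↦ by
      rw [hi, n3, n1] at hl0 hl1
      grind
    refine ⟨.of_adj₄ (n5 0) hl0.symm hl1 (n4 1) (by simp; grind), ?_⟩
    rcases h with ⟨h02, h12⟩ | ⟨hl2, h02, h12⟩
    · exact ⟨.of_adj₃ (n5 0) h02 (n4 2) (by simp; grind), .of_adj₃ (n5 1) h12 (n4 2) (by simp; grind)⟩
    · exact ⟨.of_adj₄ (n5 0) hl0.symm hl2 (n4 2) (by simp; grind),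
        .of_adj₄ (n5 1) hl1.symm hl2 (n4 2) (by simp; grind)⟩

end LowerBounds


/-! ### Cographs: bipartitions and twins -/

section Cographs

variable {V : Type*}

/-- The vertices `a, b, c, d` form an induced path in this order. -/
def IsPathFour (G : SimpleGraph V) (a b c d : V) : Prop :=
  G.Adj a b ∧ G.Adj b c ∧ G.Adj c d ∧ ¬G.Adj a c ∧ ¬G.Adj b d ∧ ¬G.Adj a d

/-- No induced path on four vertices has all its vertices in `S`. -/
def IsCographOn (G : SimpleGraph V) (S : Set V) : Prop :=
  ∀ a ∈ S, ∀ b ∈ S, ∀ c ∈ S, ∀ d ∈ S, ¬G.IsPathFour a b c d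

theorem isCograph_iff {G : SimpleGraph V} : G.IsCograph ↔ ∀ a b c d, ¬G.IsPathFour a b c d := by
  constructor
  · rintro h a b c d ⟨h1, h2, h3, h4, h5, h6⟩
    have n := G.adj_comm
    refine h.elim ⟨⟨![a, b, c, d], ?_⟩, ?_⟩
    · intro i j hij
      fin_cases i <;> fin_cases j <;> simp at hij ⊢ <;> grind
    · intro i j
      change G.Adj (![a, b, c, d] i) (![a, b, c, d] j) ↔ _
      rw [pathGraph_adj]
      fin_cases i <;> fin_cases j <;> simp <;> grind
  · refine fun h ↦ ⟨fun f ↦ h (f 0) (f 1) (f 2) (f 3) ⟨?_, ?_, ?_, ?_, ?_, ?_⟩⟩ <;>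
      simp [pathGraph_adj]

theorem IsCograph.isCographOn {G : SimpleGraph V} (h : G.IsCograph) (S : Set V) :
    G.IsCographOn S := fun a _ b _ c _ d _ ↦ isCograph_iff.1 h a b c d

theorem IsCographOn.mono {G : SimpleGraph V} {S T : Set V} (h : G.IsCographOn T) (hST : S ⊆ T) :
    G.IsCographOn S :=
  fun a ha b hb c hc d hd ↦ h a (hST ha) b (hST hb) c (hST hc) d (hST hd)

theorem IsCographOn.compl {G : SimpleGraph V} {S : Set V} (h : G.IsCographOn S) :
    Gᶜ.IsCographOn S := by
  rintro a ha b hb c hc d hd ⟨h1, h2, h3, h4, h5, h6⟩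
  have n := G.adj_comm
  simp only [compl_adj] at h1 h2 h3 h4 h5 h6
  -- The complement of the path `a b c d` is the path `b d a c`.
  exact h b hb d hd a ha c hc (by unfold IsPathFour; grind)

/-- Two disjoint nonempty sets without edges between them, which together with one more vertex `v`
span a cograph: some bipartition has no edges or all edges between its sides. -/
theorem IsCographOn.exists_bipartition_of_not_adj {G : SimpleGraph V} {A B : Set V} {v : V}
    (h : G.IsCographOn (insert v (A ∪ B))) (hA : A.Nonempty) (hB : B.Nonempty) (hv : v ∉ A ∪ B)
    (hAB : ∀ a ∈ A, ∀ b ∈ B, ¬G.Adj a b) (hAB' : Disjoint A B) :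
    ∃ K ⊆ insert v (A ∪ B), K.Nonempty ∧ (∃ x ∈ insert v (A ∪ B), x ∉ K) ∧
      ((∀ a ∈ K, ∀ b ∈ insert v (A ∪ B), b ∉ K → G.Adj a b) ∨
        ∀ a ∈ K, ∀ b ∈ insert v (A ∪ B), b ∉ K → ¬G.Adj a b) := by
  have n := G.adj_comm
  by_cases hall : ∀ a ∈ A ∪ B, G.Adj v a
  · obtain ⟨a, ha⟩ := hA
    exact ⟨{v}, by simp, by simp, ⟨a, by simp [ha], by rintro rfl; exact hv (Or.inl ha)⟩, Or.inl (by
      rintro _ rfl b hb hbv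
      exact hall b (hb.resolve_left hbv))⟩
  push Not at hall
  obtain ⟨x, hx, hvx⟩ := hall
  let R : V → V → Prop := fun y z ↦ G.Adj y z ∧ z ∈ A ∪ B ∧ ¬G.Adj v z
  have hK : ∀ y, Relation.ReflTransGen R x y → y ∈ A ∪ B ∧ ¬G.Adj v y := by
    intro y hy
    cases hy with
    | refl => exact ⟨hx, hvx⟩
    | tail _ h => exact h.2
  -- If an edge joins a non-neighbour `y` of `v` to a neighbour `z`, then `v` has no neighbour `b`
  -- on the other side, since `y z v b` would be an induced path; so that side has no edges to the
  -- rest. If there is no such edge, the set reached from `x` by `R` has none.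
  by_cases hex : ∃ y z, y ∈ A ∪ B ∧ z ∈ A ∪ B ∧ G.Adj y z ∧ ¬G.Adj v y ∧ G.Adj v z
  · obtain ⟨y, z, hy, hz, hyz, hvy, hvz⟩ := hex
    have key : ∀ A B : Set V, A.Nonempty → B.Nonempty → v ∉ A ∪ B → Disjoint A B →
        (∀ a ∈ A, ∀ b ∈ B, ¬G.Adj a b) → G.IsCographOn (insert v (A ∪ B)) → y ∈ A → z ∈ A →
        ∃ K ⊆ insert v (A ∪ B), K.Nonempty ∧ (∃ x ∈ insert v (A ∪ B), x ∉ K) ∧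
          ((∀ a ∈ K, ∀ b ∈ insert v (A ∪ B), b ∉ K → G.Adj a b) ∨
            ∀ a ∈ K, ∀ b ∈ insert v (A ∪ B), b ∉ K → ¬G.Adj a b) := by
      intro A B hA hB hv hd hAB h hy hz
      refine ⟨B, fun b hb ↦ Or.inr (Or.inr hb), hB, ⟨v, by simp, fun h ↦ hv (Or.inr h)⟩,
        Or.inr fun b hb c hc hcB hbc ↦ ?_⟩
      rcases hc with rfl | hc | hc
      · exact h y (by simp [hy]) z (by simp [hz]) c (by simp) b (by simp [hb])
          ⟨hyz, hvz.symm, hbc.symm, fun h ↦ hvy h.symm, hAB z hz b hb, hAB y hy b hb⟩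
      · exact hAB c hc b hb hbc.symm
      · exact hcB hc
    have hAB2 : ∀ b ∈ B, ∀ a ∈ A, ¬G.Adj b a := fun b hb a ha h ↦ hAB a ha b hb h.symm
    rcases hy with hy | hy <;> rcases hz with hz | hz
    · exact key A B hA hB hv hAB' hAB h hy hz
    · exact (hAB y hy z hz hyz).elim
    · exact (hAB z hz y hy hyz.symm).elim
    · rw [Set.union_comm] at hv h ⊢
      exact key B A hB hA hv hAB'.symm hAB2 h hy hz
  · push Not at hex
    refine ⟨{y | Relation.ReflTransGen R x y}, fun y hy ↦ Or.inr (hK y hy).1, ⟨x, .refl⟩,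
      ⟨v, by simp, fun h ↦ hv (hK v h).1⟩, Or.inr fun y hy z hz hzK hyz ↦ ?_⟩
    rcases hz with rfl | hz
    · exact (hK y hy).2 hyz.symm
    · exact hzK (hy.tail ⟨hyz, hz, hex y z (hK y hy).1 hz hyz (hK y hy).2⟩)

/-- The vertices of a cograph have a bipartition with all edges or no edges between its sides. -/
theorem IsCographOn.exists_bipartition {G : SimpleGraph V} (S : Finset V) (hS : 2 ≤ S.card)
    (h : G.IsCographOn S) : ∃ K : Set V, K ⊆ S ∧ K.Nonempty ∧ (∃ x ∈ S, x ∉ K) ∧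
      ((∀ a ∈ K, ∀ b ∈ S, b ∉ K → G.Adj a b) ∨ ∀ a ∈ K, ∀ b ∈ S, b ∉ K → ¬G.Adj a b) := by
  classical
  induction S using Finset.induction_on with
  | empty => simp at hS
  | insert v S hv ih =>
    rw [Finset.card_insert_of_notMem hv] at hS
    by_cases hS' : 2 ≤ S.card
    · obtain ⟨K, hKS, hK, ⟨x, hx, hxK⟩, hor⟩ := ih hS' (h.mono (by simp))
      have hU : (K ∪ {b | b ∈ S ∧ b ∉ K}) = (S : Set V) := by
        ext b
        simp only [Set.mem_union, Set.mem_ofPred_eq, Finset.mem_coe]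
        have := @hKS b
        simp only [Finset.mem_coe] at this
        tauto
      have hdis : Disjoint K {b | b ∈ S ∧ b ∉ K} := by
        rw [Set.disjoint_left]
        exact fun b hb hb' ↦ hb'.2 hb
      have hv' : v ∉ K ∪ {b | b ∈ S ∧ b ∉ K} := by rw [hU]; simpa using hv
      have hne : {b | b ∈ S ∧ b ∉ K}.Nonempty := ⟨x, hx, hxK⟩
      -- If all edges are present between the sides, the complement is considered, in which there
      -- are none.
      rcases hor with hor | hor
      · have h' : Gᶜ.IsCographOn (insert v (K ∪ {b | b ∈ S ∧ b ∉ K})) := by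
          rw [hU]; simpa using h.compl
        obtain ⟨L, hL, hL', hL'', hor⟩ := h'.exists_bipartition_of_not_adj hK hne hv'
          (fun a ha b hb hab ↦ by
            rw [compl_adj] at hab
            exact hab.2 (hor a ha b hb.1 hb.2)) hdis
        rw [hU] at hL hL'' hor
        refine ⟨L, by simpa using hL, hL', by simpa using hL'', hor.symm.imp ?_ ?_⟩
        · intro h a ha b hb hbL
          have := h a ha b (by simpa using hb) hbL
          rw [compl_adj] at this
          by_contra hab
          exact this ⟨by rintro rfl; exact hbL ha, hab⟩
        · intro h a ha b hb hbL
          have := h a ha b (by simpa using hb) hbL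
          rw [compl_adj] at this
          exact this.2
      · have h' : G.IsCographOn (insert v (K ∪ {b | b ∈ S ∧ b ∉ K})) := by
          rw [hU]; simpa using h
        obtain ⟨L, hL, hL', hL'', hor⟩ := h'.exists_bipartition_of_not_adj hK hne hv'
          (fun a ha b hb ↦ hor a ha b hb.1 hb.2) hdis
        rw [hU] at hL hL'' hor
        exact ⟨L, by simpa using hL, hL', by simpa using hL'', by simpa using hor⟩
    · obtain ⟨w, rfl⟩ := Finset.card_eq_one.1 (by omega : S.card = 1)
      simp only [Finset.mem_singleton] at hv
      refine ⟨{v}, by simp, by simp, ⟨w, by simp, by simpa using Ne.symm hv⟩, ?_⟩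
      by_cases hvw : G.Adj v w
      · left; rintro _ rfl b hb hb'
        simp only [Finset.mem_insert, Finset.mem_singleton] at hb hb'
        grind
      · right; rintro _ rfl b hb hb'
        simp only [Finset.mem_insert, Finset.mem_singleton] at hb hb'
        grind

/-- A side of the bipartition with at least two vertices contains twins by induction, and they
remain twins because a vertex of the other side sees all of this side or nothing of it. If both
sides are singletons, their two vertices are twins. -/
theorem IsCographOn.exists_twins {G : SimpleGraph V} (S : Finset V) (hS : 2 ≤ S.card)
    (h : G.IsCographOn S) :
    ∃ u ∈ S, ∃ v ∈ S, u ≠ v ∧ ∀ w ∈ S, w ≠ u → w ≠ v → (G.Adj u w ↔ G.Adj v w) := by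
  classical
  induction S using Finset.strongInduction with
  | H S ih =>
    have n := G.adj_comm
    obtain ⟨K, hKS, hK, ⟨x, hx, hxK⟩, hor⟩ := h.exists_bipartition S hS
    have hor' : ∀ a ∈ S, ∀ b ∈ S, ∀ c ∈ S, (a ∈ K ↔ b ∈ K) → ¬(a ∈ K ↔ c ∈ K) →
        (G.Adj a c ↔ G.Adj b c) := by
      intro a ha b hb c hc hab hac
      rcases hor with hor | hor
      · have := hor a; have := hor b; have := hor c
        grind
      · have := hor a; have := hor b; have := hor c
        grind
    have hK' : ∀ y, y ∈ K → y ∈ S := fun y hy ↦ hKS hy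
    obtain ⟨y, hy⟩ := hK
    have key : ∀ p : V → Prop, (∀ a ∈ S, ∀ b ∈ S, (p a ↔ p b) ↔ (a ∈ K ↔ b ∈ K)) →
        (∃ z ∈ S, ¬p z) → 2 ≤ (S.filter p).card →
        ∃ u ∈ S, ∃ v ∈ S, u ≠ v ∧ ∀ w ∈ S, w ≠ u → w ≠ v → (G.Adj u w ↔ G.Adj v w) := by
      rintro p hp ⟨z, hz, hzp⟩ hc
      have hss : S.filter p ⊂ S := Finset.filter_ssubset.2 ⟨z, hz, hzp⟩
      obtain ⟨u, hu, v, hv, huv, h'⟩ := ih _ hss hc (h.mono (Finset.coe_subset.2 hss.1))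
      simp only [Finset.mem_filter] at hu hv h'
      refine ⟨u, hu.1, v, hv.1, huv, fun w hw hwu hwv ↦ ?_⟩
      by_cases hpw : p w
      · exact h' w ⟨hw, hpw⟩ hwu hwv
      · refine hor' u hu.1 v hv.1 w hw ((hp u hu.1 v hv.1).1 (by simp [hu, hv])) ?_
        rw [← hp u hu.1 w hw]
        simp [hu.2, hpw]
    by_cases h1 : 2 ≤ (S.filter (· ∈ K)).card
    · exact key (· ∈ K) (fun a _ b _ ↦ Iff.rfl) ⟨x, hx, hxK⟩ h1
    by_cases h2 : 2 ≤ (S.filter (· ∉ K)).card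
    · exact key (· ∉ K) (fun a _ b _ ↦ by tauto) ⟨y, hK' y hy, by simpa using hy⟩ (by convert h2)
    refine ⟨x, hx, y, hK' y hy, by rintro rfl; exact hxK hy, fun w hw hwx hwy ↦ ?_⟩
    exfalso
    by_cases hwK : w ∈ K
    · exact hwy (Finset.card_le_one.1 (by omega : (S.filter (· ∈ K)).card ≤ 1) w (by simp [hw, hwK])
        y (by simp [hK' y hy, hy]))
    · exact hwx (Finset.card_le_one.1 (by omega : (S.filter (· ∉ K)).card ≤ 1) w (by simp [hw, hwK])
        x (by simp [hx, hxK]))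

theorem IsCographOn.induce_iff {G : SimpleGraph V} {S : Set V} {T : Set S} :
    (G.induce S).IsCographOn T ↔ G.IsCographOn (Subtype.val '' T) := by
  simp [IsCographOn, IsPathFour]

theorem IsCograph.reducible [Finite V] {G : SimpleGraph V} (h : G.IsCograph) :
    Reducible 0 G ⊥ := by
  obtain ⟨n, hn⟩ : ∃ n, Nat.card V = n := ⟨_, rfl⟩
  induction n generalizing V with
  | zero =>
    have := (Nat.card_eq_zero.1 hn).resolve_right (not_infinite_iff_finite.2 ‹_›)
    exact .top fun x ↦ this.elim x
  | succ n ih =>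
    have := Fintype.ofFinite V
    by_cases hV : 2 ≤ (Finset.univ : Finset V).card
    · obtain ⟨u, -, v, -, huv, h'⟩ := (h.isCographOn (Finset.univ : Finset V)).exists_twins _ hV
      refine .of_twins (u := u) (v := v) ⟨huv, fun w ↦ h' w (Finset.mem_univ w)⟩ (ih ?_ ?_)
      · rw [isCograph_iff] at h ⊢
        exact fun a b c d h' ↦ h a b c d h'
      · have : {x : V | x ≠ v} = {v}ᶜ := rfl
        rw [Nat.card_coe_set_eq, this, Set.ncard_compl, hn, Set.ncard_singleton]
        rfl
    · refine .top fun x y ↦ ?_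
      rw [Finset.card_le_one.1 (by omega : (Finset.univ : Finset V).card ≤ 1) x (Finset.mem_univ _) y
        (Finset.mem_univ _)]

end Cographs


/-! ### Distance-hereditary graphs have twins or a pendant vertex -/

section DistanceHereditary

variable {V : Type*}

/-- The distance in `G.induce S` lies between the distance in `G` and that in the subgraph induced
on `T`, and these two agree. -/
theorem IsDistanceHereditary.induce {G : SimpleGraph V} (h : G.IsDistanceHereditary) (S : Set V) :
    (G.induce S).IsDistanceHereditary := by
  intro T hT u v
  let f : ((G.induce S).induce T) ≃g (G.induce (Subtype.val '' T)) :=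
    { toEquiv := Equiv.Set.image (Subtype.val : S → V) T Subtype.val_injective
      map_rel_iff' := by intro a b; rfl }
  have hT' : (G.induce (Subtype.val '' T)).Connected := f.connected_iff.1 hT
  have h1 : (G.induce (Subtype.val '' T)).dist (f u) (f v) = G.dist u v := h _ hT' (f u) (f v)
  have h2 : ((G.induce S).induce T).dist u v ≤ G.dist u v := by
    rw [← h1]
    obtain ⟨p, hp⟩ := hT'.exists_walk_length_eq_dist (f u) (f v)
    rw [← hp]
    have := dist_le (p.map f.symm.toHom)
    rw [Walk.length_map] at this
    have e : ∀ w, f.symm.toHom (f w) = w := f.symm_apply_apply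
    rwa [e, e] at this
  have hr : (G.induce S).Reachable u v := (hT u v).map (Embedding.induce T).toHom
  have h3 : (G.induce S).dist u v ≤ ((G.induce S).induce T).dist u v := by
    obtain ⟨p, hp⟩ := hT.exists_walk_length_eq_dist u v
    rw [← hp]
    have := dist_le (p.map (Embedding.induce T).toHom)
    rw [Walk.length_map] at this
    exact this
  have h4 : G.dist u v ≤ (G.induce S).dist u v := by
    obtain ⟨p, hp⟩ := hr.exists_walk_length_eq_dist
    rw [← hp]
    have := dist_le (p.map (Embedding.induce S).toHom)
    rw [Walk.length_map] at this
    exact this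
  omega

/-- In a connected induced subgraph every vertex has a neighbour that is closer to a given one. -/
theorem IsDistanceHereditary.exists_adj_closer {G : SimpleGraph V} (h : G.IsDistanceHereditary)
    {H : Set V} (hH : (G.induce H).Connected) {r v : V} (hr : r ∈ H) (hv : v ∈ H) (hrv : r ≠ v) :
    ∃ w ∈ H, G.Adj v w ∧ G.dist r w + 1 = G.dist r v := by
  obtain ⟨p, hp⟩ := hH.exists_walk_length_eq_dist ⟨v, hv⟩ ⟨r, hr⟩
  have hd := h H hH ⟨v, hv⟩ ⟨r, hr⟩
  cases p with
  | nil => exact (hrv rfl).elim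
  | @cons _ w _ hvw q =>
    refine ⟨w, w.2, hvw, ?_⟩
    have h1 : (G.induce H).dist w ⟨r, hr⟩ ≤ q.length := dist_le q
    have h2 := h H hH w ⟨r, hr⟩
    simp only [Walk.length_cons] at hp
    have h3 : G.dist r v ≤ G.dist r w + 1 := by
      have hvw' : G.Adj v w := hvw
      have := hvw'.symm.diff_dist_adj (u := r)
      omega
    rw [dist_comm (u := v), dist_comm] at hd
    rw [dist_comm (u := (w : V))] at h2
    simp only [dist_comm (v := (⟨r, hr⟩ : H))] at *
    omega

variable {G : SimpleGraph V}

/-- Vertices are arranged in levels by their distance from `r`. Let `B` be the set of vertices below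
level `j` that are not adjacent to `v`. It is connected, as the next vertex on a shortest path to
`r` lies below level `j - 1` and so is not adjacent to `v`. If `p` were in `B`, then `B ∪ X` would
be connected through the edge `p u`, and `v` would have in it a neighbour in level `j - 1`; but `X`
has no vertex there and `B` no neighbour of `v`. -/
theorem IsDistanceHereditary.adj_of_adj_lower (h : G.IsDistanceHereditary) (hc : G.Connected)
    {r u v p : V} {j : ℕ} {X : Set V} (hX : (G.induce X).Connected) (hXj : ∀ w ∈ X, j ≤ G.dist r w)
    (hu : u ∈ X) (hv : v ∈ X) (hvj : G.dist r v = j) (hp : G.dist r p < j) (hpu : G.Adj p u) :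
    G.Adj p v := by
  by_contra hpv
  let B : Set V := {w | G.dist r w < j ∧ ¬G.Adj w v}
  have hpB : p ∈ B := ⟨hp, hpv⟩
  have hrB : r ∈ B := by
    refine ⟨by rw [dist_self]; omega, fun hrv ↦ ?_⟩
    rw [← dist_eq_one_iff_adj] at hrv
    have : G.dist r p = 0 := by omega
    rw [hc.dist_eq_zero_iff] at this
    subst this
    exact hpv (dist_eq_one_iff_adj.1 hrv)
  have huniv : (G.induce Set.univ).Connected := (induceUnivIso G).connected_iff.2 hc
  have hB : (G.induce B).Connected := by
    rw [connected_iff_exists_forall_reachable]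
    refine ⟨⟨r, hrB⟩, ?_⟩
    have : ∀ n, ∀ w (hw : w ∈ B), G.dist r w = n → (G.induce B).Reachable ⟨r, hrB⟩ ⟨w, hw⟩ := by
      intro n
      induction n with
      | zero =>
        intro w hw hwn
        rw [hc.dist_eq_zero_iff] at hwn
        subst hwn
        exact Reachable.refl _
      | succ n ih =>
        intro w hw hwn
        obtain ⟨w', -, hww', hw'⟩ := h.exists_adj_closer huniv (Set.mem_univ r) (Set.mem_univ w)
          (by rintro rfl; simp at hwn)
        have hw'B : w' ∈ B := by
          have := hw.1
          refine ⟨by omega, fun hadj ↦ ?_⟩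
          have := hadj.diff_dist_adj (u := r)
          omega
        have hadj : (G.induce B).Adj ⟨w', hw'B⟩ ⟨w, hw⟩ := hww'.symm
        exact (ih w' hw'B (by omega)).trans hadj.reachable
    rintro ⟨w, hw⟩
    exact this _ w hw rfl
  have hBX := connected_induce_union hB.preconnected hX.preconnected hpB hu hpu
  obtain ⟨w, hw, hvw, hwd⟩ := h.exists_adj_closer hBX (Or.inl hrB) (Or.inr hv)
    (by rintro rfl; simp at hvj; omega)
  rcases hw with hw | hw
  · exact hw.2 hvw.symm
  · have := hXj w hw
    omega

theorem IsDistanceHereditary.adj_iff_of_adj (h : G.IsDistanceHereditary) (hc : G.Connected)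
    {r u v p : V} (huv : G.Adj u v) (hd : G.dist r u = G.dist r v) (hp : G.dist r p < G.dist r v) :
    G.Adj p u ↔ G.Adj p v := by
  have hX := induce_pair_connected_of_adj huv
  have hXj : ∀ w ∈ ({u, v} : Set V), G.dist r v ≤ G.dist r w := by
    rintro w (rfl | rfl) <;> omega
  exact ⟨fun h' ↦ h.adj_of_adj_lower hc hX hXj (by simp) (by simp) rfl hp h',
    fun h' ↦ h.adj_of_adj_lower hc hX hXj (by simp) (by simp) hd hp h'⟩

theorem connected_induce_of_walk {H : Set V} {u v : V} (p : G.Walk u v)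
    (hp : ∀ w, w ∈ p.support ↔ w ∈ H) : (G.induce H).Connected := by
  have : H = {w | w ∈ p.support} := by ext w; exact (hp w).symm
  rw [this]
  exact p.connected_induce_support

theorem IsDistanceHereditary.adj_of_common_upper (h : G.IsDistanceHereditary) (hc : G.Connected)
    {r u v x p : V} (hxu : G.Adj x u) (hxv : G.Adj x v) (hd : G.dist r u = G.dist r v)
    (hdx : G.dist r u ≤ G.dist r x)
    (hp : G.dist r p < G.dist r u) (hpu : G.Adj p u) : G.Adj p v := by
  refine h.adj_of_adj_lower hc (X := {u, x, v}) (r := r) (j := G.dist r u) ?_ ?_ (by simp) (by simp)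
    hd.symm hp hpu
  · exact connected_induce_of_walk (.cons hxu.symm (.cons hxv .nil)) (by simp)
  · rintro w (rfl | rfl | rfl) <;> omega

/-- A vertex dominates no induced path on four vertices. -/
theorem IsDistanceHereditary.isCographOn (h : G.IsDistanceHereditary) {x : V} {M : Set V}
    (hM : ∀ m ∈ M, G.Adj x m) : G.IsCographOn M := by
  rintro a ha b hb c hc d hd ⟨h1, h2, h3, h4, h5, h6⟩
  have hconn : (G.induce {a, b, c, d}).Connected :=
    connected_induce_of_walk (.cons h1 (.cons h2 (.cons h3 .nil))) (by simp)
  have hne : d ≠ a := by rintro rfl; exact h4 h3.symm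
  obtain ⟨w, hw, haw, hwd⟩ := h.exists_adj_closer hconn (r := d) (v := a) (by simp) (by simp) hne
  have hwb : w = b := by
    rcases hw with rfl | rfl | rfl | rfl
    · exact (G.loopless.irrefl _ haw).elim
    · rfl
    · exact (h4 haw).elim
    · exact (h6 haw).elim
  subst hwb
  have h7 : G.dist d a ≤ 2 := dist_le (.cons (hM d hd).symm (.cons (hM a ha) .nil))
  have h8 : w ≠ d := by rintro rfl; exact h6 h1
  have hr : G.Reachable d w := ⟨.cons h3.symm (.cons h2.symm .nil)⟩
  have h9 := hr.one_lt_dist_of_ne_of_not_adj h8.symm (fun h ↦ h5 h.symm)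
  omega

/-- If the lower neighbourhoods of `x` and `y` crossed, a vertex `z` below the common neighbour `p`
would be adjacent to `u` and `v`. In the connected set `{x, u, z, v, y}` the vertex `x` has no
neighbour but `u`, and `u` is not adjacent to `y`, so the distance from `x` to `y` is at least three
there; through `p` it is two. -/
theorem IsDistanceHereditary.lower_nested (h : G.IsDistanceHereditary) (hc : G.Connected)
    {r x y p u v : V} {k : ℕ} (hx : G.dist r x = k + 1) (hy : G.dist r y = k + 1)
    (hp : G.dist r p = k) (hu : G.dist r u = k) (hv : G.dist r v = k)
    (hpx : G.Adj x p) (hpy : G.Adj y p) (hux : G.Adj x u) (huy : ¬G.Adj y u) (hvy : G.Adj y v) :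
    G.Adj x v := by
  by_contra hvx
  have hxy : ¬G.Adj x y := fun hxy ↦ huy
    ((h.adj_iff_of_adj hc hxy (r := r) (p := u) (by omega) (by omega)).1 hux.symm).symm
  have huniv : (G.induce Set.univ).Connected := (induceUnivIso G).connected_iff.2 hc
  have hrp : r ≠ p := by
    rintro rfl
    rw [dist_self] at hp
    subst hp
    rw [hc.dist_eq_zero_iff] at hu
    subst hu
    exact huy hpy
  obtain ⟨z, -, hpz, hz⟩ := h.exists_adj_closer huniv (Set.mem_univ r) (Set.mem_univ p) hrp
  have hzu : G.Adj z u :=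
    h.adj_of_common_upper hc (r := r) hpx hux (by omega) (by omega) (by omega) hpz.symm
  have hzv : G.Adj z v :=
    h.adj_of_common_upper hc (r := r) hpy hvy (by omega) (by omega) (by omega) hpz.symm
  have hconn : (G.induce {x, u, z, v, y}).Connected :=
    connected_induce_of_walk (.cons hux (.cons hzu.symm (.cons hzv (.cons hvy.symm .nil))))
      (by simp)
  have hne : y ≠ x := by rintro rfl; exact huy hux
  obtain ⟨w, hw, hxw, hwd⟩ := h.exists_adj_closer hconn (r := y) (v := x) (by simp) (by simp) hne
  have hwu : w = u := by
    rcases hw with rfl | rfl | rfl | rfl | rfl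
    · exact (G.loopless.irrefl _ hxw).elim
    · rfl
    · have := hxw.diff_dist_adj (u := r); omega
    · exact (hvx hxw).elim
    · exact (hxy hxw).elim
  subst hwu
  have h7 : G.dist y x ≤ 2 := dist_le (.cons hpy (.cons hpx.symm .nil))
  have h8 : y ≠ w := by rintro rfl; omega
  have h9 := hc.one_lt_dist_of_ne_of_not_adj h8 huy
  omega

/-- A vertex `z` below `u` is adjacent to `v` and `w` as well. If `v` and `w` were not adjacent,
then `w z v x` would be an induced path of length three, although `w` and `x` have the common
neighbour `u`. -/
theorem IsDistanceHereditary.lower_homogeneous (h : G.IsDistanceHereditary) (hc : G.Connected)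
    {r x w u v : V} {k : ℕ} (hx : G.dist r x = k + 1)
    (hw : G.dist r w = k) (hu : G.dist r u = k) (hv : G.dist r v = k)
    (hux : G.Adj x u) (hvx : G.Adj x v) (hwx : ¬G.Adj x w) (huw : G.Adj u w) : G.Adj v w := by
  by_contra hvw
  have huniv : (G.induce Set.univ).Connected := (induceUnivIso G).connected_iff.2 hc
  have hru : r ≠ u := by
    rintro rfl
    rw [dist_self] at hu
    subst hu
    rw [hc.dist_eq_zero_iff] at hw
    subst hw
    exact hwx hux
  obtain ⟨z, -, huz, hz⟩ := h.exists_adj_closer huniv (Set.mem_univ r) (Set.mem_univ u) hru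
  have hzv : G.Adj z v :=
    h.adj_of_common_upper hc (r := r) hux hvx (by omega) (by omega) (by omega) huz.symm
  have hzw : G.Adj z w :=
    (h.adj_iff_of_adj hc huw (r := r) (by omega) (by omega)).1 huz.symm
  have hconn : (G.induce {w, z, v, x}).Connected :=
    connected_induce_of_walk (.cons hzw.symm (.cons hzv (.cons hvx.symm .nil))) (by simp)
  have hne : x ≠ w := by rintro rfl; omega
  obtain ⟨y, hy, hwy, hyd⟩ := h.exists_adj_closer hconn (r := x) (v := w) (by simp) (by simp) hne
  have hyz : y = z := by
    rcases hy with rfl | rfl | rfl | rfl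
    · exact (G.loopless.irrefl _ hwy).elim
    · rfl
    · exact (hvw hwy.symm).elim
    · exact (hwx hwy.symm).elim
  subst hyz
  have h7 : G.dist x w ≤ 2 := dist_le (.cons hux (.cons huw .nil))
  have h8 : x ≠ y := by rintro rfl; omega
  have h9 := hc.one_lt_dist_of_ne_of_not_adj h8 (fun h ↦ by
    have := h.diff_dist_adj (u := r); omega)
  omega

/-- In the last level, take `x` with the fewest lower neighbours. If it has at least two, they form
a cograph, being neighbours of `x`, and twins `u`, `v` of this cograph are twins in `G`: other
vertices treat `N x` uniformly, by minimality and nestedness in the last level, by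
`lower_homogeneous` in the level of `N x`, and by `adj_of_common_upper` below. If `p` is the only
lower neighbour, the set `R` of last-level vertices with lower neighbour `p` alone is a cograph
joined to the rest only through `p`; it contains twins, or it is `{x}` and `x` is pendant. -/
theorem IsDistanceHereditary.exists_twins_or_pendant_of_connected [Finite V] [Nontrivial V]
    (h : G.IsDistanceHereditary) (hc : G.Connected) :
    ∃ u v, G.AreTwins u v ∨ (u ≠ v ∧ ∀ w, G.Adj u w → w = v) := by
  classical
  have n := G.adj_comm
  have huniv : (G.induce Set.univ).Connected := (induceUnivIso G).connected_iff.2 hc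
  obtain ⟨r⟩ := hc.nonempty
  obtain ⟨x₀, hx₀⟩ := Finite.exists_max fun w ↦ G.dist r w
  obtain ⟨s, hs⟩ := exists_ne r
  have hpos : 0 < G.dist r x₀ := (hc.pos_dist_of_ne hs.symm).trans_le (hx₀ s)
  obtain ⟨k, hk⟩ : ∃ k, G.dist r x₀ = k + 1 := ⟨G.dist r x₀ - 1, by omega⟩
  have hmax : ∀ w, G.dist r w ≤ k + 1 := fun w ↦ hk ▸ hx₀ w
  let N : V → Set V := fun y ↦ {m | G.Adj y m ∧ G.dist r m = k}
  have : Nonempty {y // G.dist r y = k + 1} := ⟨⟨x₀, hk⟩⟩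
  obtain ⟨⟨x, hx⟩, hxmin⟩ := Finite.exists_min (α := {y // G.dist r y = k + 1})
    fun y ↦ (N y).ncard
  have closer : ∀ y, G.dist r y = k + 1 → ∃ m, m ∈ N y := by
    intro y hy
    obtain ⟨z, -, hyz, hz⟩ := h.exists_adj_closer huniv (Set.mem_univ r) (Set.mem_univ y)
      (by rintro rfl; simp at hy)
    exact ⟨z, hyz, by omega⟩
  have same : ∀ y y', G.dist r y = k + 1 → G.dist r y' = k + 1 → G.Adj y y' → N y = N y' := by
    intro y y' hy hy' hyy'
    ext m
    refine and_congr_left fun hm ↦ ?_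
    have := h.adj_iff_of_adj hc hyy' (r := r) (p := m) (by omega) (by omega)
    rw [n y m, n y' m, this]
  have level : ∀ a b, G.Adj a b → G.dist r b ≤ G.dist r a + 1 := fun a b hab ↦ by
    have := hab.diff_dist_adj (u := r)
    omega
  by_cases hM : 2 ≤ (N x).ncard
  · obtain ⟨u, hu, v, hv, huv, htw⟩ := IsCographOn.exists_twins (G := G) (N x).toFinite.toFinset
      (by rwa [← Set.ncard_eq_toFinset_card])
      (by
        rw [Set.Finite.coe_toFinset]
        exact h.isCographOn (x := x) fun m hm ↦ hm.1)
    simp only [Set.Finite.mem_toFinset] at hu hv htw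
    have key : ∀ u ∈ N x, ∀ v ∈ N x, ∀ w, w ∉ N x → G.Adj u w → G.Adj v w := by
      intro u hu v hv w hw huw
      have l1 := level u w huw
      have l2 := level w u huw.symm
      rw [hu.2] at l1 l2
      rcases (by omega : G.dist r w = k + 1 ∨ G.dist r w = k ∨ G.dist r w < k) with hd | hd | hd
      · by_contra hvw
        -- With `u` as a common lower neighbour the sets `N w` and `N x` are nested; as `v` is
        -- missing from `N w`, it would be strictly smaller than the minimal `N x`.
        have hsub : N w ⊆ N x := by
          intro m hm
          refine ⟨?_, hm.2⟩
          by_contra hxm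
          exact hvw (h.lower_nested hc hd hx hu.2 hm.2 hv.2 huw.symm hu.1 hm.1 hxm hv.1).symm
        have hss : N w ⊂ N x := Set.ssubset_iff_of_subset hsub |>.2 ⟨v, hv, fun h ↦ hvw h.1.symm⟩
        have := Set.ncard_lt_ncard hss (Set.toFinite _)
        have := hxmin ⟨w, hd⟩
        simp only at this
        omega
      · exact h.lower_homogeneous hc hx hd hu.2 hv.2 hu.1 hv.1 (fun h ↦ hw ⟨h, hd⟩) huw
      · refine (h.adj_of_common_upper hc hu.1 hv.1 (r := r) ?_ ?_ ?_ huw.symm).symm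
        · rw [hu.2, hv.2]
        · rw [hu.2, hx]; omega
        · rw [hu.2]; exact hd
    refine ⟨u, v, Or.inl ⟨huv, fun w hwu hwv ↦ ?_⟩⟩
    by_cases hw : w ∈ N x
    · exact htw w hw hwu hwv
    · exact ⟨key u hu v hv w hw, key v hv u hu w hw⟩
  · obtain ⟨p, hp⟩ := closer x hx
    have hNx : N x = {p} := by
      refine Set.eq_singleton_iff_unique_mem.2 ⟨hp, fun m hm ↦ ?_⟩
      exact (Set.ncard_le_one (Set.toFinite _)).1 (by omega) m hm p hp
    let R : Set V := {y | G.dist r y = k + 1 ∧ N y = {p}}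
    have hRp : ∀ y ∈ R, G.Adj p y := fun y hy ↦ by
      have : p ∈ N y := by rw [hy.2]; rfl
      exact this.1.symm
    have hRout : ∀ y ∈ R, ∀ w, w ∉ R → G.Adj y w → w = p := by
      intro y hy w hw hyw
      have l1 := level w y hyw.symm
      have l2 := hmax w
      rw [hy.1] at l1
      rcases (by omega : G.dist r w = k + 1 ∨ G.dist r w = k) with hd | hd
      · exact (hw ⟨hd, by rw [← same y w hy.1 hd hyw]; exact hy.2⟩).elim
      · have : w ∈ N y := ⟨hyw, hd⟩
        rw [hy.2] at this
        exact this
    by_cases hR : 2 ≤ R.ncard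
    · obtain ⟨u, hu, v, hv, huv, htw⟩ := IsCographOn.exists_twins (G := G) R.toFinite.toFinset
        (by rwa [← Set.ncard_eq_toFinset_card])
        (by
          rw [Set.Finite.coe_toFinset]
          exact h.isCographOn (x := p) hRp)
      simp only [Set.Finite.mem_toFinset] at hu hv htw
      refine ⟨u, v, Or.inl ⟨huv, fun w hwu hwv ↦ ?_⟩⟩
      by_cases hw : w ∈ R
      · exact htw w hw hwu hwv
      · constructor <;> intro h'
        · rw [hRout u hu w hw h']; exact (hRp v hv).symm
        · rw [hRout v hv w hw h']; exact (hRp u hu).symm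
    · refine ⟨x, p, Or.inr ⟨hp.1.ne, fun w hxw ↦ ?_⟩⟩
      by_contra hwp
      have hxR : x ∈ R := ⟨hx, hNx⟩
      by_cases hw : w ∈ R
      · exact hxw.ne ((Set.ncard_le_one (Set.toFinite _)).1 (by omega) x hxR w hw)
      · exact hwp (hRout x hxR w hw hxw)

theorem IsDistanceHereditary.exists_twins_or_pendant [Finite V] [Nontrivial V]
    (h : G.IsDistanceHereditary) :
    ∃ u v, G.AreTwins u v ∨ (u ≠ v ∧ ∀ w, G.Adj u w → w = v) := by
  by_cases hE : ∃ a b, G.Adj a b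
  · obtain ⟨a, b, hab⟩ := hE
    let C := G.connectedComponentMk a
    have hb : b ∈ C := ConnectedComponent.sound hab.symm.reachable
    have : Nontrivial C := ⟨⟨a, rfl⟩, ⟨b, hb⟩, fun h ↦ hab.ne (congrArg Subtype.val h)⟩
    have hC : C.toSimpleGraph.IsDistanceHereditary := h.induce C.supp
    obtain ⟨u, v, huv⟩ := hC.exists_twins_or_pendant_of_connected C.connected_toSimpleGraph
    have hout : ∀ (u : C) (w : V), G.Adj u w → w ∈ C := fun u w huw ↦
      C.mem_supp_of_adj_mem_supp u.2 huw
    refine ⟨u, v, huv.imp (fun ⟨h1, h2⟩ ↦ ⟨fun h ↦ h1 (Subtype.ext h), fun w hwu hwv ↦ ?_⟩)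
      fun ⟨h1, h2⟩ ↦ ⟨fun h ↦ h1 (Subtype.ext h), fun w huw ↦ ?_⟩⟩
    · by_cases hw : w ∈ C
      · exact h2 ⟨w, hw⟩ (fun h ↦ hwu (congrArg Subtype.val h)) (fun h ↦ hwv (congrArg Subtype.val h))
      · exact ⟨fun h ↦ (hw (hout _ _ h)).elim, fun h ↦ (hw (hout _ _ h)).elim⟩
    · exact congrArg Subtype.val (h2 ⟨w, hout _ _ huw⟩ huw)
  · push Not at hE
    obtain ⟨u, v, huv⟩ := exists_pair_ne V
    exact ⟨u, v, Or.inr ⟨huv, fun w hw ↦ (hE _ _ hw).elim⟩⟩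

end DistanceHereditary


/-! ### Red degree two suffices for distance-hereditary graphs -/

section UpperBoundTwo

variable {V W : Type*}

/-- The vertices are labelled by pairs `(w, x)` such that adjacency between parts with different
first components is as in `H`, between the vertices with second component `true` only; then the
partition into label classes has a sequence with red degree at most two. -/
theorem IsDistanceHereditary.reducible_of_labels {G : SimpleGraph V} {H : SimpleGraph W}
    (hH : H.IsDistanceHereditary) (T : Finset W) (f : V → W × Bool) (hT : ∀ a, (f a).1 ∈ T)
    (hf : ∀ a b, (f a).1 ≠ (f b).1 →
      (G.Adj a b ↔ (f a).2 = true ∧ (f b).2 = true ∧ H.Adj (f a).1 (f b).1)) :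
    Reducible 2 G (Setoid.ker f) := by
  classical
  induction hn : T.card generalizing T f with
  | zero =>
    rw [Finset.card_eq_zero] at hn
    subst hn
    exact .top fun x ↦ by simpa using hT x
  | succ n ih =>
    have n1 := H.adj_comm
    -- Adjacency between parts with different first components is uniform, so red edges only join
    -- `(w, true)` to `(w, false)`.
    have hred : RedLE 2 G (Setoid.ker f) := by
      refine redLE_ker f fun i ↦ ⟨{(i.1, !i.2)}, by simp, ?_⟩
      rintro j hij ⟨a, b, ha, hb, hab⟩ ⟨a', b', ha', hb', hab'⟩
      have h1 := hf a b
      have h2 := hf a' b'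
      simp only [ha, hb, ha', hb'] at h1 h2
      rw [Finset.mem_singleton]
      obtain ⟨i1, i2⟩ := i
      obtain ⟨j1, j2⟩ := j
      cases i2 <;> cases j2 <;> grind
    by_cases hT1 : T.card = 1
    · obtain ⟨t, rfl⟩ := Finset.card_eq_one.1 hT1
      simp only [Finset.mem_singleton] at hT
      refine .of_relabel (g := fun _ ↦ (t, true)) (t, false) (t, true) (fun x ↦ ⟨fun _ ↦ rfl, ?_⟩)
        hred (.top fun x y ↦ rfl)
      intro hx
      have := hT x
      rcases hfx : f x with ⟨w, b⟩
      cases b <;> simp_all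
    have : Nontrivial (T : Set W) :=
      Set.Nontrivial.coe_sort (Finset.one_lt_card_iff_nontrivial.1 (by omega))
    obtain ⟨⟨u, hu⟩, ⟨v, hv⟩, huv⟩ := (hH.induce (T : Set W)).exists_twins_or_pendant
    rcases huv with ⟨huv, h⟩ | ⟨huv, h⟩
    · have huv : u ≠ v := fun h ↦ huv (Subtype.ext h)
      replace h : ∀ w ∈ T, w ≠ u → w ≠ v → (H.Adj u w ↔ H.Adj v w) := fun w hw h1 h2 ↦
        h ⟨w, hw⟩ (fun h ↦ h1 (congrArg Subtype.val h)) fun h ↦ h2 (congrArg Subtype.val h)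
      have htu := fun a ↦ h (f a).1 (hT a)
      -- Twins `u` and `v`: the parts without outside adjacencies are merged first. In between, `(u,
      -- false)` can have the red neighbours `(u, true)` and `(v, true)`; all outside adjacencies
      -- agree, so the second merge eliminates `v`.
      refine .of_relabel (g := fun a ↦ if f a = (v, false) then (u, false) else f a)
        (v, false) (u, false) (fun x ↦ by simp +contextual) hred ?_
      refine .of_relabel (g := fun a ↦ if (f a).1 = v then (u, (f a).2) else f a)
        (v, true) (u, true) (fun x ↦ ?_) ?_ ?_
      · rcases f x with ⟨w, b⟩
        cases b <;> simp <;> grind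
      · refine redLE_ker _ fun i ↦ ⟨if i = (u, false) then {(u, true), (v, true)} else
          if i = (v, true) then {(u, false)} else {(i.1, !i.2)}, ?_, ?_⟩
        · split_ifs <;> simp [Finset.card_le_two]
        · rintro j hij ⟨a, b, ha, hb, hab⟩ ⟨a', b', ha', hb', hab'⟩
          have h1 := hf a b
          have h2 := hf a' b'
          have h3 := htu a
          have h4 := htu b
          have h5 := htu a'
          have h6 := htu b'
          generalize f a = fa at *
          generalize f b = fb at *
          generalize f a' = fa' at *
          generalize f b' = fb' at *
          obtain ⟨a1, a2⟩ := fa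
          obtain ⟨b1, b2⟩ := fb
          obtain ⟨c1, c2⟩ := fa'
          obtain ⟨d1, d2⟩ := fb'
          cases a2 <;> cases b2 <;> cases c2 <;> cases d2 <;> grind
      · refine ih (T.erase v) _ (fun a ↦ ?_) (fun a b ↦ ?_) (by rw [Finset.card_erase_of_mem hv, hn]; rfl)
        · have := hT a
          split_ifs with h'
          · exact Finset.mem_erase.2 ⟨huv, hu⟩
          · exact Finset.mem_erase.2 ⟨h', this⟩
        · have h1 := hf a b
          have h3 := htu a
          have h4 := htu b
          grind
    · have huv : u ≠ v := fun h ↦ huv (Subtype.ext h)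
      replace h : ∀ w ∈ T, H.Adj u w → w = v := fun w hw h1 ↦
        congrArg Subtype.val (h ⟨w, hw⟩ h1)
      have htu := fun a ↦ h (f a).1 (hT a)
      -- For `u` with no neighbour other than possibly `v`, both its parts are merged. The result
      -- has at most the red neighbour `(v, true)`, which itself has at most this one and `(v,
      -- false)`. After that `u` can be absorbed in `(v, false)`, which has no adjacency outside
      -- `v`.
      refine .of_relabel (g := fun a ↦ if f a = (u, false) then (u, true) else f a)
        (u, false) (u, true) (fun x ↦ by simp +contextual) hred ?_
      refine .of_relabel (g := fun a ↦ if (f a).1 = u then (v, false) else f a)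
        (u, true) (v, false) (fun x ↦ ?_) ?_ ?_
      · rcases f x with ⟨w, b⟩
        cases b <;> simp <;> grind
      · refine redLE_ker _ fun i ↦ ⟨if i = (u, true) then {(v, true)} else
          if i = (v, true) then {(v, false), (u, true)} else {(i.1, !i.2)}, ?_, ?_⟩
        · split_ifs <;> simp
        · rintro j hij ⟨a, b, ha, hb, hab⟩ ⟨a', b', ha', hb', hab'⟩
          have h1 := hf a b
          have h2 := hf a' b'
          have h3 := htu a
          have h4 := htu b
          have h5 := htu a'
          have h6 := htu b'
          generalize f a = fa at *
          generalize f b = fb at *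
          generalize f a' = fa' at *
          generalize f b' = fb' at *
          obtain ⟨a1, a2⟩ := fa
          obtain ⟨b1, b2⟩ := fb
          obtain ⟨c1, c2⟩ := fa'
          obtain ⟨d1, d2⟩ := fb'
          cases a2 <;> cases b2 <;> cases c2 <;> cases d2 <;> grind
      · refine ih (T.erase u) _ (fun a ↦ ?_) (fun a b ↦ ?_) (by rw [Finset.card_erase_of_mem hu, hn]; rfl)
        · have := hT a
          split_ifs with h'
          · exact Finset.mem_erase.2 ⟨huv.symm, hv⟩
          · exact Finset.mem_erase.2 ⟨h', this⟩
        · have h1 := hf a b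
          have h3 := htu a
          have h4 := htu b
          grind

theorem IsDistanceHereditary.reducible_two [Finite V] {G : SimpleGraph V}
    (h : G.IsDistanceHereditary) : Reducible 2 G ⊥ := by
  have := Fintype.ofFinite V
  have := h.reducible_of_labels (G := G) Finset.univ (fun v ↦ (v, true)) (fun _ ↦ Finset.mem_univ _)
    (by simp)
  convert this using 1
  ext a b
  simp [Setoid.ker_def]

end UpperBoundTwo


/-! ### Threads have sequences of red degree one -/

section Threads

variable {V : Type*}

/-- The vertices are arranged in a sequence of cographs; a vertex is adjacent to all or to none of
the earlier vertices that are still active, and the activity of vertices ends at resets. -/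
def IsThread (G : SimpleGraph V) : Prop :=
  ∃ (f : V → ℕ) (act adj reset : ℕ → Prop), (∀ i, G.IsCographOn {v | f v = i}) ∧
    ∀ u v, f u < f v →
      (G.Adj u v ↔ adj (f v) ∧ act (f u) ∧ ∀ k, f u < k → k < f v → ¬reset k)

theorem IsThread.induce {G : SimpleGraph V} (h : G.IsThread) (S : Set V) :
    (G.induce S).IsThread := by
  obtain ⟨f, act, adj, reset, h1, h2⟩ := h
  refine ⟨fun v ↦ f v, act, adj, reset, fun i ↦ ?_, fun u v ↦ h2 u v⟩
  rw [IsCographOn.induce_iff]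
  exact (h1 i).mono (by rintro _ ⟨v, hv, rfl⟩; exact hv)

/-- A class of graphs that is closed under the addition of twins contains all threads if it
contains those in which all parts are singletons. -/
theorem IsThread.induction {P : ∀ (V : Type u), SimpleGraph V → Prop}
    (twins : ∀ (V : Type u) [Finite V] (G : SimpleGraph V) (u v : V), G.AreTwins u v →
      P {x | x ≠ v} (G.induce {x | x ≠ v}) → P V G)
    (inj : ∀ (V : Type u) [Finite V] (G : SimpleGraph V) (f : V → ℕ) (act adj reset : ℕ → Prop),
      f.Injective → (∀ u v, f u < f v →
        (G.Adj u v ↔ adj (f v) ∧ act (f u) ∧ ∀ k, f u < k → k < f v → ¬reset k)) → P V G)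
    {V : Type u} [Finite V] {G : SimpleGraph V} (h : G.IsThread) : P V G := by
  obtain ⟨n, hn⟩ : ∃ n, Nat.card V = n := ⟨_, rfl⟩
  induction n using Nat.strong_induction_on generalizing V with
  | _ n ih =>
    obtain ⟨f, act, adj, reset, h1, h2⟩ := id h
    by_cases hf : f.Injective
    · exact inj V G f act adj reset hf h2
    · obtain ⟨a, b, hab, hne⟩ := Function.not_injective_iff.1 hf
      have hfin : {v | f v = f a}.Finite := Set.toFinite _
      -- Adjacency to other positions depends on the position only, so twins of the cograph at one
      -- position are twins of `G`.
      obtain ⟨u, hu, v, hv, huv, htw⟩ := IsCographOn.exists_twins (G := G) hfin.toFinset (by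
          rw [← Set.ncard_eq_toFinset_card]
          exact (Set.one_lt_ncard (Set.toFinite _)).2 ⟨a, rfl, b, hab.symm, hne⟩)
        (by rw [Set.Finite.coe_toFinset]; exact h1 _)
      simp only [Set.Finite.mem_toFinset, Set.mem_ofPred_eq] at hu hv htw
      refine twins V G u v ⟨huv, fun w hwu hwv ↦ ?_⟩ (ih _ ?_ (h.induce _) rfl)
      · rcases lt_trichotomy (f w) (f a) with hlt | heq | hlt
        · rw [G.adj_comm u, G.adj_comm v, h2 w u (hu ▸ hlt), h2 w v (hv ▸ hlt), hu, hv]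
        · exact htw w heq hwu hwv
        · rw [h2 u w (hu ▸ hlt), h2 v w (hv ▸ hlt), hu, hv]
      · have : {x : V | x ≠ v} = {v}ᶜ := rfl
        have hpos : 0 < Nat.card V := Nat.card_pos_iff.2 ⟨⟨v⟩, ‹_›⟩
        rw [Nat.card_coe_set_eq, this, Set.ncard_compl, Set.ncard_singleton]
        omega

open Classical in
/-- The parts of the partition after the vertices before `n` have been contracted to an active and
an inactive part. -/
noncomputable def threadLabel (f : V → ℕ) (act reset : ℕ → Prop) (n : ℕ) (u : V) : V ⊕ Bool :=
  if n ≤ f u then .inl u else .inr (decide (act (f u) ∧ ∀ k, f u < k → k < n → ¬reset k))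

-- Sweep along the positions. The later vertices see the active part uniformly and the inactive part
-- not at all, so the only red edge is the one between these two parts.
open Classical in
theorem reducible_one_of_injective_thread [Finite V] {G : SimpleGraph V} {f : V → ℕ}
    {act adj reset : ℕ → Prop} (hf : f.Injective) (h : ∀ u v, f u < f v →
      (G.Adj u v ↔ adj (f v) ∧ act (f u) ∧ ∀ k, f u < k → k < f v → ¬reset k)) :
    Reducible 1 G ⊥ := by
  obtain ⟨N, hN⟩ : ∃ N, ∀ u, f u < N := by
    obtain ⟨N, hN⟩ := (Set.finite_range f).bddAbove
    exact ⟨N + 1, fun u ↦ Nat.lt_succ_of_le (hN ⟨u, rfl⟩)⟩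
  have h' : ∀ n u w, f u < n → n ≤ f w → (G.Adj u w ↔
      adj (f w) ∧ (act (f u) ∧ ∀ k, f u < k → k < n → ¬reset k) ∧ ∀ k, n ≤ k → k < f w → ¬reset k) := by
    intro n u w hu hw
    rw [h u w (hu.trans_le hw)]
    refine ⟨fun ⟨h1, h2, h3⟩ ↦ ⟨h1, ⟨h2, fun k hk hk' ↦ h3 k hk (by omega)⟩,
      fun k hk hk' ↦ h3 k (by omega) hk'⟩, fun ⟨h1, ⟨h2, h3⟩, h4⟩ ↦ ⟨h1, h2, fun k hk hk' ↦ ?_⟩⟩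
    by_cases hkn : k < n
    · exact h3 k hk hkn
    · exact h4 k (by omega) hk'
  have hred : ∀ n, RedLE 1 G (Setoid.ker (threadLabel f act reset n)) := by
    intro n
    refine redLE_ker _ fun i ↦ ⟨i.elim (fun _ ↦ ∅) fun b ↦ {.inr !b}, ?_, ?_⟩
    · cases i <;> simp
    · rintro j hij ⟨a, b, ha, hb, hab⟩ ⟨a', b', ha', hb', hab'⟩
      have n1 := G.adj_comm
      have h1 := h' n a b
      have h2 := h' n a' b'
      have h3 := h' n b a
      have h4 := h' n b' a'
      unfold threadLabel at ha hb ha' hb'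
      rcases i with i | i <;> rcases j with j | j
      · split_ifs at ha hb ha' hb' <;> grind
      · split_ifs at ha hb ha' hb'
        all_goals simp only [Sum.inl.injEq, Sum.inr.injEq] at ha hb ha' hb'
        subst ha ha'
        rw [← hb'] at hb
        rw [decide_eq_decide] at hb
        grind
      · split_ifs at ha hb ha' hb'
        all_goals simp only [Sum.inl.injEq, Sum.inr.injEq] at ha hb ha' hb'
        subst hb hb'
        rw [← ha'] at ha
        rw [decide_eq_decide] at ha
        grind
      · simp only [Sum.elim_inr, Finset.mem_singleton, Sum.inr.injEq]
        cases i <;> cases j <;> simp at hij ⊢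
  have key : ∀ n, n ≤ N → Reducible 1 G (Setoid.ker (threadLabel f act reset n)) := by
    intro n hn
    induction hn using Nat.decreasingInduction with
    | self =>
      refine .of_relabel (g := fun _ ↦ .inr false) (.inr true) (.inr false) (fun x ↦ ⟨fun _ ↦ rfl, ?_⟩)
        (hred N) (.top fun x y ↦ rfl)
      have := hN x
      simp only [threadLabel, not_le.2 this, if_false]
      simp
    | of_succ n hn ih =>
      have hlab : ∀ u, (f u < n → threadLabel f act reset n u =
          .inr (decide (act (f u) ∧ ∀ k, f u < k → k < n → ¬reset k))) ∧
          (n ≤ f u → threadLabel f act reset n u = .inl u) := fun u ↦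
        ⟨fun hu ↦ by simp only [threadLabel, not_le.2 hu, if_false], fun hu ↦ by simp [threadLabel, hu]⟩
      have hlab' : ∀ u, (f u < n → threadLabel f act reset (n + 1) u =
          .inr (decide ((act (f u) ∧ ∀ k, f u < k → k < n → ¬reset k) ∧ ¬reset n))) ∧
          (n < f u → threadLabel f act reset (n + 1) u = .inl u) ∧
          (f u = n → threadLabel f act reset (n + 1) u = .inr (decide (act n))) := by
        refine fun u ↦ ⟨fun hu ↦ ?_, fun hu ↦ by simp [threadLabel, Nat.succ_le_of_lt hu], fun hu ↦ ?_⟩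
        · have : ¬ n + 1 ≤ f u := by omega
          simp only [threadLabel, this, if_false, Sum.inr.injEq, decide_eq_decide, and_assoc]
          refine and_congr_right fun _ ↦ ⟨fun h ↦ ⟨fun k hk hk' ↦ h k hk (by omega), h n hu (by omega)⟩,
            fun ⟨h1, h2⟩ k hk hk' ↦ ?_⟩
          rcases (by omega : k < n ∨ k = n) with hk2 | rfl
          exacts [h1 k hk hk2, h2]
        · have : ¬ n + 1 ≤ f u := by omega
          simp only [threadLabel, this, if_false, Sum.inr.injEq, decide_eq_decide]
          rw [hu]
          exact ⟨fun h ↦ h.1, fun h ↦ ⟨h, fun k hk hk' ↦ by omega⟩⟩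
      -- Once the earlier vertices are grouped as after position `n`, the vertex at this position,
      -- if there is one, joins its part.
      have hadd : ∀ g : V → V ⊕ Bool, RedLE 1 G (Setoid.ker g) →
          (∀ u, (f u = n → g u = .inl u) ∧ (f u ≠ n → g u = threadLabel f act reset (n + 1) u)) →
          Reducible 1 G (Setoid.ker g) := by
        intro g hg hg'
        by_cases hex : ∃ v, f v = n
        · obtain ⟨v, hv⟩ := hex
          refine .of_relabel (.inl v) (.inr (decide (act n))) (fun x ↦ ?_) hg ih
          by_cases hx : f x = n
          · have : x = v := hf (hx.trans hv.symm)
            subst this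
            simp [(hlab' x).2.2 hv, (hg' x).1 hv]
          · rw [(hg' x).2 hx]
            refine ⟨fun h ↦ ?_, fun _ ↦ rfl⟩
            rcases lt_or_gt_of_ne hx with hlt | hlt
            · rw [(hlab' x).1 hlt] at h
              simp at h
            · rw [(hlab' x).2.1 hlt] at h
              simp only [Sum.inl.injEq] at h
              subst h
              exact (hx hv).elim
        · push Not at hex
          have : g = threadLabel f act reset (n + 1) := funext fun u ↦ (hg' u).2 (hex u)
          rwa [this]
      -- At a reset the earlier vertices are merged to one part before the vertex at `n` is
      -- absorbed. That vertex may still see the active ones, but no later vertex does, so the red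
      -- edge between the old parts is replaced by one to this vertex.
      by_cases hr : reset n
      · let g : V → V ⊕ Bool := fun u ↦ if n ≤ f u then .inl u else .inr false
        have hg : RedLE 1 G (Setoid.ker g) := by
          refine redLE_ker _ fun i ↦ ⟨i.elim (fun _ ↦ {.inr false}) fun b ↦
            if hv : ∃ v, f v = n then {.inl hv.choose} else ∅, ?_, ?_⟩
          · cases i
            · simp
            · simp only [Sum.elim_inr]
              split_ifs <;> simp
          · rintro j hij ⟨a, b, ha, hb, hab⟩ ⟨a', b', ha', hb', hab'⟩
            have n1 := G.adj_comm
            simp only [g] at ha hb ha' hb'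
            rcases i with i | i <;> rcases j with j | j
            · split_ifs at ha hb ha' hb' <;> grind
            · split_ifs at ha hb ha' hb' <;> grind
            · split_ifs at ha hb ha' hb' with c1 c2 c3 c4
              all_goals simp only [Sum.inl.injEq, Sum.inr.injEq, reduceCtorEq] at ha hb ha' hb'
              subst hb
              have h1 := (h' n a b (by omega) (by omega)).1 hab
              have hbn : f b = n := by
                by_contra hbn
                exact h1.2.2 n le_rfl (by omega) hr
              have hv : ∃ v, f v = n := ⟨b, hbn⟩
              simp only [Sum.elim_inr, hv, dif_pos, Finset.mem_singleton]
              rw [hf (hv.choose_spec.trans hbn.symm)]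
            · split_ifs at ha hb ha' hb' <;> grind
        refine .of_relabel (g := g) (.inr true) (.inr false) (fun x ↦ ?_) (hred n) (hadd g hg fun u ↦ ?_)
        · simp only [g]
          rcases lt_or_ge (f x) n with hlt | hle
          · rw [(hlab x).1 hlt]
            simp only [not_le.2 hlt, if_false]
            simp
          · rw [(hlab x).2 hle]
            simp [hle]
        · refine ⟨fun hu ↦ by simp [g, hu], fun hu ↦ ?_⟩
          rcases lt_or_gt_of_ne hu with hlt | hlt
          · rw [(hlab' u).1 hlt]
            simp [g, hr, hlt]
          · rw [(hlab' u).2.1 hlt]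
            simp [g, hlt.le]
      · refine hadd _ (hred n) fun u ↦ ⟨fun hu ↦ (hlab u).2 hu.ge, fun hu ↦ ?_⟩
        rcases lt_or_gt_of_ne hu with hlt | hlt
        · rw [(hlab' u).1 hlt, (hlab u).1 hlt]
          simp [hr]
        · rw [(hlab' u).2.1 hlt, (hlab u).2 hlt.le]
  have := key 0 (Nat.zero_le N)
  convert this using 1
  ext a b
  simp [Setoid.ker_def, threadLabel]

theorem IsThread.reducible_one {V : Type u} [Finite V] {G : SimpleGraph V} (h : G.IsThread) :
    Reducible 1 G ⊥ :=
  h.induction (P := fun _ G ↦ Reducible 1 G ⊥) (fun _ _ _ _ _ htw hr ↦ .of_twins htw hr)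
    fun _ _ _ _ _ _ _ hf h ↦ reducible_one_of_injective_thread hf h

end Threads


/-! ### Threads are permutation graphs, and these are AT-free -/

section Permutation

variable {V : Type*}

/-- The two maps are the two orders of a permutation diagram of the graph induced on `S`. -/
structure IsDiagramOn (G : SimpleGraph V) (S : Set V) (σ τ : V → ℤ) : Prop where
  inj_left : S.InjOn σ
  inj_right : S.InjOn τ
  adj_iff : ∀ a ∈ S, ∀ b ∈ S, G.Adj a b ↔ (σ a < σ b ∧ τ b < τ a) ∨ (σ b < σ a ∧ τ a < τ b)

theorem IsDiagramOn.symm {G : SimpleGraph V} {S : Set V} {σ τ : V → ℤ} (h : G.IsDiagramOn S σ τ) :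
    G.IsDiagramOn S τ σ :=
  ⟨h.inj_right, h.inj_left, fun a ha b hb ↦ by rw [h.adj_iff a ha b hb]; tauto⟩

theorem exists_equiv_fin_lt_iff [Finite V] {σ : V → ℤ} (hσ : σ.Injective) :
    ∃ e : V ≃ Fin (Nat.card V), ∀ a b, e a < e b ↔ σ a < σ b := by
  have := Fintype.ofFinite V
  let _ : LinearOrder V := LinearOrder.lift' σ hσ
  let e := Fintype.orderIsoFinOfCardEq V (Nat.card_eq_fintype_card (α := V)).symm
  exact ⟨e.symm.toEquiv, fun a b ↦ e.symm.lt_iff_lt⟩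

theorem IsDiagramOn.isPermutationGraph [Finite V] {G : SimpleGraph V} {σ τ : V → ℤ}
    (h : G.IsDiagramOn Set.univ σ τ) : G.IsPermutationGraph := by
  obtain ⟨e, he⟩ := exists_equiv_fin_lt_iff (Set.injOn_univ.1 h.inj_left)
  obtain ⟨e', he'⟩ := exists_equiv_fin_lt_iff (Set.injOn_univ.1 h.inj_right)
  exact ⟨e, e', fun a b ↦ by
    simp only [he, he']; exact h.adj_iff a (Set.mem_univ _) b (Set.mem_univ _)⟩

/-- Doubling the coordinates makes room for `v` next to `u` in both orders: just after it in the
first, and in the second just before it or after it according to whether they are adjacent. -/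
theorem IsDiagramOn.of_twins {G : SimpleGraph V} {u v : V} (huv : G.AreTwins u v)
    (h : ∃ σ τ, G.IsDiagramOn {x | x ≠ v} σ τ) : ∃ σ τ, G.IsDiagramOn Set.univ σ τ := by
  classical
  obtain ⟨σ, τ, h1, h2, h3⟩ := h
  obtain ⟨hne, htw⟩ := huv
  have n := G.adj_comm
  have h1' : ∀ a b, a ≠ v → b ≠ v → σ a = σ b → a = b := fun a b ha hb h ↦ h1 ha hb h
  have h2' : ∀ a b, a ≠ v → b ≠ v → τ a = τ b → a = b := fun a b ha hb h ↦ h2 ha hb h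
  simp only [Set.mem_ofPred_eq] at h3
  refine ⟨fun w ↦ if w = v then 2 * σ u + 1 else 2 * σ w,
    fun w ↦ if w = v then 2 * τ u + (if G.Adj u v then -1 else 1) else 2 * τ w,
    fun a _ b _ hab ↦ ?_, fun a _ b _ hab ↦ ?_, fun a _ b _ ↦ ?_⟩
  · split_ifs at hab <;> grind
  · split_ifs at hab <;> grind
  · have key : ∀ w, w ≠ v → (G.Adj v w ↔
        (2 * σ u + 1 < 2 * σ w ∧ 2 * τ w < 2 * τ u + (if G.Adj u v then -1 else 1)) ∨
        (2 * σ w < 2 * σ u + 1 ∧ 2 * τ u + (if G.Adj u v then -1 else 1) < 2 * τ w)) := by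
      intro w hw
      by_cases hwu : w = u
      · subst hwu
        rw [n v w]
        by_cases hwv : G.Adj w v <;> simp [hwv]
      · rw [← htw w hwu hw, h3 u hne w hw]
        have : σ w ≠ σ u := fun h ↦ hwu (h1' w u hw hne h)
        have : τ w ≠ τ u := fun h ↦ hwu (h2' w u hw hne h)
        split_ifs <;> omega
    by_cases hav : a = v
    · by_cases hbv : b = v
      · simp [hav, hbv]
      · simp only [hav, hbv, if_true, if_false]
        exact key b hbv
    · by_cases hbv : b = v
      · simp only [hav, hbv, if_true, if_false]
        rw [n, key a hav]
        tauto
      · simp only [hav, hbv, if_false]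
        rw [h3 a hav b hbv]
        omega

-- The vertices are inserted by position, with the invariant that in the second order the active
-- vertices come after the inactive ones. A new vertex that is last in the first order and separates
-- these two groups in the second is adjacent exactly to the active ones.
set_option maxHeartbeats 2000000 in
theorem exists_diagram_of_injective_thread [Finite V] {G : SimpleGraph V} {f : V → ℕ}
    {act adj reset : ℕ → Prop} (hf : f.Injective) (h : ∀ u v, f u < f v →
      (G.Adj u v ↔ adj (f v) ∧ act (f u) ∧ ∀ k, f u < k → k < f v → ¬reset k)) :
    ∃ σ τ, G.IsDiagramOn Set.univ σ τ := by
  classical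
  have n1 := G.adj_comm
  obtain ⟨A, hA, hA', h'⟩ : ∃ A : ℕ → V → Prop,
      (∀ n u, f u < n → (A (n + 1) u ↔ A n u ∧ ¬reset n)) ∧ (∀ u, A (f u + 1) u ↔ act (f u)) ∧
      ∀ u v, f u < f v → (G.Adj u v ↔ adj (f v) ∧ A (f v) u) := by
    refine ⟨fun n u ↦ act (f u) ∧ ∀ k, f u < k → k < n → ¬reset k, fun n u hu ↦ ?_,
      fun u ↦ ⟨fun h ↦ h.1, fun h ↦ ⟨h, fun k _ _ ↦ by omega⟩⟩, h⟩
    simp only [and_assoc]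
    refine and_congr_right fun _ ↦ ⟨fun h ↦ ⟨fun k hk hk' ↦ h k hk (by omega), h n hu (by omega)⟩,
      fun ⟨h1, h2⟩ k hk hk' ↦ ?_⟩
    rcases (by omega : k < n ∨ k = n) with hk2 | rfl
    exacts [h1 k hk hk2, h2]
  have key : ∀ n, ∃ σ τ : V → ℤ, G.IsDiagramOn {u | f u < n} σ τ ∧
      ∀ a b, f a < n → f b < n → A n a → ¬A n b → τ b < τ a := by
    intro n
    induction n with
    | zero => exact ⟨0, 0, ⟨fun a ha ↦ by simp at ha, fun a ha ↦ by simp at ha,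
        fun a ha ↦ by simp at ha⟩, fun a b ha ↦ by simp at ha⟩
    | succ n ih =>
      obtain ⟨σ, τ, ⟨i1, i2, i3⟩, i4⟩ := ih
      by_cases hex : ∃ v, f v = n
      · obtain ⟨v, rfl⟩ := hex
        have hlt : ∀ u, f u < f v + 1 ↔ f u < f v ∨ u = v := fun u ↦ by
          constructor
          · intro hu
            rcases (by omega : f u < f v ∨ f u = f v) with h | h
            exacts [Or.inl h, Or.inr (hf h)]
          · rintro (h | rfl) <;> omega
        obtain ⟨M, hM⟩ : ∃ M : ℤ, ∀ u, -M < σ u ∧ σ u < M ∧ -M < τ u ∧ τ u < M := by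
          obtain ⟨M, hM⟩ := (Set.finite_range fun u ↦ |σ u| + |τ u|).bddAbove
          refine ⟨M + 1, fun u ↦ ?_⟩
          have := hM ⟨u, rfl⟩
          have := abs_nonneg (σ u)
          have := abs_nonneg (τ u)
          have := neg_abs_le (σ u)
          have := le_abs_self (σ u)
          have := neg_abs_le (τ u)
          have := le_abs_self (τ u)
          dsimp only at *
          omega
        have i1' : ∀ a b, f a < f v → f b < f v → σ a = σ b → a = b := fun a b ha hb h ↦ i1 ha hb h
        have i2' : ∀ a b, f a < f v → f b < f v → τ a = τ b → a = b := fun a b ha hb h ↦ i2 ha hb h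
        have i3' : ∀ a b, f a < f v → f b < f v →
          (G.Adj a b ↔ (σ a < σ b ∧ τ b < τ a) ∨ (σ b < σ a ∧ τ a < τ b)) :=
          fun a b ha hb ↦ i3 a ha b hb
        -- All old coordinates lie strictly between `-M` and `M`, and active vertices are shifted by
        -- `2 * M` in the second order. So `t = M` is the gap between inactive and active vertices,
        -- `4 * M` is beyond everything and `-M` before everything.
        obtain ⟨s, t, hst⟩ : ∃ s t : ℤ,
            (adj (f v) → s = M ∧ t = M) ∧ (¬adj (f v) → act (f v) → s = M ∧ t = 4 * M) ∧
            (¬adj (f v) → ¬act (f v) → s = -M ∧ t = -M) := by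
          by_cases adj (f v) <;> by_cases act (f v) <;> simp_all
        let σ' : V → ℤ := fun u ↦ if u = v then s else σ u
        let τ' : V → ℤ := fun u ↦ if u = v then t else if A (f v) u then τ u + 2 * M else τ u
        have hσ' : σ' v = s ∧ ∀ u, f u < f v → σ' u = σ u :=
          ⟨by simp [σ'], fun u hu ↦ by simp only [σ']; rw [if_neg]; rintro rfl; omega⟩
        have hτv : τ' v = t := by simp [τ']
        have hτ' : ∀ u, f u < f v → (A (f v) u ∧ τ' u = τ u + 2 * M) ∨ (¬A (f v) u ∧ τ' u = τ u) := by
          intro u hu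
          have huv : u ≠ v := by rintro rfl; omega
          by_cases hAu : A (f v) u
          · exact Or.inl ⟨hAu, by simp only [τ']; rw [if_neg huv, if_pos hAu]⟩
          · exact Or.inr ⟨hAu, by simp only [τ']; rw [if_neg huv, if_neg hAu]⟩
        clear_value τ' σ'
        have hτlt : ∀ a b, f a < f v → f b < f v → (τ' a < τ' b ↔ τ a < τ b) := by
          intro a b ha hb
          have := hM a
          have := hM b
          rcases hτ' a ha with ⟨hAa, ea⟩ | ⟨hAa, ea⟩ <;> rcases hτ' b hb with ⟨hAb, eb⟩ | ⟨hAb, eb⟩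
          · omega
          · have := i4 a b ha hb hAa hAb
            omega
          · have := i4 b a hb ha hAb hAa
            omega
          · omega
        have hv : ∀ u, f u < f v → (G.Adj u v ↔
            (σ' u < σ' v ∧ τ' v < τ' u) ∨ (σ' v < σ' u ∧ τ' u < τ' v)) ∧
            σ' u ≠ σ' v ∧ τ' u ≠ τ' v := by
          intro u hu
          rw [h' u v hu, hσ'.1, hσ'.2 u hu, hτv]
          have := hM u
          obtain ⟨st1, st2, st3⟩ := hst
          by_cases c1 : adj (f v)
          · have := st1 c1
            rcases hτ' u hu with ⟨hAu, eu⟩ | ⟨hAu, eu⟩ <;> simp only [c1, hAu, and_self, and_false, true_iff, false_iff] <;> omega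
          · by_cases c2 : act (f v)
            · have := st2 c1 c2
              rcases hτ' u hu with ⟨hAu, eu⟩ | ⟨hAu, eu⟩ <;> simp only [c1, false_and, false_iff] <;> omega
            · have := st3 c1 c2
              rcases hτ' u hu with ⟨hAu, eu⟩ | ⟨hAu, eu⟩ <;> simp only [c1, false_and, false_iff] <;> omega
        have hd : G.IsDiagramOn {u | f u < f v + 1} σ' τ' := by
          refine ⟨fun a ha b hb hab ↦ ?_, fun a ha b hb hab ↦ ?_, fun a ha b hb ↦ ?_⟩ <;>
            simp only [Set.mem_ofPred_eq, hlt] at ha hb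
          · rcases ha with ha | rfl <;> rcases hb with hb | rfl
            · rw [hσ'.2 a ha, hσ'.2 b hb] at hab
              exact i1' a b ha hb hab
            · exact ((hv a ha).2.1 hab).elim
            · exact ((hv b hb).2.1 hab.symm).elim
            · rfl
          · rcases ha with ha | rfl <;> rcases hb with hb | rfl
            · refine i2' a b ha hb (le_antisymm ?_ ?_) <;> rw [← not_lt]
              · rw [← hτlt b a hb ha]; omega
              · rw [← hτlt a b ha hb]; omega
            · exact ((hv a ha).2.2 hab).elim
            · exact ((hv b hb).2.2 hab.symm).elim
            · rfl
          · rcases ha with ha | rfl <;> rcases hb with hb | rfl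
            · rw [hτlt a b ha hb, hτlt b a hb ha, hσ'.2 a ha, hσ'.2 b hb]
              exact i3' a b ha hb
            · exact (hv a ha).1
            · rw [n1, (hv b hb).1]; tauto
            · simp
        by_cases hr : reset (f v)
        · by_cases ha : act (f v)
          · refine ⟨τ', σ', hd.symm, fun a b ha' hb' hAa hAb ↦ ?_⟩
            rw [hlt] at ha' hb'
            have hav : a = v := by
              rcases ha' with ha' | ha'
              · rw [hA _ _ ha'] at hAa
                exact (hAa.2 hr).elim
              · exact ha'
            subst hav
            rcases hb' with hb' | rfl
            · rw [hσ'.1, hσ'.2 b hb']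
              have := hM b
              by_cases c : adj (f a)
              · have := hst.1 c
                omega
              · have := hst.2.1 c ha
                omega
            · exact (hAb hAa).elim
          · refine ⟨σ', τ', hd, fun a b ha' hb' hAa hAb ↦ ?_⟩
            rw [hlt] at ha'
            rcases ha' with ha' | rfl
            · rw [hA _ _ ha'] at hAa
              exact (hAa.2 hr).elim
            · exact (ha ((hA' _).1 hAa)).elim
        · refine ⟨σ', τ', hd, fun a b ha' hb' hAa hAb ↦ ?_⟩
          rw [hlt] at ha' hb'
          have q1 := hA' v
          rcases ha' with ha' | rfl <;> rcases hb' with hb' | rfl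
          · rw [hA _ _ ha'] at hAa
            rw [hA _ _ hb'] at hAb
            rw [hτlt b a hb' ha']
            exact i4 a b ha' hb' hAa.1 fun h ↦ hAb ⟨h, hr⟩
          · rw [hA _ _ ha'] at hAa
            rw [hτv]
            have e := ((hτ' a ha').resolve_right fun h ↦ h.1 hAa.1).2
            have := hM a
            by_cases c : adj (f b)
            · have := hst.1 c
              omega
            · have := hst.2.2 c fun h ↦ hAb (q1.2 h)
              omega
          · rw [hA _ _ hb'] at hAb
            rw [hτv]
            have e := ((hτ' b hb').resolve_left fun h ↦ hAb ⟨h.1, hr⟩).2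
            have := hM b
            by_cases c : adj (f a)
            · have := hst.1 c
              omega
            · have := hst.2.1 c (q1.1 hAa)
              omega
          · exact (hAb hAa).elim
      · push Not at hex
        have hlt : ∀ u, f u < n + 1 ↔ f u < n := fun u ↦ by have := hex u; omega
        simp only [hlt]
        refine ⟨σ, τ, ⟨i1, i2, i3⟩, fun a b ha hb hAa hAb ↦ ?_⟩
        rw [hA n a ha] at hAa
        rw [hA n b hb] at hAb
        exact i4 a b ha hb hAa.1 fun h ↦ hAb ⟨h, hAa.2⟩
  obtain ⟨N, hN⟩ : ∃ N, ∀ u, f u < N := by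
    obtain ⟨N, hN⟩ := (Set.finite_range f).bddAbove
    exact ⟨N + 1, fun u ↦ Nat.lt_succ_of_le (hN ⟨u, rfl⟩)⟩
  obtain ⟨σ, τ, hd, -⟩ := key N
  have : {u | f u < N} = Set.univ := by ext u; simp [hN u]
  exact ⟨σ, τ, this ▸ hd⟩

theorem IsThread.isPermutationGraph {V : Type u} [Finite V] {G : SimpleGraph V} (h : G.IsThread) :
    G.IsPermutationGraph := by
  have : ∃ σ τ, G.IsDiagramOn Set.univ σ τ :=
    h.induction (P := fun _ G ↦ ∃ σ τ, G.IsDiagramOn Set.univ σ τ)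
      (fun V _ G u v htw ⟨σ, τ, hd⟩ ↦ IsDiagramOn.of_twins htw (by
        classical
        refine ⟨fun x ↦ if hx : x ≠ v then σ ⟨x, hx⟩ else 0,
          fun x ↦ if hx : x ≠ v then τ ⟨x, hx⟩ else 0, fun a ha b hb hab ↦ ?_,
          fun a ha b hb hab ↦ ?_, fun a ha b hb ↦ ?_⟩ <;>
          simp only [Set.mem_ofPred_eq] at ha hb
        · simp only [ha, hb, ne_eq, not_false_eq_true, dif_pos] at hab
          exact congrArg Subtype.val (hd.inj_left (Set.mem_univ _) (Set.mem_univ _) hab)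
        · simp only [ha, hb, ne_eq, not_false_eq_true, dif_pos] at hab
          exact congrArg Subtype.val (hd.inj_right (Set.mem_univ _) (Set.mem_univ _) hab)
        · simp only [ha, hb, ne_eq, not_false_eq_true, dif_pos]
          exact hd.adj_iff ⟨a, ha⟩ (Set.mem_univ _) ⟨b, hb⟩ (Set.mem_univ _)))
      fun _ _ _ _ _ _ _ hf h ↦ exists_diagram_of_injective_thread hf h
  obtain ⟨σ, τ, hd⟩ := this
  exact hd.isPermutationGraph

/-- Nonadjacent vertices come in the same order in both orderings, so an independent triple is a
chain. A path avoiding the middle vertex and its neighbours cannot pass from one side of it to the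
other: vertices on different sides are not adjacent. -/
theorem IsPermutationGraph.isATFree [Finite V] {G : SimpleGraph V} (h : G.IsPermutationGraph) :
    G.IsATFree := by
  obtain ⟨σ, τ, h⟩ := h
  have between : ∀ a b c, σ a < σ b → τ a < τ b → σ b < σ c → τ b < τ c →
      ¬G.PathNotDominating a c b := by
    rintro a b c h1 h2 h3 h4 ⟨p, -, hp⟩
    have key : ∀ (x y : V) (p : G.Walk x y), (∀ w ∈ p.support, w ≠ b ∧ ¬G.Adj w b) →
        σ x < σ b → τ x < τ b → σ y < σ b ∧ τ y < τ b := by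
      intro x y p
      induction p with
      | nil => exact fun _ h h' ↦ ⟨h, h'⟩
      | @cons x w y hxw q ih =>
        intro hq hx hx'
        have hw := hq w (by simp)
        refine ih (fun z hz ↦ hq z (by simp [hz])) ?_ ?_
        all_goals
          have e1 : σ w ≠ σ b := fun e ↦ hw.1 (σ.injective e)
          have e2 : τ w ≠ τ b := fun e ↦ hw.1 (τ.injective e)
          have e3 := hw.2
          rw [h] at e3 hxw
          omega
    have := key a c p hp h1 h2
    omega
  rintro a b c ⟨hab, hac, hbc, h1, h2, h3⟩
  have sym : ∀ {x y z}, G.PathNotDominating x y z → G.PathNotDominating y x z := by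
    rintro x y z ⟨p, hp, hp'⟩
    exact ⟨p.reverse, hp.reverse, fun w hw ↦ hp' w (by simpa using hw)⟩
  have nadj : ∀ {x y z}, G.PathNotDominating x y z → ¬G.Adj x z ∧ ¬G.Adj y z := by
    rintro x y z ⟨p, -, hp⟩
    exact ⟨(hp x (by simp)).2, (hp y (by simp)).2⟩
  have tot : ∀ {x y}, x ≠ y → ¬G.Adj x y →
      (σ x < σ y ∧ τ x < τ y) ∨ (σ y < σ x ∧ τ y < τ x) := by
    intro x y hxy hadj
    have e1 : σ x ≠ σ y := fun e ↦ hxy (σ.injective e)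
    have e2 : τ x ≠ τ y := fun e ↦ hxy (τ.injective e)
    rw [h] at hadj
    omega
  have b : ∀ {x y z}, G.PathNotDominating x z y →
      ¬((σ x < σ y ∧ τ x < τ y) ∧ σ y < σ z ∧ τ y < τ z) := fun h ⟨⟨h1, h2⟩, h3, h4⟩ ↦
    between _ _ _ h1 h2 h3 h4 h
  have b1 := b h1
  have b2 := b h2
  have b3 := b h3
  have b4 := b (sym h1)
  have b5 := b (sym h2)
  have b6 := b (sym h3)
  rcases tot hab (nadj h2).1 with t1 | t1 <;> rcases tot hac (nadj h1).1 with t2 | t2 <;>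
    rcases tot hbc (nadj h1).2 with t3 | t3 <;> simp_all

end Permutation


/-! ### Directions in trees -/

section Directions

variable {X : Type*} {T : SimpleGraph X}

/-- The first vertex after `x` on the path of the tree from `x` to `u`. -/
noncomputable def IsTree.dir (hT : T.IsTree) (x u : X) : X :=
  (hT.existsUnique_path x u).choose.snd

namespace IsTree

variable (hT : T.IsTree)
include hT

theorem dir_eq_snd {x u : X} {p : T.Walk x u} (hp : p.IsPath) : hT.dir x u = p.snd := by
  unfold dir
  rw [(hT.existsUnique_path x u).choose_spec.2 p hp]

theorem exists_path (x u : X) : ∃ p : T.Walk x u, p.IsPath :=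
  (hT.existsUnique_path x u).exists

theorem adj_dir {x u : X} (h : x ≠ u) : T.Adj x (hT.dir x u) := by
  obtain ⟨p, hp⟩ := hT.exists_path x u
  rw [hT.dir_eq_snd hp]
  exact p.adj_snd (Walk.not_nil_of_ne h)

theorem dir_ne {x u : X} (h : x ≠ u) : hT.dir x u ≠ x := (hT.adj_dir h).ne'

@[simp]
theorem dir_self (x : X) : hT.dir x x = x := by
  rw [hT.dir_eq_snd (p := .nil) Walk.IsPath.nil]
  rfl

theorem dir_of_adj {x w : X} (h : T.Adj x w) : hT.dir x w = w := by
  rw [hT.dir_eq_snd (p := .cons h .nil) (by simp [h.ne])]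
  rfl

/-- Of the paths from `x` to the two ends of an edge, one extends the other. -/
theorem dir_eq_of_adj {x u v : X} (h : T.Adj u v) (hu : x ≠ u) (hv : x ≠ v) :
    hT.dir x u = hT.dir x v := by
  have key : ∀ {u v : X} (h : T.Adj u v) (hu : x ≠ u) {p : T.Walk x u} (hp : p.IsPath)
      (hv : v ∉ p.support), hT.dir x u = hT.dir x v := by
    intro u v h hu p hp hv
    rw [hT.dir_eq_snd hp, hT.dir_eq_snd (hp.concat hv h)]
    cases p with
    | nil => exact (hu rfl).elim
    | cons h q => simp [Walk.concat_cons]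
  obtain ⟨p, hp⟩ := hT.exists_path x u
  obtain ⟨q, hq⟩ := hT.exists_path x v
  by_cases hvp : v ∈ p.support
  · exact (key h.symm hv hq
      (hT.isAcyclic.ne_mem_support_of_support_of_adj_of_isPath hp hq h hvp)).symm
  · exact key h hu hp hvp

theorem dir_eq_of_walk {x u v : X} (p : T.Walk u v) (hp : x ∉ p.support) :
    hT.dir x u = hT.dir x v := by
  induction p with
  | nil => rfl
  | cons h q ih =>
    simp only [Walk.support_cons, List.mem_cons, not_or] at hp
    rw [← ih hp.2]
    exact hT.dir_eq_of_adj h hp.1 fun h ↦ hp.2 (h ▸ q.start_mem_support)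

/-- A path from `y` to `u` through `x` would leave `y` towards `x`. So the path avoids `x`, and its
two ends lie in one direction from `x`. -/
theorem dir_eq_dir {x y u : X} (hxy : x ≠ y) (h : hT.dir y u ≠ hT.dir y x) :
    hT.dir x u = hT.dir x y := by
  classical
  obtain ⟨p, hp⟩ := hT.exists_path y u
  by_cases hx : x ∈ p.support
  · refine (h ?_).elim
    rw [hT.dir_eq_snd hp, hT.dir_eq_snd (hp.takeUntil hx), Walk.snd_takeUntil hxy]
  · exact (hT.dir_eq_of_walk p hx).symm

/-- If `n` lies between `s` and `t`, then from every other vertex, `n` is in the direction of `s`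
or of `t`. -/
theorem dir_between {m n s t : X} (hmn : m ≠ n) (h : hT.dir n s ≠ hT.dir n t) :
    hT.dir m n = hT.dir m s ∨ hT.dir m n = hT.dir m t := by
  by_cases h' : hT.dir n s = hT.dir n m
  · right
    exact (hT.dir_eq_dir hmn (fun h2 ↦ h (h'.trans h2.symm))).symm
  · left
    exact (hT.dir_eq_dir hmn h').symm

theorem dir_dir {x u : X} (h : hT.dir x u ≠ u) : hT.dir (hT.dir x u) u ≠ x := by
  by_cases hx : x = u
  · subst hx; simp at h
  obtain ⟨p, hp⟩ := hT.exists_path x u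
  have := hT.dir_eq_snd hp
  cases p with
  | nil => exact (hx rfl).elim
  | @cons _ w _ hxw q =>
    rw [Walk.snd_cons] at this
    rw [this] at h ⊢
    rw [Walk.cons_isPath_iff] at hp
    rw [hT.dir_eq_snd hp.1]
    intro h'
    apply hp.2
    rw [← h']
    exact q.getVert_mem_support 1

theorem dir_getVert {a b : X} {p : T.Walk a b} (hp : p.IsPath) {n : ℕ} (hn : 0 < n)
    (hn' : n < p.length) : hT.dir (p.getVert n) a = p.getVert (n - 1) ∧
      hT.dir (p.getVert n) b = p.getVert (n + 1) := by
  constructor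
  · have h1 : (p.take n).reverse.IsPath := (hp.take n).reverse
    rw [hT.dir_eq_snd h1, Walk.snd_reverse, Walk.penultimate, Walk.take_getVert, Walk.take_length]
    congr 1
    omega
  · have h1 : (p.drop n).IsPath := hp.drop n
    rw [hT.dir_eq_snd h1, Walk.snd, Walk.drop_getVert]

theorem mem_support_iff {a b x : X} {p : T.Walk a b} (hp : p.IsPath) :
    x ∈ p.support ↔ x = a ∨ x = b ∨ hT.dir x a ≠ hT.dir x b := by
  constructor
  · intro hx
    obtain ⟨n, rfl, hn⟩ := Walk.mem_support_iff_exists_getVert.1 hx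
    by_cases h0 : n = 0
    · left; rw [h0]; exact p.getVert_zero
    by_cases h1 : n = p.length
    · right; left; rw [h1]; exact p.getVert_length
    right; right
    obtain ⟨e1, e2⟩ := hT.dir_getVert hp (n := n) (by omega) (by omega)
    rw [e1, e2]
    intro h
    have := hp.getVert_injOn (by simp; omega) (by simp; omega) h
    omega
  · rintro (rfl | rfl | h)
    · exact p.start_mem_support
    · exact p.end_mem_support
    · by_contra hx
      exact h (hT.dir_eq_of_walk p hx)

theorem infix_support_iff {a b w x w' : X} {p : T.Walk a b} (hp : p.IsPath) :
    [w, x, w'] <:+: p.support ↔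
      x ≠ a ∧ x ≠ b ∧ w = hT.dir x a ∧ w' = hT.dir x b ∧ w ≠ w' := by
  rw [List.infix_iff_getElem?]
  constructor
  · rintro ⟨k, hk, h⟩
    simp only [List.length_cons, List.length_nil, Walk.length_support] at hk
    have e0 := h 0 (by simp)
    have e1 := h 1 (by simp)
    have e2 := h 2 (by simp)
    rw [← Walk.getVert_eq_support_getElem? _ (by omega)] at e0 e1 e2
    simp only [zero_add, List.getElem_cons_zero, List.getElem_cons_succ, Option.some.injEq] at e0 e1 e2
    obtain ⟨f1, f2⟩ := hT.dir_getVert hp (n := 1 + k) (by omega) (by omega)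
    rw [show 1 + k - 1 = k by omega, e0, e1] at f1
    rw [show 1 + k + 1 = 2 + k by omega, e1, e2] at f2
    have inj := hp.getVert_injOn
    refine ⟨?_, ?_, f1.symm, f2.symm, ?_⟩
    · rintro rfl
      have := inj (x₁ := 1 + k) (x₂ := 0) (by simp; omega) (by simp) (by rw [e1, p.getVert_zero])
      omega
    · rintro rfl
      have := inj (x₁ := 1 + k) (x₂ := p.length) (by simp; omega) (by simp)
        (by rw [e1, p.getVert_length])
      omega
    · rintro rfl
      have := inj (x₁ := k) (x₂ := 2 + k) (by simp; omega) (by simp; omega) (by rw [e0, e2])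
      omega
  · rintro ⟨hxa, hxb, rfl, rfl, hne⟩
    have hx := (hT.mem_support_iff hp).2 (Or.inr (Or.inr hne))
    obtain ⟨n, rfl, hn⟩ := Walk.mem_support_iff_exists_getVert.1 hx
    have h0 : n ≠ 0 := by rintro rfl; exact hxa p.getVert_zero
    have h1 : n ≠ p.length := by rintro rfl; exact hxb p.getVert_length
    obtain ⟨e1, e2⟩ := hT.dir_getVert hp (n := n) (by omega) (by omega)
    rw [e1, e2]
    refine ⟨n - 1, by simp; omega, fun i hi ↦ ?_⟩
    rw [← Walk.getVert_eq_support_getElem? _ (by simp at hi; omega)]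
    simp only [List.length_cons, List.length_nil] at hi
    interval_cases i
    · simp
    · simp [show 1 + (n - 1) = n by omega]
    · simp [show 2 + (n - 1) = n + 1 by omega]

end IsTree

end Directions

end SimpleGraph

/-! ### Accessibility in terms of directions -/

namespace GraphLabelledTree

variable {L : Type u} (D : GraphLabelledTree L)

/-- The neighbour of `x` towards `u`. -/
noncomputable def dir (x u : L ⊕ D.Node) : L ⊕ D.Node := D.isTree.dir x u

/-- Adjacency in the label of `x`, as a relation on the vertices of the tree. -/
def Lab (x : D.Node) (w w' : L ⊕ D.Node) : Prop :=
  ∃ h h', (D.label x).Adj ⟨w, h⟩ ⟨w', h'⟩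

/-- At all nodes between `s` and `t` the markers of the path are adjacent. -/
def Open (s t : L ⊕ D.Node) : Prop :=
  ∀ n : D.Node, Sum.inr n ≠ s → Sum.inr n ≠ t →
    D.dir (Sum.inr n) s ≠ D.dir (Sum.inr n) t →
    D.Lab n (D.dir (Sum.inr n) s) (D.dir (Sum.inr n) t)

variable {D}

theorem Lab.symm {x : D.Node} {w w' : L ⊕ D.Node} (h : D.Lab x w w') : D.Lab x w' w :=
  ⟨h.2.1, h.1, h.2.2.symm⟩

theorem Lab.ne {x : D.Node} {w w' : L ⊕ D.Node} (h : D.Lab x w w') : w ≠ w' := by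
  obtain ⟨_, _, h⟩ := h
  exact fun e ↦ h.ne (Subtype.ext e)

theorem Lab.adj {x : D.Node} {w w' : L ⊕ D.Node} (h : D.Lab x w w') : D.tree.Adj (Sum.inr x) w :=
  h.1

theorem Open.symm {s t : L ⊕ D.Node} (h : D.Open s t) : D.Open t s :=
  fun n h1 h2 h3 ↦ (h n h2 h1 h3.symm).symm

theorem accessibilityGraph_adj_iff {u v : L} :
    D.accessibilityGraph.Adj u v ↔ u ≠ v ∧ D.Open (Sum.inl u) (Sum.inl v) := by
  refine and_congr_right fun huv ↦ ⟨?_, fun h ↦ ?_⟩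
  · rintro ⟨p, hp, h⟩ n hn hn' hne
    have a1 := D.isTree.adj_dir hn
    have a2 := D.isTree.adj_dir hn'
    exact ⟨a1, a2, h n ⟨_, a1⟩ ⟨_, a2⟩
      ((D.isTree.infix_support_iff hp).2 ⟨hn, hn', rfl, rfl, hne⟩)⟩
  · obtain ⟨p, hp⟩ := D.isTree.exists_path (Sum.inl u) (Sum.inl v)
    refine ⟨p, hp, fun n w w' hw ↦ ?_⟩
    obtain ⟨h1, h2, h3, h4, h5⟩ := (D.isTree.infix_support_iff hp).1 hw
    rw [h3, h4] at h5
    obtain ⟨_, _, h6⟩ := h n h1 h2 h5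
    have e3 : w = ⟨_, h3 ▸ w.2⟩ := Subtype.ext h3
    have e4 : w' = ⟨_, h4 ▸ w'.2⟩ := Subtype.ext h4
    rw [e3, e4]
    exact h6

theorem adj_dir {x u : L ⊕ D.Node} (h : x ≠ u) : D.tree.Adj x (D.dir x u) := D.isTree.adj_dir h

theorem dir_ne {x u : L ⊕ D.Node} (h : x ≠ u) : D.dir x u ≠ x := D.isTree.dir_ne h

@[simp]
theorem dir_self (x : L ⊕ D.Node) : D.dir x x = x := D.isTree.dir_self x

theorem dir_of_adj {x w : L ⊕ D.Node} (h : D.tree.Adj x w) : D.dir x w = w := D.isTree.dir_of_adj h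

theorem dir_eq_of_adj {x u v : L ⊕ D.Node} (h : D.tree.Adj u v) (hu : x ≠ u) (hv : x ≠ v) :
    D.dir x u = D.dir x v := D.isTree.dir_eq_of_adj h hu hv

theorem dir_eq_dir {x y u : L ⊕ D.Node} (hxy : x ≠ y) (h : D.dir y u ≠ D.dir y x) :
    D.dir x u = D.dir x y := D.isTree.dir_eq_dir hxy h

theorem dir_between {m n s t : L ⊕ D.Node} (hmn : m ≠ n) (h : D.dir n s ≠ D.dir n t) :
    D.dir m n = D.dir m s ∨ D.dir m n = D.dir m t := D.isTree.dir_between hmn h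

/-- Accessibility is composed at every node on the way. -/
theorem open_iff {s t : L ⊕ D.Node} {n : D.Node} (hs : Sum.inr n ≠ s) (ht : Sum.inr n ≠ t)
    (h : D.dir (Sum.inr n) s ≠ D.dir (Sum.inr n) t) :
    D.Open s t ↔ D.Open s (Sum.inr n) ∧ D.Open (Sum.inr n) t ∧
      D.Lab n (D.dir (Sum.inr n) s) (D.dir (Sum.inr n) t) := by
  have key : ∀ {s t : L ⊕ D.Node}, Sum.inr n ≠ s → Sum.inr n ≠ t →
      D.dir (Sum.inr n) s ≠ D.dir (Sum.inr n) t → D.Open s t → D.Open s (Sum.inr n) := by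
    intro s t hs ht h hst m hms hmn hne
    have hb := (dir_between hmn h).resolve_left hne.symm
    rw [hb]
    refine hst m hms (fun hmt ↦ ?_) (hb ▸ hne)
    subst hmt
    rw [dir_self] at hb
    exact dir_ne hmn hb
  refine ⟨fun hst ↦ ⟨key hs ht h hst, (key ht hs h.symm hst.symm).symm, hst n hs ht h⟩, ?_⟩
  rintro ⟨h1, h2, h3⟩ m hms hmt hne
  by_cases hmn : (Sum.inr m : L ⊕ D.Node) = Sum.inr n
  · have : m = n := Sum.inr_injective hmn
    subst this
    exact h3
  · rcases dir_between hmn h with e | e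
    · rw [← e] at hne ⊢
      exact h2 m hmn hmt hne
    · rw [← e] at hne ⊢
      exact h1 m hms hmn hne

end GraphLabelledTree

/-! ### Splits from twins and pendant vertices -/

namespace SimpleGraph

section Labels

variable {V W : Type*}

theorem IsDistanceHereditary.exists_twins_or_pendant_of_embedding [Finite W] [Nontrivial W]
    {G : SimpleGraph V} {H : SimpleGraph W} (h : G.IsDistanceHereditary) (f : H ↪g G) :
    ∃ u v, H.AreTwins u v ∨ (u ≠ v ∧ ∀ w, H.Adj u w → w = v) := by
  have : Nontrivial (Set.range f) := by
    obtain ⟨a, b, hab⟩ := exists_pair_ne W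
    exact ⟨⟨f a, a, rfl⟩, ⟨f b, b, rfl⟩, fun h ↦ hab (f.injective (congrArg Subtype.val h))⟩
  obtain ⟨⟨_, u, rfl⟩, ⟨_, v, rfl⟩, h⟩ := (h.induce (Set.range f)).exists_twins_or_pendant
  refine ⟨u, v, h.imp (fun ⟨h1, h2⟩ ↦ ⟨fun h ↦ h1 (Subtype.ext (congrArg f h)), fun w hu hv ↦ ?_⟩)
    fun ⟨h1, h2⟩ ↦ ⟨fun h ↦ h1 (Subtype.ext (congrArg f h)), fun w huw ↦ ?_⟩⟩
  · have := h2 ⟨f w, w, rfl⟩ (fun h ↦ hu (f.injective (congrArg Subtype.val h)))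
      fun h ↦ hv (f.injective (congrArg Subtype.val h))
    simpa using this
  · exact f.injective (congrArg Subtype.val (h2 ⟨f w, w, rfl⟩ (by simpa using huw)))

/-- The pair is one side of the split; four vertices are needed so that the other side has two. -/
theorem isSplit_of_twins_or_pendant [Finite W] {H : SimpleGraph W} (hW : 4 ≤ Nat.card W) {p q : W}
    (h : H.AreTwins p q ∨ (p ≠ q ∧ ∀ w, H.Adj p w → w = q)) : ∃ A B, H.IsSplit A B := by
  have hpq : p ≠ q := h.elim (fun h ↦ h.1) fun h ↦ h.1
  refine ⟨{p, q}, {p, q}ᶜ, rfl, ⟨p, by simp, q, by simp, hpq⟩, ?_, ?_⟩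
  · rw [← Set.one_lt_ncard_iff_nontrivial, Set.ncard_compl]
    have := Set.ncard_insert_le p {q}
    rw [Set.ncard_singleton] at this
    omega
  · rcases h with ⟨-, h⟩ | ⟨-, h⟩
    · refine ⟨{p, q}, subset_rfl, {w | H.Adj p w} ∩ {p, q}ᶜ, Set.inter_subset_right, ?_⟩
      intro a ha b hb
      have hb' := hb
      simp only [Set.mem_compl_iff, Set.mem_insert_iff, Set.mem_singleton_iff, not_or] at hb'
      rcases ha with rfl | rfl
      · simp [hb']
      · simp [hb', h b hb'.1 hb'.2]
    · refine ⟨{q}, by simp, {w | H.Adj q w} ∩ {p, q}ᶜ, Set.inter_subset_right, ?_⟩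
      intro a ha b hb
      have hb' := hb
      simp only [Set.mem_compl_iff, Set.mem_insert_iff, Set.mem_singleton_iff, not_or] at hb'
      rcases ha with rfl | rfl
      · have : ¬H.Adj a b := fun h' ↦ hb'.2 (h b h')
        simp [hpq, this]
      · simp [hb']

theorem eq_top_or_eq_starGraph_of_card_eq_three {H : SimpleGraph W} (hW : Nat.card W = 3)
    (hc : H.Connected) : H = ⊤ ∨ ∃ c, H = starGraph c := by
  have : Finite W := Nat.finite_of_card_ne_zero (by omega)
  have : Nontrivial W := Finite.one_lt_card_iff_nontrivial.1 (by omega)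
  by_cases h : ∀ a b, a ≠ b → H.Adj a b
  · left
    ext a b
    exact ⟨fun h ↦ h.ne, fun hab ↦ h a b hab⟩
  · right
    push Not at h
    obtain ⟨a, b, hab, hadj⟩ := h
    obtain ⟨c, hac⟩ := hc.preconnected.exists_adj_of_nontrivial a
    obtain ⟨d, hbd⟩ := hc.preconnected.exists_adj_of_nontrivial b
    have hbc : b ≠ c := by rintro rfl; exact hadj hac
    have huniv : ({a, b, c} : Set W) = Set.univ := by
      apply Set.eq_of_subset_of_ncard_le (Set.subset_univ _)
      rw [Set.ncard_univ, hW, Set.ncard_eq_three.2 ⟨a, b, c, hab, hac.ne, hbc, rfl⟩]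
    have hall : ∀ w, w = a ∨ w = b ∨ w = c := fun w ↦ by
      have : w ∈ ({a, b, c} : Set W) := huniv ▸ Set.mem_univ w
      simpa using this
    have hbc' : H.Adj b c := by
      rcases hall d with rfl | rfl | rfl
      · exact (hadj hbd.symm).elim
      · exact (hbd.ne rfl).elim
      · exact hbd
    have n := H.adj_comm
    refine ⟨c, ?_⟩
    ext u v
    rw [starGraph_adj]
    rcases hall u with rfl | rfl | rfl <;> rcases hall v with rfl | rfl | rfl <;> simp [*] <;> grind

end Labels

end SimpleGraph

/-! ### Labels of distance-hereditary graphs are cliques and stars -/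

namespace GraphLabelledTree

open SimpleGraph

variable {L : Type u} (D : GraphLabelledTree L)

/-- The label of `x` is a star with centre `c`. -/
def StarAt (x : D.Node) (c : L ⊕ D.Node) : Prop :=
  D.tree.Adj (Sum.inr x) c ∧ ∀ w w', D.Lab x w w' ↔
    D.tree.Adj (Sum.inr x) w ∧ D.tree.Adj (Sum.inr x) w' ∧ w ≠ w' ∧ (w = c ∨ w' = c)

/-- The label of `x` is a clique. -/
def CliqueAt (x : D.Node) : Prop :=
  ∀ w w', D.Lab x w w' ↔ D.tree.Adj (Sum.inr x) w ∧ D.tree.Adj (Sum.inr x) w' ∧ w ≠ w'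

variable {D}

theorem isStarWithCentre_iff {x : D.Node} {c : D.tree.neighborSet (Sum.inr x)} :
    D.IsStarWithCentre x c ↔ D.StarAt x c := by
  constructor
  · intro h
    refine ⟨c.2, fun w w' ↦ ?_⟩
    unfold Lab
    rw [show D.label x = starGraph c from h]
    simp only [starGraph_adj, ne_eq, Subtype.ext_iff, mem_neighborSet]
    exact ⟨fun ⟨h, h', h2⟩ ↦ ⟨h, h', h2⟩, fun ⟨h, h', h2⟩ ↦ ⟨h, h', h2⟩⟩
  · intro h
    unfold IsStarWithCentre
    ext ⟨w, hw⟩ ⟨w', hw'⟩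
    rw [starGraph_adj]
    have := h.2 w w'
    unfold Lab at this
    simp only [mem_neighborSet] at hw hw'
    simp only [mem_neighborSet, hw, hw', exists_true_left, true_and] at this
    rw [this]
    simp [Subtype.ext_iff]

theorem isClique_iff {x : D.Node} : D.IsClique x ↔ D.CliqueAt x := by
  constructor
  · intro h w w'
    unfold Lab
    rw [show D.label x = ⊤ from h]
    simp only [top_adj, ne_eq, Subtype.mk.injEq, mem_neighborSet]
    exact ⟨fun ⟨h, h', h2⟩ ↦ ⟨h, h', h2⟩, fun ⟨h, h', h2⟩ ↦ ⟨h, h', h2⟩⟩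
  · intro h
    unfold IsClique
    ext ⟨w, hw⟩ ⟨w', hw'⟩
    have := h w w'
    unfold Lab at this
    simp only [mem_neighborSet] at hw hw'
    simp only [mem_neighborSet, hw, hw', exists_true_left, true_and] at this
    rw [this]
    simp

/-- Behind every marker there is a leaf; on the way to it, the node `y` is left through a marker
that is in the relation `P y` to the marker through which it is entered. -/
theorem exists_leaf_of_exists_next [Finite L] (P : D.Node → L ⊕ D.Node → L ⊕ D.Node → Prop)
    (hP : ∀ y v, D.tree.Adj (Sum.inr y) v → ∃ w, D.tree.Adj (Sum.inr y) w ∧ w ≠ v ∧ P y v w)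
    {x w : L ⊕ D.Node} (hxw : D.tree.Adj x w) :
    ∃ u : L, D.dir x (Sum.inl u) = w ∧ ∀ n : D.Node, Sum.inr n ≠ x →
      D.dir (Sum.inr n) x ≠ D.dir (Sum.inr n) (Sum.inl u) →
      P n (D.dir (Sum.inr n) x) (D.dir (Sum.inr n) (Sum.inl u)) := by
  have := D.finite_node
  -- The induction is on the number of tree vertices behind the marker, which drops with every step
  -- away from `x`.
  induction hk : {z | D.dir x z = w}.ncard using Nat.strong_induction_on generalizing x w with
  | _ k ih =>
    rcases w with u | y
    · refine ⟨u, dir_of_adj hxw, fun n hn hne ↦ (hne ?_).elim⟩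
      exact dir_eq_of_adj hxw hn (by simp)
    · obtain ⟨w', hw', hne', hP'⟩ := hP y x hxw.symm
      have hyx := dir_of_adj hxw.symm
      have hsub : ∀ z, D.dir (Sum.inr y) z = w' → D.dir x z = Sum.inr y := by
        intro z hz
        rw [dir_eq_dir hxw.ne (by rw [hz, hyx]; exact hne'), dir_of_adj hxw]
      have hss : {z | D.dir (Sum.inr y) z = w'} ⊂ {z | D.dir x z = Sum.inr y} := by
        refine Set.ssubset_iff_of_subset hsub |>.2 ⟨Sum.inr y, dir_of_adj hxw, fun h ↦ ?_⟩
        have h : D.dir (Sum.inr y) (Sum.inr y) = w' := h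
        rw [dir_self] at h
        exact hw'.ne h
      obtain ⟨u, hu, hu'⟩ := ih _ (hk ▸ Set.ncard_lt_ncard hss (Set.toFinite _)) hw' rfl
      refine ⟨u, hsub _ hu, fun n hn hne ↦ ?_⟩
      by_cases hny : n = y
      · subst hny
        rw [hyx, hu]
        exact hP'
      · have e := dir_eq_of_adj hxw hn (fun h ↦ hny (Sum.inr_injective h))
        rw [e] at hne ⊢
        exact hu' n (fun h ↦ hny (Sum.inr_injective h)) hne

theorem exists_adj_ne (x : D.Node) (v : L ⊕ D.Node) : ∃ w, D.tree.Adj (Sum.inr x) w ∧ w ≠ v := by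
  have h := D.node_degree x
  obtain ⟨w, hw, hwv⟩ := Set.exists_ne_of_one_lt_ncard (by omega : 1 < (D.tree.neighborSet (Sum.inr x)).ncard) v
  exact ⟨w, hw, hwv⟩

theorem exists_leaf [Finite L] {x w : L ⊕ D.Node} (hxw : D.tree.Adj x w) :
    ∃ u : L, D.dir x (Sum.inl u) = w := by
  obtain ⟨u, hu, -⟩ := exists_leaf_of_exists_next (fun _ _ _ ↦ True)
    (fun y v _ ↦ let ⟨w, h1, h2⟩ := exists_adj_ne y v; ⟨w, h1, h2, trivial⟩) hxw
  exact ⟨u, hu⟩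

theorem inl_adj_unique [Finite L] {l : L} {a b : L ⊕ D.Node} (ha : D.tree.Adj (Sum.inl l) a)
    (hb : D.tree.Adj (Sum.inl l) b) : a = b := by
  have := D.finite_node
  exact (Set.ncard_le_one (Set.toFinite _)).1 (D.leaf_degree l) a ha b hb

/-- Adjacent leaves lie behind equal or adjacent markers of `x`, so walks of the accessibility graph
project to the label; every marker has a leaf behind it. -/
theorem label_connected [Finite L] (h : D.accessibilityGraph.Connected) (x : D.Node) :
    (D.label x).Connected := by
  have key : ∀ (u v : L), D.accessibilityGraph.Walk u v →
      (D.label x).Reachable ⟨D.dir (Sum.inr x) (Sum.inl u), adj_dir (by simp)⟩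
        ⟨D.dir (Sum.inr x) (Sum.inl v), adj_dir (by simp)⟩ := by
    intro u v p
    induction p with
    | nil => exact Reachable.refl _
    | @cons u w v huw q ih =>
      refine Reachable.trans ?_ ih
      by_cases he : D.dir (Sum.inr x) (Sum.inl u) = D.dir (Sum.inr x) (Sum.inl w)
      · have : (⟨D.dir (Sum.inr x) (Sum.inl u), adj_dir (by simp)⟩ : D.tree.neighborSet (Sum.inr x))
            = ⟨D.dir (Sum.inr x) (Sum.inl w), adj_dir (by simp)⟩ := Subtype.ext he
        rw [this]
      · obtain ⟨_, _, h⟩ := (accessibilityGraph_adj_iff.1 huw).2 x (by simp) (by simp) he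
        exact h.reachable
  have hne : Nonempty (D.tree.neighborSet (Sum.inr x)) := by
    obtain ⟨w, hw, -⟩ := exists_adj_ne x (Sum.inr x)
    exact ⟨⟨w, hw⟩⟩
  refine ⟨fun ⟨w, hw⟩ ⟨w', hw'⟩ ↦ ?_⟩
  obtain ⟨u, rfl⟩ := exists_leaf hw
  obtain ⟨v, rfl⟩ := exists_leaf hw'
  obtain ⟨p⟩ := h.preconnected u v
  exact key u v p

theorem exists_lab [Finite L] (h : D.accessibilityGraph.Connected) (x : D.Node) (w : L ⊕ D.Node)
    (hw : D.tree.Adj (Sum.inr x) w) : ∃ w', D.Lab x w w' := by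
  have : Nontrivial (D.tree.neighborSet (Sum.inr x)) := by
    obtain ⟨w', hw', hne⟩ := exists_adj_ne x w
    exact ⟨⟨w, hw⟩, ⟨w', hw'⟩, fun h ↦ hne (congrArg Subtype.val h).symm⟩
  obtain ⟨⟨w', hw'⟩, h⟩ := (label_connected h x).preconnected.exists_adj_of_nontrivial ⟨w, hw⟩
  exact ⟨w', hw, hw', h⟩

theorem exists_open_leaf [Finite L] (h : D.accessibilityGraph.Connected) {x w : L ⊕ D.Node}
    (hxw : D.tree.Adj x w) : ∃ u : L, D.dir x (Sum.inl u) = w ∧ D.Open x (Sum.inl u) := by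
  obtain ⟨u, hu, hu'⟩ := exists_leaf_of_exists_next (fun n w w' ↦ D.Lab n w w')
    (fun y v hv ↦ let ⟨w, hw⟩ := exists_lab h y v hv; ⟨w, hw.symm.adj, hw.ne.symm, hw⟩) hxw
  exact ⟨u, hu, fun n hn _ ↦ hu' n hn⟩

/-- Leaves that are accessible from `x` behind different markers are adjacent if the markers are. -/
theorem adj_iff_lab {x : D.Node} {u v : L}
    (hu : D.Open (Sum.inr x) (Sum.inl u)) (hv : D.Open (Sum.inr x) (Sum.inl v))
    (h : D.dir (Sum.inr x) (Sum.inl u) ≠ D.dir (Sum.inr x) (Sum.inl v)) :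
    D.accessibilityGraph.Adj u v ↔
      D.Lab x (D.dir (Sum.inr x) (Sum.inl u)) (D.dir (Sum.inr x) (Sum.inl v)) := by
  rw [accessibilityGraph_adj_iff, open_iff (by simp) (by simp) h]
  refine ⟨fun h ↦ h.2.2.2, fun h' ↦ ⟨?_, hu.symm, hv, h'⟩⟩
  rintro rfl
  exact h rfl

variable (D) in
/-- All labels are cliques or stars, and the tree is reduced at its star nodes. -/
structure IsCliqueStarTree : Prop where
  connected : D.accessibilityGraph.Connected
  exists_third : ∀ (x : D.Node) (a b : L ⊕ D.Node), ∃ w, D.tree.Adj (Sum.inr x) w ∧ w ≠ a ∧ w ≠ b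
  type : ∀ x, D.CliqueAt x ∨ ∃ c, D.StarAt x c
  star_reduced : ∀ x y c c', D.StarAt x c → D.StarAt y c' → c = Sum.inr y → c' = Sum.inr x

/-- Choosing an accessible leaf behind each marker embeds a label in `G`. With four or more vertices
it therefore has twins or a pendant vertex, hence a split; with three, being connected, it is a
triangle or a star. -/
theorem IsSplitDecompositionOf.isCliqueStarTree [Finite L] {G : SimpleGraph L}
    (h : D.IsSplitDecompositionOf G) (hG : G.IsDistanceHereditary) (hc : G.Connected) :
    D.IsCliqueStarTree := by
  have := D.finite_node
  have hconn : D.accessibilityGraph.Connected := by rw [h.accessibilityGraph_eq]; exact hc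
  refine ⟨hconn, fun x a b ↦ ?_, fun x ↦ ?_, fun x y c c' hx hy hcy ↦ ?_⟩
  · have h3 := h.three_le_degree x
    have h2 : ({a, b} : Set (L ⊕ D.Node)).ncard ≤ 2 := by
      have := Set.ncard_insert_le a {b}
      rwa [Set.ncard_singleton] at this
    obtain ⟨w, hw, hw'⟩ := Set.exists_mem_notMem_of_ncard_lt_ncard
      (h2.trans_lt (by omega : 2 < (D.tree.neighborSet (Sum.inr x)).ncard)) (Set.toFinite _)
    simp only [Set.mem_insert_iff, Set.mem_singleton_iff, not_or] at hw'
    exact ⟨w, hw, hw'.1, hw'.2⟩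
  · rw [← isClique_iff]
    suffices D.IsClique x ∨ D.IsStar x from
      this.imp_right fun ⟨c, hc⟩ ↦ ⟨c, isStarWithCentre_iff.1 hc⟩
    by_contra hnot
    rw [not_or] at hnot
    have hsplit := ((h.label_type x).resolve_left hnot.1).resolve_left hnot.2
    have hlc := label_connected hconn x
    by_cases h4 : 4 ≤ (D.tree.neighborSet (Sum.inr x)).ncard
    · have : Nontrivial (D.tree.neighborSet (Sum.inr x)) :=
        Set.Nontrivial.coe_sort (Set.one_lt_ncard_iff_nontrivial.1 (by omega))
      have hex : ∀ w : D.tree.neighborSet (Sum.inr x), ∃ u : L,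
          D.dir (Sum.inr x) (Sum.inl u) = w ∧ D.Open (Sum.inr x) (Sum.inl u) :=
        fun w ↦ exists_open_leaf hconn w.2
      choose g hg hg' using hex
      let f : D.label x ↪g D.accessibilityGraph := ⟨⟨g, fun a b hab ↦ Subtype.ext (by
        rw [← hg a, ← hg b, hab])⟩, by
        intro a b
        change D.accessibilityGraph.Adj (g a) (g b) ↔ _
        by_cases hab : a = b
        · subst hab; simp
        · rw [adj_iff_lab (hg' a) (hg' b)
            (by rw [hg, hg]; exact fun h ↦ hab (Subtype.ext h)), hg, hg]
          exact ⟨fun ⟨_, _, h⟩ ↦ h, fun h ↦ ⟨a.2, b.2, h⟩⟩⟩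
      rw [h.accessibilityGraph_eq] at f
      obtain ⟨p, q, hpq⟩ := hG.exists_twins_or_pendant_of_embedding f
      obtain ⟨A, B, hAB⟩ := isSplit_of_twins_or_pendant (by rwa [Nat.card_coe_set_eq]) hpq
      exact hsplit A B hAB
    · have h3 : Nat.card (D.tree.neighborSet (Sum.inr x)) = 3 := by
        rw [Nat.card_coe_set_eq]
        have := h.three_le_degree x
        omega
      exact (eq_top_or_eq_starGraph_of_card_eq_three h3 hlc).elim hnot.1 fun ⟨c, hc⟩ ↦ hnot.2 ⟨c, hc⟩
  · exact h.star_reduced x y ⟨c, hx.1⟩ ⟨c', hy.1⟩ (isStarWithCentre_iff.2 hx)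
      (isStarWithCentre_iff.2 hy) hcy

end GraphLabelledTree

/-! ### Stars, induced paths, and pointing to edges and paths -/

namespace GraphLabelledTree

open SimpleGraph

variable {L : Type u} {D : GraphLabelledTree L}

theorem StarAt.adj {x : D.Node} {c : L ⊕ D.Node} (h : D.StarAt x c) : D.tree.Adj (Sum.inr x) c := h.1

theorem StarAt.unique {x : D.Node} {c c' : L ⊕ D.Node} (h : D.StarAt x c) (h' : D.StarAt x c')
    (h3 : ∀ a b : L ⊕ D.Node, ∃ w, D.tree.Adj (Sum.inr x) w ∧ w ≠ a ∧ w ≠ b) : c = c' := by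
  by_contra hne
  obtain ⟨w, hw, h1, h2⟩ := h3 c c'
  have := ((h.2 c w).2 ⟨h.1, hw, h1.symm, .inl rfl⟩)
  rw [h'.2] at this
  grind

/-- Two distinct markers of a star node are adjacent if and only if one of them is the centre. -/
theorem StarAt.lab_dir_iff {x : D.Node} {c : L ⊕ D.Node} (h : D.StarAt x c) {s t : L ⊕ D.Node}
    (hs : Sum.inr x ≠ s) (ht : Sum.inr x ≠ t) :
    D.Lab x (D.dir (Sum.inr x) s) (D.dir (Sum.inr x) t) ↔
      D.dir (Sum.inr x) s ≠ D.dir (Sum.inr x) t ∧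
      (D.dir (Sum.inr x) s = c ∨ D.dir (Sum.inr x) t = c) := by
  rw [h.2]
  exact ⟨fun h ↦ h.2.2, fun h ↦ ⟨adj_dir hs, adj_dir ht, h⟩⟩

theorem lab_of_adj {u v : L} (h : D.accessibilityGraph.Adj u v) {x : D.Node}
    (hx : D.dir (Sum.inr x) (Sum.inl u) ≠ D.dir (Sum.inr x) (Sum.inl v)) :
    D.Lab x (D.dir (Sum.inr x) (Sum.inl u)) (D.dir (Sum.inr x) (Sum.inl v)) :=
  (accessibilityGraph_adj_iff.1 h).2 x (by simp) (by simp) hx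

namespace IsCliqueStarTree

variable (h : D.IsCliqueStarTree)
include h

theorem centre_unique {x : D.Node} {c c' : L ⊕ D.Node} (hc : D.StarAt x c) (hc' : D.StarAt x c') :
    c = c' := hc.unique hc' (h.exists_third x)

theorem exists_star_of_not_open {s t : L ⊕ D.Node} (hst : ¬D.Open s t) :
    ∃ x c, D.StarAt x c ∧ Sum.inr x ≠ s ∧ Sum.inr x ≠ t ∧
      D.dir (Sum.inr x) s ≠ D.dir (Sum.inr x) t ∧
      D.dir (Sum.inr x) s ≠ c ∧ D.dir (Sum.inr x) t ≠ c := by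
  simp only [Open, not_forall] at hst
  obtain ⟨x, hs, ht, hne, hl⟩ := hst
  rcases h.type x with hx | ⟨c, hx⟩
  · exact (hl ((hx _ _).2 ⟨adj_dir hs, adj_dir ht, hne⟩)).elim
  · rw [hx.lab_dir_iff hs ht] at hl
    exact ⟨x, c, hx, hs, ht, hne, by grind, by grind⟩

/-- Some star separates `u` from `w` with its centre towards neither. If `v` were not behind the
centre either, its adjacency to both would put all three behind one marker. -/
theorem exists_star_of_path_three {u v w : L} (huv : D.accessibilityGraph.Adj u v)
    (hvw : D.accessibilityGraph.Adj v w) (huw : ¬D.accessibilityGraph.Adj u w) (hne : u ≠ w) :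
    ∃ x c, D.StarAt x c ∧ D.dir (Sum.inr x) (Sum.inl v) = c ∧ D.dir (Sum.inr x) (Sum.inl u) ≠ c ∧
      D.dir (Sum.inr x) (Sum.inl w) ≠ c ∧
      D.dir (Sum.inr x) (Sum.inl u) ≠ D.dir (Sum.inr x) (Sum.inl w) := by
  have hno : ¬D.Open (Sum.inl u) (Sum.inl w) :=
    fun h' ↦ huw (accessibilityGraph_adj_iff.2 ⟨hne, h'⟩)
  obtain ⟨x, c, hx, -, -, h1, h2, h3⟩ := h.exists_star_of_not_open hno
  refine ⟨x, c, hx, ?_, h2, h3, h1⟩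
  by_contra hv
  have e1 : D.dir (Sum.inr x) (Sum.inl u) = D.dir (Sum.inr x) (Sum.inl v) := by
    by_contra hh
    have := lab_of_adj huv hh
    rw [hx.lab_dir_iff (by simp) (by simp)] at this
    grind
  have e2 : D.dir (Sum.inr x) (Sum.inl v) = D.dir (Sum.inr x) (Sum.inl w) := by
    by_contra hh
    have := lab_of_adj hvw hh
    rw [hx.lab_dir_iff (by simp) (by simp)] at this
    grind
  exact h1 (e1.trans e2)

/-- The star comes from the path `a b c`. If `d` were not behind the marker of `c`, it would be
behind the centre, and then `a` and `d` would be adjacent: a node between them other than `x`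
separates `c` from `d` or `a` from `b` in the same way, and these pairs are adjacent. -/
theorem exists_star_of_isPathFour {a b c d : L} (hp : D.accessibilityGraph.IsPathFour a b c d) :
    ∃ x z, D.StarAt x z ∧ D.dir (Sum.inr x) (Sum.inl b) = z ∧ D.dir (Sum.inr x) (Sum.inl a) ≠ z ∧
      D.dir (Sum.inr x) (Sum.inl c) ≠ z ∧
      D.dir (Sum.inr x) (Sum.inl a) ≠ D.dir (Sum.inr x) (Sum.inl c) ∧
      D.dir (Sum.inr x) (Sum.inl d) = D.dir (Sum.inr x) (Sum.inl c) := by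
  obtain ⟨hab, hbc, hcd, hac, hbd, had⟩ := hp
  have hne : a ≠ c := by rintro rfl; exact had hcd
  have hne' : a ≠ d := by rintro rfl; exact hbd hab.symm
  obtain ⟨x, z, hx, h1, h2, h3, h4⟩ := h.exists_star_of_path_three hab hbc hac hne
  refine ⟨x, z, hx, h1, h2, h3, h4, ?_⟩
  by_contra hd
  have h5 : D.dir (Sum.inr x) (Sum.inl d) = z := by
    have := lab_of_adj hcd (x := x) (fun h ↦ hd h.symm)
    rw [hx.lab_dir_iff (by simp) (by simp)] at this
    grind
  refine had (accessibilityGraph_adj_iff.2 ⟨hne', fun m _ _ hm ↦ ?_⟩)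
  by_cases hmx : m = x
  · subst hmx
    rw [hx.lab_dir_iff (by simp) (by simp)]
    exact ⟨hm, .inr h5⟩
  have hmx' : (Sum.inr m : L ⊕ D.Node) ≠ Sum.inr x := fun h ↦ hmx (Sum.inr_injective h)
  rcases dir_between hmx' (s := Sum.inl a) (t := Sum.inl d) (by grind) with e | e
  · rcases dir_between hmx' (s := Sum.inl c) (t := Sum.inl d) (by grind) with e' | e'
    · rw [← e, e'] at hm ⊢
      exact lab_of_adj hcd hm
    · exact (hm (e.symm.trans e')).elim
  · rcases dir_between hmx' (s := Sum.inl a) (t := Sum.inl b) (by grind) with e' | e'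
    · exact (hm (e'.symm.trans e)).elim
    · rw [← e, e'] at hm ⊢
      exact lab_of_adj hab hm

end IsCliqueStarTree

variable (D) in
/-- The stars `x` and `y`, with centres `c` and `c'`, do not point to each other. -/
def AwayPair (x : D.Node) (c : L ⊕ D.Node) (y : D.Node) (c' : L ⊕ D.Node) : Prop :=
  D.StarAt x c ∧ D.StarAt y c' ∧ x ≠ y ∧ D.dir (Sum.inr x) (Sum.inr y) ≠ c ∧
    D.dir (Sum.inr y) (Sum.inr x) ≠ c'

theorem inr_ne {x y : D.Node} (h : x ≠ y) : (Sum.inr x : L ⊕ D.Node) ≠ Sum.inr y :=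
  fun e ↦ h (Sum.inr_injective e)

namespace IsCliqueStarTree

variable (h : D.IsCliqueStarTree)
include h

/-- The star at `b` and the star at `c`, the latter from the reversed path, turn their centres away
from each other: each keeps two vertices, the centre vertex of the other among them, behind one
non-central marker. -/
theorem exists_awayPair_of_isPathFour {a b c d : L}
    (hp : D.accessibilityGraph.IsPathFour a b c d) :
    ∃ x z y z', D.AwayPair x z y z' ∧ D.dir (Sum.inr x) (Sum.inl b) = z ∧
      D.dir (Sum.inr x) (Sum.inl a) ≠ z ∧ D.dir (Sum.inr x) (Sum.inl c) ≠ z ∧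
      D.dir (Sum.inr x) (Sum.inl a) ≠ D.dir (Sum.inr x) (Sum.inl c) ∧
      D.dir (Sum.inr y) (Sum.inl c) = z' ∧ D.dir (Sum.inr y) (Sum.inl d) ≠ z' ∧
      D.dir (Sum.inr y) (Sum.inl b) ≠ z' ∧
      D.dir (Sum.inr y) (Sum.inl d) ≠ D.dir (Sum.inr y) (Sum.inl b) := by
  obtain ⟨x, z, hx, h1, h2, h3, h4, h5⟩ := h.exists_star_of_isPathFour hp
  have hp' : D.accessibilityGraph.IsPathFour d c b a := by
    obtain ⟨hab, hbc, hcd, hac, hbd, had⟩ := hp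
    exact ⟨hcd.symm, hbc.symm, hab.symm, fun h ↦ hbd h.symm, fun h ↦ hac h.symm, fun h ↦ had h.symm⟩
  obtain ⟨y, z', hy, k1, k2, k3, k4, k5⟩ := h.exists_star_of_isPathFour hp'
  have hxy : x ≠ y := by
    rintro rfl
    exact k2 (h5.trans k1)
  refine ⟨x, z, y, z', ⟨hx, hy, hxy, ?_, ?_⟩, h1, h2, h3, h4, k1, k2, k3, k4⟩
  · rcases dir_between (inr_ne hxy) (s := Sum.inl c) (t := Sum.inl d) (by rw [k1]; exact k2.symm)
      with e | e <;> rw [e]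
    · exact h3
    · rw [h5]; exact h3
  · rcases dir_between (inr_ne hxy.symm) (s := Sum.inl b) (t := Sum.inl a)
      (by rw [h1]; exact h2.symm) with e | e <;> rw [e]
    · exact k3
    · rw [k5]; exact k3

/-- Among the stars that do not point to `s` and lie in a given direction there is one with no
obstruction between itself and `s`. -/
theorem exists_open_star [Finite L] {s : L ⊕ D.Node} {y : D.Node} {c : L ⊕ D.Node}
    (hy : D.StarAt y c) (hsy : s ≠ Sum.inr y) (hc : D.dir (Sum.inr y) s ≠ c) :
    ∃ n z, D.StarAt n z ∧ s ≠ Sum.inr n ∧ D.dir (Sum.inr n) s ≠ z ∧ D.Open s (Sum.inr n) ∧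
      D.dir s (Sum.inr n) = D.dir s (Sum.inr y) := by
  have := D.finite_node
  induction hk : {m | D.dir m s ≠ D.dir m (Sum.inr y) ∧ m ≠ Sum.inr y}.ncard using
    Nat.strong_induction_on generalizing y c with
  | _ k ih =>
    by_cases ho : D.Open s (Sum.inr y)
    · exact ⟨y, c, hy, hsy, hc, ho, rfl⟩
    obtain ⟨n, z, hn, hns, hny, hne, h1, h2⟩ := h.exists_star_of_not_open ho
    have e1 : D.dir (Sum.inr y) s = D.dir (Sum.inr y) (Sum.inr n) := dir_eq_dir hny.symm hne
    have e2 : D.dir s (Sum.inr y) = D.dir s (Sum.inr n) := dir_eq_dir hns.symm hne.symm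
    have hss : {m | D.dir m s ≠ D.dir m (Sum.inr n) ∧ m ≠ Sum.inr n} ⊂
        {m | D.dir m s ≠ D.dir m (Sum.inr y) ∧ m ≠ Sum.inr y} := by
      refine Set.ssubset_iff_of_subset ?_ |>.2 ⟨Sum.inr n, ⟨hne, hny⟩, fun h ↦ h.2 rfl⟩
      rintro m ⟨hm, hmn⟩
      have e := (dir_between hmn hne).resolve_left hm.symm
      refine ⟨e ▸ hm, ?_⟩
      rintro rfl
      exact hm e1
    obtain ⟨n', z', k1, k2, k3, k4, k5⟩ :=
      ih _ (hk ▸ Set.ncard_lt_ncard hss (Set.toFinite _)) hn hns.symm h1 rfl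
    exact ⟨n', z', k1, k2, k3, k4, k5.trans e2.symm⟩

/-- First `y` is replaced by a star `n` in the same direction that is accessible from `x`. The inner
vertices of the path are leaves behind the two centres, the ends are leaves behind a third marker at
each of the two nodes. -/
theorem exists_isPathFour_of_awayPair [Finite L] {x y : D.Node} {c c' : L ⊕ D.Node}
    (hxy : D.AwayPair x c y c') : ∃ a b d e, D.accessibilityGraph.IsPathFour a b d e := by
  obtain ⟨hx, hy, hne, h1, h2⟩ := hxy
  obtain ⟨n, z, hn, hxn, hz, ho, hd⟩ := h.exists_open_star hy (inr_ne hne) h2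
  rw [← hd] at h1
  clear hd h2 hy hne
  obtain ⟨w, hw, hwc, hwn⟩ := h.exists_third x c (D.dir (Sum.inr x) (Sum.inr n))
  obtain ⟨w', hw', hwc', hwn'⟩ := h.exists_third n z (D.dir (Sum.inr n) (Sum.inr x))
  obtain ⟨b, hb, hb'⟩ := exists_open_leaf h.connected hx.adj
  obtain ⟨a, ha, ha'⟩ := exists_open_leaf h.connected hw
  obtain ⟨d, hd, hd'⟩ := exists_open_leaf h.connected hn.adj
  obtain ⟨e, he, he'⟩ := exists_open_leaf h.connected hw'
  have xd : D.dir (Sum.inr x) (Sum.inl d) = D.dir (Sum.inr x) (Sum.inr n) :=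
    dir_eq_dir hxn (by rw [hd]; exact hz.symm)
  have xe : D.dir (Sum.inr x) (Sum.inl e) = D.dir (Sum.inr x) (Sum.inr n) :=
    dir_eq_dir hxn (by rw [he]; exact hwn')
  have nb : D.dir (Sum.inr n) (Sum.inl b) = D.dir (Sum.inr n) (Sum.inr x) :=
    dir_eq_dir hxn.symm (by rw [hb]; exact h1.symm)
  have hod : D.Open (Sum.inr x) (Sum.inl d) := by
    rw [open_iff hxn.symm (by simp) (by rw [hd]; exact hz)]
    refine ⟨ho, hd', ?_⟩
    rw [hn.lab_dir_iff hxn.symm (by simp), hd]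
    exact ⟨hz, .inr rfl⟩
  have X : ∀ {u v : L}, D.accessibilityGraph.Adj u v →
      D.dir (Sum.inr x) (Sum.inl u) ≠ D.dir (Sum.inr x) (Sum.inl v) →
      D.dir (Sum.inr x) (Sum.inl u) = c ∨ D.dir (Sum.inr x) (Sum.inl v) = c := fun h hne ↦
    ((hx.lab_dir_iff (by simp) (by simp)).1 (lab_of_adj h hne)).2
  have N : ∀ {u v : L}, D.accessibilityGraph.Adj u v →
      D.dir (Sum.inr n) (Sum.inl u) ≠ D.dir (Sum.inr n) (Sum.inl v) →
      D.dir (Sum.inr n) (Sum.inl u) = z ∨ D.dir (Sum.inr n) (Sum.inl v) = z := fun h hne ↦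
    ((hn.lab_dir_iff (by simp) (by simp)).1 (lab_of_adj h hne)).2
  refine ⟨a, b, d, e, ?_, ?_, ?_, ?_, ?_, ?_⟩
  · rw [adj_iff_lab ha' hb' (by rw [ha, hb]; exact hwc), hx.lab_dir_iff (by simp) (by simp)]
    grind
  · rw [adj_iff_lab hb' hod (by grind), hx.lab_dir_iff (by simp) (by simp)]
    grind
  · rw [adj_iff_lab hd' he' (by grind), hn.lab_dir_iff (by simp) (by simp)]
    grind
  · intro h; have := X h; grind
  · intro h; have := N h; grind
  · intro h; have := X h; grind

end IsCliqueStarTree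

/-- Away from `x` both ends of the edge lie in the same direction. If the edge is at `x`, one of the
directions is `x` itself, which is never a centre, so the disjunction is still right. -/
theorem pointsToEdge_iff {x : D.Node} {c : D.tree.neighborSet (Sum.inr x)} {u v : L ⊕ D.Node}
    (huv : D.tree.Adj u v) : D.PointsToEdge x c s(u, v) ↔
      D.dir (Sum.inr x) u = c ∨ D.dir (Sum.inr x) v = c := by
  classical
  constructor
  · rintro ⟨y, p, hp, he, hc⟩
    have key : ∀ w ∈ p.support, w ≠ Sum.inr x → D.dir (Sum.inr x) w = c := by
      intro w hw hwx
      rw [← hc, ← Walk.snd_takeUntil hwx p hw]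
      exact D.isTree.dir_eq_snd (hp.takeUntil hw)
    by_cases hu : u = Sum.inr x
    · exact .inr (key v (p.snd_mem_support_of_mem_edges he) (hu ▸ huv.ne'))
    · exact .inl (key u (p.fst_mem_support_of_mem_edges he) hu)
  · have key : ∀ {u v : L ⊕ D.Node}, D.tree.Adj u v → D.dir (Sum.inr x) v = c →
        D.PointsToEdge x c s(u, v) := by
      intro u v huv hv
      obtain ⟨q, hq⟩ := D.isTree.exists_path (Sum.inr x) u
      by_cases hvq : v ∈ q.support
      · obtain ⟨p, hp⟩ := D.isTree.exists_path (Sum.inr x) v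
        have hup := D.isTree.isAcyclic.ne_mem_support_of_support_of_adj_of_isPath hq hp huv hvq
        have hxu : Sum.inr x ≠ u := fun h ↦ hup (h ▸ p.start_mem_support)
        have hxv : Sum.inr x ≠ v := by
          rintro rfl
          rw [dir_self] at hv
          exact D.tree.ne_of_adj c.2 hv
        refine ⟨u, p.concat huv.symm, hp.concat hup _, ?_, ?_⟩
        · rw [Walk.edges_concat, Sym2.eq_swap]; simp
        · rw [← hv, ← dir_eq_of_adj huv hxu hxv]
          exact (D.isTree.dir_eq_snd (hp.concat hup _)).symm
      · refine ⟨v, q.concat huv, hq.concat hvq _, by simp [Walk.edges_concat], ?_⟩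
        rw [← hv]
        exact (D.isTree.dir_eq_snd (hq.concat hvq _)).symm
    rintro (h | h)
    · rw [Sym2.eq_swap]
      exact key huv.symm h
    · exact key huv h

theorem starsPointToEdge_iff : D.StarsPointToEdge ↔ ∃ u v, D.tree.Adj u v ∧
    ∀ x c, D.StarAt x c → D.dir (Sum.inr x) u = c ∨ D.dir (Sum.inr x) v = c := by
  constructor
  · rintro ⟨e, he, h⟩
    induction e using Sym2.ind with
    | _ u v =>
      refine ⟨u, v, he, fun x c hc ↦ ?_⟩
      exact (pointsToEdge_iff (c := ⟨c, hc.1⟩) he).1 (h x ⟨c, hc.1⟩ (isStarWithCentre_iff.2 hc))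
  · rintro ⟨u, v, huv, h⟩
    exact ⟨s(u, v), huv, fun x c hc ↦ (pointsToEdge_iff huv).2 (h x c (isStarWithCentre_iff.1 hc))⟩

/-- For two stars turned away from each other, the part of the tree behind one centre is disjoint
from the part behind the other, with `x` and `y` in between, and no edge meets both. -/
theorem StarsPointToEdge.not_awayPair (h : D.StarsPointToEdge) {x y : D.Node} {c c' : L ⊕ D.Node} :
    ¬D.AwayPair x c y c' := by
  obtain ⟨u, v, huv, h⟩ := starsPointToEdge_iff.1 h
  have key : ∀ {u v : L ⊕ D.Node}, D.tree.Adj u v →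
      (∀ x c, D.StarAt x c → D.dir (Sum.inr x) u = c ∨ D.dir (Sum.inr x) v = c) →
      ∀ {x y : D.Node} {c c' : L ⊕ D.Node}, D.AwayPair x c y c' → D.dir (Sum.inr x) u ≠ c := by
    rintro u v huv h x y c c' ⟨hx, hy, hxy, h1, h2⟩ hu
    have e1 : D.dir (Sum.inr y) u = D.dir (Sum.inr y) (Sum.inr x) :=
      dir_eq_dir (inr_ne hxy.symm) (by rw [hu]; exact h1.symm)
    have e2 : D.dir (Sum.inr y) v = c' := (h y c' hy).resolve_left (by rw [e1]; exact h2)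
    have e3 : D.dir (Sum.inr x) v = D.dir (Sum.inr x) (Sum.inr y) :=
      dir_eq_dir (inr_ne hxy) (by rw [e2]; exact h2.symm)
    have hxu : Sum.inr x ≠ u := by
      rintro rfl
      rw [dir_self] at hu
      exact hx.adj.ne hu
    have hxv : Sum.inr x ≠ v := by
      rintro rfl
      exact h2 e2
    exact h1 (by rw [← e3, ← dir_eq_of_adj huv hxu hxv, hu])
  intro hp
  rcases h x c hp.1 with e | e
  · exact key huv h hp e
  · exact key huv.symm (fun x c hc ↦ (h x c hc).symm) hp e

/-- Take the star `x` with the fewest tree vertices behind its centre, and the edge to that centre.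
A star `y` not pointing to this edge does not point to `x`, so `x` points to `y`; then what is
behind the centre of `y` is strictly contained in what is behind the centre of `x`. -/
theorem IsCliqueStarTree.starsPointToEdge [Finite L] (h : D.IsCliqueStarTree)
    (hn : ∀ x c y c', ¬D.AwayPair x c y c') {u v : L ⊕ D.Node} (huv : D.tree.Adj u v) :
    D.StarsPointToEdge := by
  have := D.finite_node
  rw [starsPointToEdge_iff]
  by_cases hs : ∃ p : D.Node × (L ⊕ D.Node), D.StarAt p.1 p.2
  · obtain ⟨⟨x, c⟩, hx, hmin⟩ := Set.exists_min_image {p : D.Node × (L ⊕ D.Node) | D.StarAt p.1 p.2}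
      (fun p ↦ {z | D.dir (Sum.inr p.1) z = p.2}.ncard) (Set.toFinite _) hs
    refine ⟨Sum.inr x, c, hx.1, fun y c' hy ↦ ?_⟩
    by_cases hyx : y = x
    · subst hyx
      rw [h.centre_unique hy hx]
      exact .inr (dir_of_adj hx.1)
    by_contra hcon
    rw [not_or] at hcon
    have e : D.dir (Sum.inr x) (Sum.inr y) = c := by
      by_contra hh
      exact hn y c' x c ⟨hy, hx, hyx, hcon.1, hh⟩
    refine (hmin (y, c') hy).not_gt (Set.ncard_lt_ncard ?_ (Set.toFinite _))
    refine Set.ssubset_iff_of_subset (fun z hz ↦ ?_) |>.2 ⟨Sum.inr y, e, fun h ↦ ?_⟩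
    · have hz : D.dir (Sum.inr y) z = c' := hz
      change D.dir (Sum.inr x) z = c
      rw [← e]
      exact dir_eq_dir (inr_ne (Ne.symm hyx)) (by rw [hz]; exact fun h ↦ hcon.1 h.symm)
    · have h : D.dir (Sum.inr y) (Sum.inr y) = c' := h
      rw [dir_self] at h
      exact hy.adj.ne h
  · exact ⟨u, v, huv, fun x c hc ↦ (hs ⟨(x, c), hc⟩).elim⟩

/-- Every star off the path from `s` to `t` points to it. -/
def PointTo (D : GraphLabelledTree L) (s t : L ⊕ D.Node) : Prop :=
  ∀ x c, D.StarAt x c → Sum.inr x ≠ s → Sum.inr x ≠ t →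
    D.dir (Sum.inr x) s = D.dir (Sum.inr x) t → D.dir (Sum.inr x) s = c

theorem PointTo.symm {s t : L ⊕ D.Node} (h : D.PointTo s t) : D.PointTo t s :=
  fun x c hx ht hs e ↦ e ▸ h x c hx hs ht e.symm

/-- The condition survives prolonging the path: beyond a node `n` it is continued to a leaf in a
direction other than that of `t`. -/
theorem PointTo.exists_leaf [Finite L] {s t : L ⊕ D.Node} (h : D.PointTo s t) :
    ∃ a : L, D.PointTo (Sum.inl a) t := by
  rcases s with a | n
  · exact ⟨a, h⟩
  obtain ⟨w, hw, hwt⟩ := exists_adj_ne n (D.dir (Sum.inr n) t)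
  obtain ⟨a, ha⟩ := GraphLabelledTree.exists_leaf hw
  refine ⟨a, fun x c hx _ hxt e ↦ ?_⟩
  have hxn : (Sum.inr x : L ⊕ D.Node) ≠ Sum.inr n := by
    rintro e'
    rw [e', ha] at e
    exact hwt e
  have e' : D.dir (Sum.inr x) (Sum.inr n) = D.dir (Sum.inr x) (Sum.inl a) :=
    (dir_between hxn (by rw [ha]; exact hwt)).elim id fun h ↦ h.trans e.symm
  rw [← e']
  exact h x c hx hxn hxt (e'.trans e)

theorem starsPointToPath_iff [Finite L] : D.StarsPointToPath ↔
    ∃ a b : L, D.PointTo (Sum.inl a) (Sum.inl b) := by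
  classical
  constructor
  · rintro ⟨s, t, q, hq, h⟩
    have hst : D.PointTo s t := by
      intro x c hx hs ht e
      have hxq : Sum.inr x ∉ q.support := by
        rw [D.isTree.mem_support_iff hq]
        rintro (h | h | h)
        exacts [hs h, ht h, h e]
      obtain ⟨y, hy, p, hp, hc⟩ := h x ⟨c, hx.1⟩ (isStarWithCentre_iff.2 hx) hxq
      change p.snd = c at hc
      rw [← hc, ← D.isTree.dir_eq_snd hp]
      exact D.isTree.dir_eq_of_walk (q.takeUntil y hy)
        fun h ↦ hxq (q.support_takeUntil_subset_support hy h)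
    obtain ⟨a, ha⟩ := hst.exists_leaf
    obtain ⟨b, hb⟩ := ha.symm.exists_leaf
    exact ⟨a, b, hb.symm⟩
  · rintro ⟨a, b, h⟩
    obtain ⟨q, hq⟩ := D.isTree.exists_path (Sum.inl a) (Sum.inl b)
    refine ⟨_, _, q, hq, fun x c hx hxq ↦ ?_⟩
    obtain ⟨p, hp⟩ := D.isTree.exists_path (Sum.inr x) (Sum.inl a)
    refine ⟨_, q.start_mem_support, p, hp, ?_⟩
    rw [← D.isTree.dir_eq_snd hp]
    exact h x c (isStarWithCentre_iff.1 hx) (by simp) (by simp) (D.isTree.dir_eq_of_walk q hxq)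

end GraphLabelledTree

/-! ### Tripods and asteroids -/

namespace GraphLabelledTree

open SimpleGraph

variable {L : Type u} {D : GraphLabelledTree L}

/-- Three vertices of the tree, none of which lies between the other two, have a median node. -/
theorem exists_median [Finite L] {p q r : L ⊕ D.Node} (hpq : p ≠ q) (hqr : q ≠ r)
    (hp : D.dir p q = D.dir p r) (hq : D.dir q p = D.dir q r) (hr : D.dir r p = D.dir r q) :
    ∃ m : D.Node, D.dir (Sum.inr m) p ≠ D.dir (Sum.inr m) q ∧
      D.dir (Sum.inr m) p ≠ D.dir (Sum.inr m) r ∧ D.dir (Sum.inr m) q ≠ D.dir (Sum.inr m) r ∧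
      D.dir p (Sum.inr m) = D.dir p q := by
  have := D.finite_node
  -- The vertex `p` moves towards `q` and `r` until their directions part. This does not happen at a
  -- leaf, which has only one neighbour.
  induction hk : {z | D.dir p z = D.dir p q}.ncard using Nat.strong_induction_on generalizing p with
  | _ k ih =>
    have hadj := adj_dir hpq
    obtain ⟨p', hp'⟩ : ∃ p', D.dir p q = p' := ⟨_, rfl⟩
    rw [hp'] at hadj hk
    have hp'' : D.dir p r = p' := hp ▸ hp'
    have hp'q : p' ≠ q := by
      rintro rfl
      have := D.isTree.dir_dir (x := p) (u := r) (by change D.dir p r ≠ r; rw [hp'']; exact hqr)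
      change D.dir (D.dir p r) r ≠ p at this
      rw [hp'', ← hq] at this
      exact this (dir_of_adj hadj.symm)
    have hp'r : p' ≠ r := by
      rintro rfl
      have := D.isTree.dir_dir (x := p) (u := q) (by change D.dir p q ≠ q; rw [hp']; exact hqr.symm)
      change D.dir (D.dir p q) q ≠ p at this
      rw [hp', ← hr] at this
      exact this (dir_of_adj hadj.symm)
    have hne : D.dir p' q ≠ p := by
      have := D.isTree.dir_dir (x := p) (u := q) (by change D.dir p q ≠ q; rwa [hp'])
      change D.dir (D.dir p q) q ≠ p at this
      rwa [hp'] at this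
    have hne' : D.dir p' r ≠ p := by
      have := D.isTree.dir_dir (x := p) (u := r) (by change D.dir p r ≠ r; rwa [hp''])
      change D.dir (D.dir p r) r ≠ p at this
      rwa [hp''] at this
    have hpp' : D.dir p' p = p := dir_of_adj hadj.symm
    by_cases hd : D.dir p' q = D.dir p' r
    · have hpr : p ≠ r := by
        rintro rfl
        rw [dir_self] at hp''
        exact hadj.ne hp''
      have e1 : D.dir q p' = D.dir q p := (dir_eq_of_adj hadj hpq.symm hp'q.symm).symm
      have e2 : D.dir r p' = D.dir r p := (dir_eq_of_adj hadj hpr.symm hp'r.symm).symm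
      have hsub : ∀ z, D.dir p' z = D.dir p' q → D.dir p z = p' := by
        intro z hz
        rw [dir_eq_dir hadj.ne (by rw [hz, hpp']; exact hne), dir_of_adj hadj]
      have hss : {z | D.dir p' z = D.dir p' q} ⊂ {z | D.dir p z = p'} := by
        refine Set.ssubset_iff_of_subset hsub |>.2 ⟨p', dir_of_adj hadj, fun h ↦ ?_⟩
        have h : D.dir p' p' = D.dir p' q := h
        rw [dir_self] at h
        exact dir_ne hp'q h.symm
      obtain ⟨m, h1, h2, h3, h4⟩ := ih _ (hk ▸ Set.ncard_lt_ncard hss (Set.toFinite _)) hp'q hd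
        (e1.trans hq) (e2.trans hr) rfl
      have hmp' : Sum.inr m ≠ p' := by
        rintro e
        rw [e, dir_self] at h4
        exact dir_ne hp'q h4.symm
      have h5 := hsub _ h4
      have hmp : Sum.inr m ≠ p := by
        rintro e
        rw [e, dir_self] at h5
        exact hadj.ne h5
      rw [← dir_eq_of_adj hadj hmp hmp'] at h1 h2
      exact ⟨m, h1, h2, h3, h5.trans hp'.symm⟩
    · rcases p' with l | m
      · exact (hd (inl_adj_unique (adj_dir hp'q) (adj_dir hp'r))).elim
      · refine ⟨m, ?_, ?_, hd, ?_⟩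
        · rw [hpp']; exact hne.symm
        · rw [hpp']; exact hne'.symm
        · rw [hp', dir_of_adj hadj]

variable (D) in
/-- The node `m` lies between three stars `n i` with centres `z i` that do not point to `m`, and
that are accessible from `m`. -/
structure IsTripod (m : D.Node) (n : Fin 3 → D.Node) (z : Fin 3 → L ⊕ D.Node) : Prop where
  star : ∀ i, D.StarAt (n i) (z i)
  ne : ∀ i, m ≠ n i
  away : ∀ i, D.dir (Sum.inr (n i)) (Sum.inr m) ≠ z i
  isOpen : ∀ i, D.Open (Sum.inr m) (Sum.inr (n i))
  inj : ∀ i j, D.dir (Sum.inr m) (Sum.inr (n i)) = D.dir (Sum.inr m) (Sum.inr (n j)) → i = j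

theorem IsTripod.comp {m : D.Node} {n : Fin 3 → D.Node} {z : Fin 3 → L ⊕ D.Node}
    (h : D.IsTripod m n z) (e : Equiv.Perm (Fin 3)) : D.IsTripod m (n ∘ e) (z ∘ e) :=
  ⟨fun _ ↦ h.star _, fun _ ↦ h.ne _, fun _ ↦ h.away _, fun _ ↦ h.isOpen _,
    fun _ _ he ↦ e.injective (h.inj _ _ he)⟩

namespace IsCliqueStarTree

variable (h : D.IsCliqueStarTree)
include h

/-- Each `a i` is a leaf behind the centre of `n i`, and `b i` one behind a marker that is neither
the centre nor the one towards `m`. So `b i` sees `a i` but nothing on the side of `m`. -/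
theorem exists_spikes [Finite L] {m : D.Node} {n : Fin 3 → D.Node} {z : Fin 3 → L ⊕ D.Node}
    (ht : D.IsTripod m n z) : ∃ a b : Fin 3 → L, D.accessibilityGraph.HasSpikes a b ∧
      (∀ i, D.dir (Sum.inr m) (Sum.inl (a i)) = D.dir (Sum.inr m) (Sum.inr (n i))) ∧
      (∀ i, D.Open (Sum.inr m) (Sum.inl (a i))) ∧
      ∀ i u, D.dir (Sum.inr (n i)) (Sum.inl u) = D.dir (Sum.inr (n i)) (Sum.inr m) →
        ¬D.accessibilityGraph.Adj u (b i) := by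
  have hmn : ∀ i, (Sum.inr m : L ⊕ D.Node) ≠ Sum.inr (n i) := fun i ↦ inr_ne (ht.ne i)
  have hex := fun i ↦ h.exists_third (n i) (z i) (D.dir (Sum.inr (n i)) (Sum.inr m))
  choose w hw hwz hwm using hex
  choose a ha ha' using fun i ↦ exists_open_leaf h.connected (ht.star i).adj
  choose b hb hb' using fun i ↦ exists_open_leaf h.connected (hw i)
  have ma : ∀ i, D.dir (Sum.inr m) (Sum.inl (a i)) = D.dir (Sum.inr m) (Sum.inr (n i)) := fun i ↦
    dir_eq_dir (hmn i) (by rw [ha]; exact (ht.away i).symm)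
  have mb : ∀ i, D.dir (Sum.inr m) (Sum.inl (b i)) = D.dir (Sum.inr m) (Sum.inr (n i)) := fun i ↦
    dir_eq_dir (hmn i) (by rw [hb]; exact hwm i)
  have hout : ∀ i u, D.dir (Sum.inr (n i)) (Sum.inl u) = D.dir (Sum.inr (n i)) (Sum.inr m) →
      ¬D.accessibilityGraph.Adj u (b i) := by
    intro i u hu hadj
    have := lab_of_adj hadj (x := n i) (by rw [hu, hb]; exact (hwm i).symm)
    rw [(ht.star i).lab_dir_iff (by simp) (by simp), hu, hb] at this
    exact this.2.elim (ht.away i) (hwz i)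
  have hout' : ∀ i u, D.dir (Sum.inr m) (Sum.inl u) ≠ D.dir (Sum.inr m) (Sum.inr (n i)) →
      ¬D.accessibilityGraph.Adj u (b i) :=
    fun i u hu ↦ hout i u (dir_eq_dir (hmn i).symm hu)
  refine ⟨a, b, ⟨fun i j ↦ ?_, fun i j ↦ ?_⟩, ma, fun i ↦ ?_, hout⟩
  · by_cases hij : i = j
    · subst hij
      refine iff_of_true ?_ rfl
      rw [adj_iff_lab (ha' i) (hb' i) (by rw [ha, hb]; exact (hwz i).symm),
        (ht.star i).lab_dir_iff (by simp) (by simp), ha, hb]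
      exact ⟨(hwz i).symm, .inl rfl⟩
    · refine iff_of_false (hout' j _ ?_) hij
      rw [ma]
      exact fun e ↦ hij (ht.inj _ _ e)
  · by_cases hij : i = j
    · subst hij; simp
    · refine hout' j _ ?_
      rw [mb]
      exact fun e ↦ hij (ht.inj _ _ e)
  · rw [open_iff (hmn i).symm (by simp) (by rw [ha]; exact ht.away i)]
    refine ⟨ht.isOpen i, ha' i, ?_⟩
    rw [(ht.star i).lab_dir_iff (hmn i).symm (by simp), ha]
    exact ⟨ht.away i, .inr rfl⟩

/-- As the tree is reduced, the neighbour `p` of `m` at its centre is not `n i`, whose centre is not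
at `m`. If `p` is a star, its centre is at `m` by the same rule; so in either case a third marker of
`p` leads to a leaf accessible from `m` that branches off before `n i`. -/
theorem exists_outer_leaf [Finite L] {m : D.Node} {n : Fin 3 → D.Node} {z : Fin 3 → L ⊕ D.Node}
    (ht : D.IsTripod m n z) {i : Fin 3} (hm : D.StarAt m (D.dir (Sum.inr m) (Sum.inr (n i)))) :
    ∃ l : L, D.Open (Sum.inr m) (Sum.inl l) ∧
      D.dir (Sum.inr m) (Sum.inl l) = D.dir (Sum.inr m) (Sum.inr (n i)) ∧
      D.dir (Sum.inr (n i)) (Sum.inl l) = D.dir (Sum.inr (n i)) (Sum.inr m) := by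
  have hmn : (Sum.inr m : L ⊕ D.Node) ≠ Sum.inr (n i) := inr_ne (ht.ne i)
  have hadj := adj_dir hmn
  obtain ⟨p, hp⟩ : ∃ p, D.dir (Sum.inr m) (Sum.inr (n i)) = p := ⟨_, rfl⟩
  rw [hp] at hadj hm ⊢
  have hpn : p ≠ Sum.inr (n i) := by
    rintro rfl
    have := h.star_reduced m (n i) _ _ hm (ht.star i) rfl
    refine ht.away i ?_
    rw [this, dir_of_adj hadj.symm]
  have hd := D.isTree.dir_dir (x := Sum.inr m) (u := Sum.inr (n i))
    (by change D.dir _ _ ≠ _; rwa [hp])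
  change D.dir (D.dir _ _) _ ≠ _ at hd
  rw [hp] at hd
  have hpm := dir_of_adj hadj.symm
  rcases p with l | p
  · exact (hd (inl_adj_unique (adj_dir hpn) hadj.symm)).elim
  obtain ⟨w, hw, hwm, hwn⟩ := h.exists_third p (Sum.inr m) (D.dir (Sum.inr p) (Sum.inr (n i)))
  obtain ⟨l, hl, hl'⟩ := exists_open_leaf h.connected hw
  refine ⟨l, ?_, ?_, ?_⟩
  · rw [open_iff hadj.ne' (by simp) (by rw [hpm, hl]; exact hwm.symm)]
    refine ⟨((open_iff hadj.ne' hpn (by rw [hpm]; exact hd.symm)).1 (ht.isOpen i)).1, hl', ?_⟩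
    rcases h.type p with hc | ⟨c, hc⟩
    · rw [hc, hpm, hl]
      exact ⟨hadj.symm, hw, hwm.symm⟩
    · rw [hc.lab_dir_iff hadj.ne' (by simp), hpm, hl]
      exact ⟨hwm.symm, .inl (h.star_reduced m p _ _ hm hc rfl).symm⟩
  · rw [← dir_of_adj hadj]
    exact dir_eq_dir hadj.ne (by rw [hl, hpm]; exact hwm)
  · have e1 : D.dir (Sum.inr (n i)) (Sum.inl l) = D.dir (Sum.inr (n i)) (Sum.inr p) :=
      dir_eq_dir hpn.symm (by rw [hl]; exact hwn)
    have e2 : D.dir (Sum.inr (n i)) (Sum.inr m) = D.dir (Sum.inr (n i)) (Sum.inr p) :=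
      dir_eq_dir hpn.symm (by rw [hpm]; exact hd.symm)
    rw [e1, e2]

/-- If `m` is a clique, the spikes form a net. If it is a star with centre towards none of them, a
leaf `l` behind the centre gives the spider. If the centre is towards one of them, the outer leaf
serves as `l` and gives a four-cycle, with or without the chord from `l`. -/
theorem hasAsteroid_of_isTripod [Finite L] {m : D.Node} {n : Fin 3 → D.Node}
    {z : Fin 3 → L ⊕ D.Node} (ht : D.IsTripod m n z) : D.accessibilityGraph.HasAsteroid := by
  have hne : ∀ {i j : Fin 3}, i ≠ j →
      D.dir (Sum.inr m) (Sum.inr (n i)) ≠ D.dir (Sum.inr m) (Sum.inr (n j)) :=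
    fun hij e ↦ hij (ht.inj _ _ e)
  rcases h.type m with hm | ⟨c, hm⟩
  · obtain ⟨a, b, hab, ha, ha', -⟩ := h.exists_spikes ht
    have hadj : ∀ {i j}, i ≠ j → D.accessibilityGraph.Adj (a i) (a j) := by
      intro i j hij
      rw [adj_iff_lab (ha' i) (ha' j) (by rw [ha, ha]; exact hne hij), hm]
      exact ⟨adj_dir (by simp), adj_dir (by simp), by rw [ha, ha]; exact hne hij⟩
    exact ⟨a, b, hab, .inl ⟨hadj (by decide), hadj (by decide), hadj (by decide)⟩⟩
  by_cases hc : ∃ i, D.dir (Sum.inr m) (Sum.inr (n i)) = c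
  · wlog hc2 : D.dir (Sum.inr m) (Sum.inr (n 2)) = c generalizing n z
    · obtain ⟨i, hi⟩ := hc
      have hcc : D.dir (Sum.inr m) (Sum.inr ((n ∘ Equiv.swap 2 i) 2)) = c := by simpa using hi
      refine this (ht.comp (Equiv.swap 2 i)) (fun hij e ↦ hij ?_) ⟨2, hcc⟩ hcc
      exact (ht.comp (Equiv.swap 2 i)).inj _ _ e
    subst hc2
    obtain ⟨a, b, hab, ha, ha', hb⟩ := h.exists_spikes ht
    obtain ⟨l, hl, hl', hl''⟩ := h.exists_outer_leaf ht hm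
    have h0 : (0 : Fin 3) ≠ 2 := by decide
    have h1 : (1 : Fin 3) ≠ 2 := by decide
    have hla : ∀ i, i ≠ 2 → D.accessibilityGraph.Adj l (a i) := by
      intro i hi
      rw [adj_iff_lab hl (ha' i) (by rw [hl', ha]; exact hne hi.symm),
        hm.lab_dir_iff (by simp) (by simp), hl', ha]
      exact ⟨hne hi.symm, .inl rfl⟩
    have haa : ∀ i, i ≠ 2 → D.accessibilityGraph.Adj (a i) (a 2) := by
      intro i hi
      rw [adj_iff_lab (ha' i) (ha' 2) (by rw [ha, ha]; exact hne hi),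
        hm.lab_dir_iff (by simp) (by simp), ha, ha]
      exact ⟨hne hi, .inr rfl⟩
    refine ⟨a, b, hab, .inr ⟨l, fun i ↦ ?_, hla 0 h0, hla 1 h1, fun hadj ↦ ?_,
      .inl ⟨haa 0 h0, haa 1 h1⟩⟩⟩
    · by_cases hi : i = 2
      · subst hi
        exact hb _ _ hl''
      · exact hb _ _ (dir_eq_dir (inr_ne (ht.ne i).symm) (by rw [hl']; exact hne (Ne.symm hi)))
    · have := lab_of_adj hadj (x := m) (by rw [ha, ha]; exact hne (by decide))
      rw [hm.lab_dir_iff (by simp) (by simp), ha, ha] at this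
      exact this.2.elim (hne h0) (hne h1)
  · push Not at hc
    obtain ⟨a, b, hab, ha, ha', hb⟩ := h.exists_spikes ht
    obtain ⟨l, hl, hl'⟩ := exists_open_leaf h.connected hm.adj
    have hla : ∀ i, D.accessibilityGraph.Adj l (a i) := by
      intro i
      rw [adj_iff_lab hl' (ha' i) (by rw [hl, ha]; exact (hc i).symm),
        hm.lab_dir_iff (by simp) (by simp), hl, ha]
      exact ⟨(hc i).symm, .inl rfl⟩
    have haa : ∀ {i j}, i ≠ j → ¬D.accessibilityGraph.Adj (a i) (a j) := by
      intro i j hij hadj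
      have := lab_of_adj hadj (x := m) (by rw [ha, ha]; exact hne hij)
      rw [hm.lab_dir_iff (by simp) (by simp), ha, ha] at this
      exact this.2.elim (hc _) (hc _)
    refine ⟨a, b, hab, .inr ⟨l, fun i ↦ ?_, hla 0, hla 1, haa (by decide),
      .inr ⟨hla 2, haa (by decide), haa (by decide)⟩⟩⟩
    exact hb _ _ (dir_eq_dir (inr_ne (ht.ne i).symm) (by rw [hl]; exact (hc i).symm))

/-- The node `m` is the median of the three stars; each star is then exchanged for one in the same
direction from `m` that is accessible from it. -/
theorem exists_isTripod [Finite L] {y : Fin 3 → D.Node} {c : Fin 3 → L ⊕ D.Node}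
    (hy : ∀ i, D.StarAt (y i) (c i)) (hne : ∀ i j, i ≠ j → y i ≠ y j)
    (hc : ∀ i j, i ≠ j → D.dir (Sum.inr (y i)) (Sum.inr (y j)) ≠ c i)
    (hd : ∀ i j k, i ≠ j → i ≠ k →
      D.dir (Sum.inr (y i)) (Sum.inr (y j)) = D.dir (Sum.inr (y i)) (Sum.inr (y k))) :
    ∃ m n z, D.IsTripod m n z := by
  obtain ⟨m, h1, h2, h3, -⟩ := exists_median (p := Sum.inr (y 0)) (q := Sum.inr (y 1))
    (r := Sum.inr (y 2)) (inr_ne (hne _ _ (by decide))) (inr_ne (hne _ _ (by decide)))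
    (hd _ _ _ (by decide) (by decide)) (hd _ _ _ (by decide) (by decide))
    (hd _ _ _ (by decide) (by decide))
  have hinj : ∀ i j, i ≠ j →
      D.dir (Sum.inr m) (Sum.inr (y i)) ≠ D.dir (Sum.inr m) (Sum.inr (y j)) := by
    intro i j hij
    fin_cases i <;> fin_cases j <;> first | exact (hij rfl).elim | assumption | (symm; assumption)
  have hex : ∀ i : Fin 3, ∃ j k, i ≠ j ∧ i ≠ k ∧ j ≠ k := by decide
  have hmy : ∀ i, m ≠ y i := by
    rintro i rfl
    obtain ⟨j, k, hij, hik, hjk⟩ := hex i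
    exact hinj j k hjk (hd _ _ _ hij hik)
  have hdm : ∀ i, D.dir (Sum.inr (y i)) (Sum.inr m) ≠ c i := by
    intro i
    obtain ⟨j, k, hij, hik, hjk⟩ := hex i
    rw [← dir_eq_dir (inr_ne (hmy i).symm) (hinj j i hij.symm)]
    exact hc _ _ hij
  choose n z hn1 hn2 hn3 hn4 hn5 using
    fun i ↦ h.exists_open_star (hy i) (inr_ne (hmy i)) (hdm i)
  refine ⟨m, n, z, hn1, fun i e ↦ hn2 i (congrArg Sum.inr e), hn3, hn4, fun i j e ↦ ?_⟩
  rw [hn5, hn5] at e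
  by_contra hij
  exact hinj i j hij e

/-- Prolong a longest away pair `x`, `y` to leaves behind the two centres. Some star `z` off this
path does not point to it, and by maximality it branches off strictly between `x` and `y`; so the
three stars are pairwise turned away and form a tripod. If there is no away pair, all stars point to
an edge, and a path between leaves through that edge contradicts the hypothesis. -/
theorem hasAsteroid_of_not_starsPointToPath [Finite L] (hp : ¬D.StarsPointToPath) :
    D.accessibilityGraph.HasAsteroid := by
  have := D.finite_node
  rw [starsPointToPath_iff] at hp
  by_cases haw : ∃ p : (D.Node × (L ⊕ D.Node)) × D.Node × (L ⊕ D.Node),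
      D.AwayPair p.1.1 p.1.2 p.2.1 p.2.2
  · obtain ⟨⟨⟨x, c⟩, y, c'⟩, hxy, hmax⟩ := Set.exists_max_image
      {p : (D.Node × (L ⊕ D.Node)) × D.Node × (L ⊕ D.Node) | D.AwayPair p.1.1 p.1.2 p.2.1 p.2.2}
      -- For different nodes this set consists of the vertices of the path between them, ends
      -- included.
      (fun p ↦ {m | D.dir m (Sum.inr p.1.1) ≠ D.dir m (Sum.inr p.2.1)}.ncard) (Set.toFinite _) haw
    simp only [Set.mem_ofPred_eq] at hxy hmax
    obtain ⟨hx, hy, hne, h1, h2⟩ := hxy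
    -- a third star beyond `x` would give a longer pair
    have key : ∀ {x y : D.Node} {c' : L ⊕ D.Node}, x ≠ y → (∀ n d n' d', D.AwayPair n d n' d' →
        {m | D.dir m (Sum.inr n) ≠ D.dir m (Sum.inr n')}.ncard ≤
          {m | D.dir m (Sum.inr x) ≠ D.dir m (Sum.inr y)}.ncard) →
        D.StarAt y c' → D.dir (Sum.inr y) (Sum.inr x) ≠ c' → ∀ {z : D.Node} {d : L ⊕ D.Node},
        D.StarAt z d → z ≠ x → z ≠ y → D.dir (Sum.inr z) (Sum.inr y) ≠ d →
        D.dir (Sum.inr z) (Sum.inr x) = D.dir (Sum.inr z) (Sum.inr y) →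
        D.dir (Sum.inr x) (Sum.inr z) = D.dir (Sum.inr x) (Sum.inr y) := by
      intro x y c' hne hmax hy h2 z d hz hzx hzy hzd he
      by_contra hcon
      have e : D.dir (Sum.inr y) (Sum.inr z) = D.dir (Sum.inr y) (Sum.inr x) :=
        dir_eq_dir (inr_ne hne.symm) hcon
      refine (hmax z d y c' ⟨hz, hy, hzy, hzd, by rw [e]; exact h2⟩).not_gt
        (Set.ncard_lt_ncard ?_ (Set.toFinite _))
      refine Set.ssubset_iff_of_subset (fun m hm ↦ ?_) |>.2
        ⟨Sum.inr z, by
          change D.dir (Sum.inr z) (Sum.inr z) ≠ _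
          rw [dir_self]; exact (dir_ne (inr_ne hzy)).symm, fun h ↦ h he⟩
      change D.dir m (Sum.inr z) ≠ D.dir m (Sum.inr y)
      have hm : D.dir m (Sum.inr x) ≠ D.dir m (Sum.inr y) := hm
      by_cases hmx : m = Sum.inr x
      · subst hmx; exact hcon
      · rcases dir_between hmx hcon with e' | e'
        · rwa [← e']
        · exact (hm e').elim
    obtain ⟨a, ha⟩ := exists_leaf hx.adj
    obtain ⟨b, hb⟩ := exists_leaf hy.adj
    have hxb : D.dir (Sum.inr x) (Sum.inl b) = D.dir (Sum.inr x) (Sum.inr y) :=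
      dir_eq_dir (inr_ne hne) (by rw [hb]; exact h2.symm)
    have hya : D.dir (Sum.inr y) (Sum.inl a) = D.dir (Sum.inr y) (Sum.inr x) :=
      dir_eq_dir (inr_ne hne.symm) (by rw [ha]; exact h1.symm)
    have hab := not_exists.1 (not_exists.1 hp a) b
    simp only [PointTo, not_forall] at hab
    obtain ⟨z, d, hz, -, -, he, hd⟩ := hab
    have hzx : z ≠ x := by
      rintro rfl
      rw [ha, hxb] at he
      exact h1 he.symm
    have hzy : z ≠ y := by
      rintro rfl
      rw [hb, hya] at he
      exact h2 he
    have ex : D.dir (Sum.inr z) (Sum.inr x) = D.dir (Sum.inr z) (Sum.inl a) :=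
      (dir_between (inr_ne hzx) (s := Sum.inl a) (t := Sum.inl b)
        (by rw [ha, hxb]; exact h1.symm)).elim id fun h ↦ h.trans he.symm
    have ey : D.dir (Sum.inr z) (Sum.inr y) = D.dir (Sum.inr z) (Sum.inl a) :=
      (dir_between (inr_ne hzy) (s := Sum.inl a) (t := Sum.inl b)
        (by rw [hb, hya]; exact h2)).elim id fun h ↦ h.trans he.symm
    have kx := key hne (fun n d n' d' ↦ hmax ((n, d), n', d')) hy h2 hz hzx hzy
      (by rwa [ey]) (ex.trans ey.symm)
    have hmax' : ∀ n d n' d', D.AwayPair n d n' d' →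
        {m | D.dir m (Sum.inr n) ≠ D.dir m (Sum.inr n')}.ncard ≤
          {m | D.dir m (Sum.inr y) ≠ D.dir m (Sum.inr x)}.ncard := by
      intro n d n' d' hn
      simp_rw [ne_comm (a := D.dir _ (Sum.inr y))]
      exact hmax ((n, d), n', d') hn
    have ky := key hne.symm hmax' hx h1 hz hzy hzx (by rwa [ex]) (ey.trans ex.symm)
    obtain ⟨m, n, z', ht⟩ := h.exists_isTripod (y := ![x, y, z]) (c := ![c, c', d])
      (by intro i; fin_cases i <;> assumption)
      (by
        intro i j hij
        fin_cases i <;> fin_cases j <;>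
          first | exact (hij rfl).elim | assumption | exact Ne.symm (by assumption))
      (by
        intro i j hij
        fin_cases i <;> fin_cases j <;>
          simp only [Fin.zero_eta, Fin.mk_one, Fin.reduceFinMk, Matrix.cons_val] <;> grind)
      (by
        intro i j k hij hik
        fin_cases i <;> fin_cases j <;> fin_cases k <;>
          simp only [Fin.zero_eta, Fin.mk_one, Fin.reduceFinMk, Matrix.cons_val] <;> grind)
    exact h.hasAsteroid_of_isTripod ht
  · exfalso
    by_cases hs : ∃ x c, D.StarAt x c
    · obtain ⟨x, c, hx⟩ := hs
      obtain ⟨u, v, huv, he⟩ := starsPointToEdge_iff.1 <| h.starsPointToEdge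
        (fun x c y c' hxy ↦ haw ⟨((x, c), y, c'), hxy⟩) hx.adj
      obtain ⟨a, ha⟩ := exists_leaf huv.symm
      obtain ⟨b, hb⟩ := exists_leaf huv
      have key : ∀ {u v : L ⊕ D.Node} {a : L}, D.tree.Adj v u → D.dir v (Sum.inl a) = u →
          D.dir u (Sum.inl a) ≠ v := by
        intro u v a hvu ha
        by_cases hua : u = Sum.inl a
        · subst hua
          rw [dir_self]
          exact hvu.ne'
        · have := D.isTree.dir_dir (x := v) (u := Sum.inl a)
            (by change D.dir v _ ≠ _; rwa [ha])
          change D.dir (D.dir v _) _ ≠ _ at this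
          rwa [ha] at this
      have ka := key huv.symm ha
      have kb := key huv hb
      refine hp ⟨a, b, fun y d hy _ _ e ↦ ?_⟩
      by_cases hyu : Sum.inr y = u
      · subst hyu
        have := he y d hy
        rw [dir_self, dir_of_adj huv] at this
        rw [e, hb]
        exact this.resolve_left hy.adj.ne
      by_cases hyv : Sum.inr y = v
      · subst hyv
        have := he y d hy
        rw [dir_self, dir_of_adj huv.symm] at this
        rw [ha]
        exact this.resolve_right hy.adj.ne
      have e1 := dir_between hyu (s := Sum.inl a) (t := Sum.inl b) (by rw [hb]; exact ka)
      have e2 := dir_between hyv (s := Sum.inl a) (t := Sum.inl b) (by rw [ha]; exact kb.symm)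
      rcases he y d hy with e3 | e3 <;> grind
    · obtain ⟨a⟩ := h.connected.nonempty
      exact hp ⟨a, a, fun x c hx ↦ (hs ⟨x, c, hx⟩).elim⟩

end IsCliqueStarTree

end GraphLabelledTree

/-! ### The leaves along a path form a thread -/

namespace GraphLabelledTree

open SimpleGraph

variable {L : Type u} {D : GraphLabelledTree L}

section Thread

variable (D) (a b : L)

/-- The node `x` lies on the path from the leaf `a` to the leaf `b`. -/
def OnPath (x : D.Node) : Prop := D.dir (Sum.inr x) (Sum.inl a) ≠ D.dir (Sum.inr x) (Sum.inl b)

/-- The leaf `u` is attached to the path at the node `x`. -/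
def HangsAt (x : D.Node) (u : L) : Prop :=
  D.dir (Sum.inr x) (Sum.inl u) ≠ D.dir (Sum.inr x) (Sum.inl a) ∧
  D.dir (Sum.inr x) (Sum.inl u) ≠ D.dir (Sum.inr x) (Sum.inl b)

open Classical in
/-- The place of the leaf `u` relative to the node `x` of the path from `a` to `b`: before `x`,
at `x` (behind a marker that is not the centre of a star, or is), or after `x`. -/
noncomputable def place (x : D.Node) (u : L) : ℕ :=
  if D.dir (Sum.inr x) (Sum.inl u) = D.dir (Sum.inr x) (Sum.inl a) then 0
  else if D.dir (Sum.inr x) (Sum.inl u) = D.dir (Sum.inr x) (Sum.inl b) then 3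
  else if D.StarAt x (D.dir (Sum.inr x) (Sum.inl u)) then 2 else 1

open Classical in
/-- The position of the leaf `u` along the path from `a` to `b`. -/
noncomputable def position (u : L) : ℕ :=
  have := D.finite_node
  have := Fintype.ofFinite D.Node
  ∑ x with D.OnPath a b x, D.place a b x u

variable {D a b}

theorem place_le_three (x : D.Node) (u : L) : D.place a b x u ≤ 3 := by
  unfold place; split_ifs <;> omega

theorem place_eq_zero_iff {x : D.Node} {u : L} : D.place a b x u = 0 ↔
    D.dir (Sum.inr x) (Sum.inl u) = D.dir (Sum.inr x) (Sum.inl a) := by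
  unfold place; split_ifs <;> simp_all

theorem place_eq_three_iff {x : D.Node} {u : L} (hx : D.OnPath a b x) : D.place a b x u = 3 ↔
    D.dir (Sum.inr x) (Sum.inl u) = D.dir (Sum.inr x) (Sum.inl b) := by
  unfold OnPath at hx
  unfold place; split_ifs <;> simp_all

theorem place_eq_two_iff {x : D.Node} {u : L} : D.place a b x u = 2 ↔
    D.HangsAt a b x u ∧ D.StarAt x (D.dir (Sum.inr x) (Sum.inl u)) := by
  unfold place HangsAt; split_ifs <;> simp_all

theorem place_eq_one_iff {x : D.Node} {u : L} : D.place a b x u = 1 ↔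
    D.HangsAt a b x u ∧ ¬D.StarAt x (D.dir (Sum.inr x) (Sum.inl u)) := by
  unfold place HangsAt; split_ifs <;> simp_all

theorem hangsAt_iff {x : D.Node} {u : L} : D.HangsAt a b x u ↔
    D.place a b x u = 1 ∨ D.place a b x u = 2 := by
  rw [place_eq_one_iff, place_eq_two_iff]; tauto

/-- The nodes of the path never disagree about the order of two leaves: from a node `y` on the side
of `a` the later leaf `v` lies towards `b`, and from one on the side of `b` the earlier leaf `u`
lies towards `a`. This is why the sum of the places is a faithful position. -/
theorem place_le_of_place_lt {x y : D.Node} {u v : L} (hx : D.OnPath a b x) (hy : D.OnPath a b y)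
    (h : D.place a b x u < D.place a b x v) : D.place a b y u ≤ D.place a b y v := by
  by_cases hxy : x = y
  · subst hxy; exact h.le
  have hv : D.dir (Sum.inr x) (Sum.inl v) ≠ D.dir (Sum.inr x) (Sum.inl a) := by
    rw [ne_eq, ← place_eq_zero_iff (b := b)]; omega
  have hu : D.dir (Sum.inr x) (Sum.inl u) ≠ D.dir (Sum.inr x) (Sum.inl b) := by
    rw [ne_eq, ← place_eq_three_iff hx]
    have := place_le_three (a := a) (b := b) x v
    omega
  unfold OnPath at hx
  rcases dir_between (inr_ne hxy) hy with e | e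
  · have h1 : D.dir (Sum.inr y) (Sum.inl v) = D.dir (Sum.inr y) (Sum.inr x) :=
      dir_eq_dir (inr_ne (Ne.symm hxy)) (by rwa [e])
    have h2 : D.dir (Sum.inr y) (Sum.inl b) = D.dir (Sum.inr y) (Sum.inr x) :=
      dir_eq_dir (inr_ne (Ne.symm hxy)) (by rw [e]; exact hx.symm)
    rw [(place_eq_three_iff hy).2 (h1.trans h2.symm)]
    exact place_le_three _ _
  · have h1 : D.dir (Sum.inr y) (Sum.inl u) = D.dir (Sum.inr y) (Sum.inr x) :=
      dir_eq_dir (inr_ne (Ne.symm hxy)) (by rwa [e])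
    have h2 : D.dir (Sum.inr y) (Sum.inl a) = D.dir (Sum.inr y) (Sum.inr x) :=
      dir_eq_dir (inr_ne (Ne.symm hxy)) (by rwa [e])
    rw [place_eq_zero_iff.2 (h1.trans h2.symm)]
    exact Nat.zero_le _

theorem position_le_of_place_le {u v : L}
    (h : ∀ x, D.OnPath a b x → D.place a b x u ≤ D.place a b x v) :
    D.position a b u ≤ D.position a b v :=
  Finset.sum_le_sum fun x hx ↦ h x (by simpa using hx)

theorem position_lt_of_place_lt {x : D.Node} {u v : L} (hx : D.OnPath a b x)
    (h : D.place a b x u < D.place a b x v) : D.position a b u < D.position a b v :=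
  Finset.sum_lt_sum (fun y hy ↦ place_le_of_place_lt hx (by simpa using hy) h)
    ⟨x, by simpa using hx, h⟩

theorem place_le_of_position_le {x : D.Node} {u v : L} (hx : D.OnPath a b x)
    (h : D.position a b u ≤ D.position a b v) : D.place a b x u ≤ D.place a b x v := by
  by_contra hlt
  exact (position_lt_of_place_lt hx (not_le.1 hlt)).not_ge h

theorem place_eq_of_position_eq {x : D.Node} {u v : L} (hx : D.OnPath a b x)
    (h : D.position a b u = D.position a b v) : D.place a b x u = D.place a b x v :=
  (place_le_of_position_le hx h.le).antisymm (place_le_of_position_le hx h.ge)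

/-- All leaves hanging at `x` look alike from the other nodes of the path, since they lie beyond
`x`. -/
theorem position_eq_of_place_eq {x : D.Node} {u v : L} (hx : D.OnPath a b x)
    (hu : D.HangsAt a b x u) (h : D.place a b x u = D.place a b x v) :
    D.position a b u = D.position a b v := by
  have hv : D.HangsAt a b x v := by
    rw [hangsAt_iff] at hu ⊢
    rwa [← h]
  have key : ∀ u v, D.HangsAt a b x u → D.HangsAt a b x v → D.place a b x u = D.place a b x v →
      ∀ y, D.OnPath a b y → D.place a b y u = D.place a b y v := by
    intro u v hu hv h y hy
    by_cases hxy : x = y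
    · subst hxy; exact h
    have side : ∀ w, D.HangsAt a b x w →
        D.dir (Sum.inr y) (Sum.inl w) = D.dir (Sum.inr y) (Sum.inr x) := fun w hw ↦
      dir_eq_dir (inr_ne (Ne.symm hxy)) (by
        rcases dir_between (inr_ne hxy) hy with e | e <;> rw [e]
        exacts [hw.1, hw.2])
    have hne := dir_between (inr_ne (Ne.symm hxy)) hx
    rcases hne with e | e
    · rw [place_eq_zero_iff.2 ((side u hu).trans e), place_eq_zero_iff.2 ((side v hv).trans e)]
    · rw [(place_eq_three_iff hy).2 ((side u hu).trans e),
        (place_eq_three_iff hy).2 ((side v hv).trans e)]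
  exact (position_le_of_place_le fun y hy ↦ (key u v hu hv h y hy).le).antisymm
    (position_le_of_place_le fun y hy ↦ (key u v hu hv h y hy).ge)

theorem exists_place_lt_of_position_lt {u v : L} (h : D.position a b u < D.position a b v) :
    ∃ x, D.OnPath a b x ∧ D.place a b x u < D.place a b x v := by
  by_contra! hc
  exact (position_le_of_place_le hc).not_gt h

end Thread

namespace IsCliqueStarTree

variable (h : D.IsCliqueStarTree) {a b : L} (hab : D.PointTo (Sum.inl a) (Sum.inl b))
include h hab

/-- An induced path gives two stars turned away from each other. Neither lies on the path from `a`
to `b`, because leaves of equal position are not separated there by the centre. So both point to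
that path, and hence one points to the other. -/
theorem isCographOn_position (i : ℕ) :
    D.accessibilityGraph.IsCographOn {v | D.position a b v = i} := by
  intro v₁ h₁ v₂ h₂ v₃ h₃ v₄ h₄ hp
  simp only [Set.mem_ofPred_eq] at h₁ h₂ h₃ h₄
  obtain ⟨x, z, y, z', ⟨hx, hy, hne, hxy, hyx⟩, e1, e2, e3, e4, k1, k2, k3, k4⟩ :=
    h.exists_awayPair_of_isPathFour hp
  have key : ∀ {x : D.Node} {z : L ⊕ D.Node}, D.StarAt x z → ∀ {u v w : L},
      D.position a b u = i → D.position a b v = i → D.position a b w = i →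
      D.dir (Sum.inr x) (Sum.inl v) = z → D.dir (Sum.inr x) (Sum.inl u) ≠ z →
      D.dir (Sum.inr x) (Sum.inl w) ≠ z →
      D.dir (Sum.inr x) (Sum.inl u) ≠ D.dir (Sum.inr x) (Sum.inl w) → ¬D.OnPath a b x := by
    intro x z hx u v w hu hv hw hvz huz hwz huw hon
    have f1 := place_eq_of_position_eq hon (hu.trans hv.symm)
    have f2 := place_eq_of_position_eq hon (hw.trans hv.symm)
    have g1 := place_eq_zero_iff (x := x) (u := v) (a := a) (b := b)
    have g2 := place_eq_zero_iff (x := x) (u := u) (a := a) (b := b)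
    have g3 := place_eq_zero_iff (x := x) (u := w) (a := a) (b := b)
    have g4 := place_eq_three_iff (u := v) hon
    have g5 := place_eq_three_iff (u := u) hon
    have g6 := place_eq_three_iff (u := w) hon
    have p1 : D.HangsAt a b x v := ⟨by grind, by grind⟩
    have p2 := place_eq_two_iff.2 ⟨p1, hvz ▸ hx⟩
    have p3 := (place_eq_two_iff.1 (f1.trans p2)).2
    exact huz (h.centre_unique p3 hx)
  have nx := key hx h₁ h₂ h₃ e1 e2 e3 e4
  have ny := key hy h₄ h₃ h₂ k1 k2 k3 k4
  simp only [OnPath, not_not] at nx ny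
  have fx := hab x z hx (by simp) (by simp) nx
  have fy := hab y z' hy (by simp) (by simp) ny
  refine hyx ?_
  rw [← fy]
  exact (dir_eq_dir (inr_ne hne.symm) (by rw [fx]; exact hxy.symm)).symm

/-- Nodes off the path do not obstruct leaves of different positions: a star there has its centre
towards the path, and if it separates `u` from `v`, one of them lies in that direction. -/
theorem adj_iff_lab_onPath {u v : L} (huv : D.position a b u < D.position a b v) :
    D.accessibilityGraph.Adj u v ↔ ∀ x, D.OnPath a b x →
      D.dir (Sum.inr x) (Sum.inl u) ≠ D.dir (Sum.inr x) (Sum.inl v) →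
      D.Lab x (D.dir (Sum.inr x) (Sum.inl u)) (D.dir (Sum.inr x) (Sum.inl v)) := by
  refine ⟨fun hadj x _ hx ↦ lab_of_adj hadj hx, fun hall ↦ ?_⟩
  rw [accessibilityGraph_adj_iff]
  refine ⟨fun e ↦ huv.ne (e ▸ rfl), fun y _ _ hy ↦ ?_⟩
  by_cases hon : D.OnPath a b y
  · exact hall y hon hy
  obtain ⟨x, hx, hlt⟩ := exists_place_lt_of_position_lt huv
  rcases h.type y with hc | ⟨c, hc⟩
  · rw [hc]
    exact ⟨adj_dir (by simp), adj_dir (by simp), hy⟩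
  rw [hc.lab_dir_iff (by simp) (by simp)]
  refine ⟨hy, ?_⟩
  have hyx : y ≠ x := by rintro rfl; exact hon hx
  simp only [OnPath, not_not] at hon
  have e := hab y c hc (by simp) (by simp) hon
  have e1 : D.dir (Sum.inr y) (Sum.inr x) = c := by
    rcases dir_between (inr_ne hyx) hx with e' | e' <;> rw [e']
    · exact e
    · rw [← hon, e]
  have hne : D.dir (Sum.inr x) (Sum.inl u) ≠ D.dir (Sum.inr x) (Sum.inl v) := by
    intro e'
    unfold place at hlt
    rw [e'] at hlt
    omega
  rw [← e1]
  exact (dir_between (inr_ne hyx) hne).imp Eq.symm Eq.symm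

/-- Only stars of the path obstruct. A leaf behind a non-central marker at such a star sees later
leaves there only if the centre is not towards `a`, and earlier ones only if it is. A star with
centre towards neither end lets nothing pass; the leaves behind its centre, placed after the others
at the node, mark the reset. -/
theorem isThread [Finite L] : D.accessibilityGraph.IsThread := by
  refine ⟨D.position a b,
    fun n ↦ ∀ u x, D.position a b u = n → D.OnPath a b x → D.place a b x u = 1 →
      ¬D.StarAt x (D.dir (Sum.inr x) (Sum.inl a)),
    fun n ↦ ∀ u x c, D.position a b u = n → D.OnPath a b x → D.place a b x u = 1 →
      D.StarAt x c → c = D.dir (Sum.inr x) (Sum.inl a),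
    fun n ↦ ∃ u x, D.position a b u = n ∧ D.OnPath a b x ∧ D.place a b x u = 2,
    h.isCographOn_position hab, fun u v huv ↦ ?_⟩
  rw [h.adj_iff_lab_onPath hab huv]
  have hle : ∀ x, D.OnPath a b x → D.place a b x u ≤ D.place a b x v :=
    fun x hx ↦ place_le_of_position_le hx huv.le
  have hdist : ∀ x, D.OnPath a b x → D.HangsAt a b x u → D.place a b x u ≠ D.place a b x v :=
    fun x hx hu e ↦ huv.ne (position_eq_of_place_eq hx hu e)
  have lab : ∀ {x c}, D.StarAt x c → (D.Lab x (D.dir (Sum.inr x) (Sum.inl u))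
      (D.dir (Sum.inr x) (Sum.inl v)) ↔
        D.dir (Sum.inr x) (Sum.inl u) ≠ D.dir (Sum.inr x) (Sum.inl v) ∧
        (D.dir (Sum.inr x) (Sum.inl u) = c ∨ D.dir (Sum.inr x) (Sum.inl v) = c)) :=
    fun hx ↦ hx.lab_dir_iff (by simp) (by simp)
  have u0 := fun x : D.Node ↦ place_eq_zero_iff (x := x) (u := u) (a := a) (b := b)
  have v0 := fun x : D.Node ↦ place_eq_zero_iff (x := x) (u := v) (a := a) (b := b)
  have u1 := fun x : D.Node ↦ place_eq_one_iff (x := x) (u := u) (a := a) (b := b)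
  have v1 := fun x : D.Node ↦ place_eq_one_iff (x := x) (u := v) (a := a) (b := b)
  have u2 := fun x : D.Node ↦ place_eq_two_iff (x := x) (u := u) (a := a) (b := b)
  have v2 := fun x : D.Node ↦ place_eq_two_iff (x := x) (u := v) (a := a) (b := b)
  have u3 := fun x (hx : D.OnPath a b x) ↦ place_eq_three_iff (u := u) hx
  have v3 := fun x (hx : D.OnPath a b x) ↦ place_eq_three_iff (u := v) hx
  have m3 := fun x : D.Node ↦ place_le_three (D := D) (a := a) (b := b) x v
  constructor
  · intro hall
    refine ⟨fun v' x c hv' hx hp hc ↦ ?_, fun u' x hu' hx hp hc ↦ ?_, ?_⟩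
    · rw [place_eq_of_position_eq hx hv'] at hp
      obtain ⟨hh, hns⟩ := (v1 x).1 hp
      have hvc : D.dir (Sum.inr x) (Sum.inl v) ≠ c := by
        rintro rfl; exact hns hc
      by_contra hca
      have hlt : D.place a b x u = 0 := by
        by_contra h0
        have h1 : D.place a b x u = 1 := by have := hle x hx; omega
        exact hdist x hx ((u1 x).1 h1).1 (h1.trans hp.symm)
      rw [u0] at hlt
      have := ((lab hc).1 (hall x hx (by rw [hlt]; exact hh.1.symm))).2
      rw [hlt] at this
      exact this.elim (fun e ↦ hca e.symm) hvc
    · rw [place_eq_of_position_eq hx hu'] at hp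
      obtain ⟨hh, hns⟩ := (u1 x).1 hp
      have hv : D.place a b x v = 3 := by
        have l1 := hle x hx
        have l2 := hdist x hx hh
        have l3 : D.place a b x v ≠ 2 := by
          intro e
          obtain ⟨e1, e2⟩ := (v2 x).1 e
          exact e1.1 (h.centre_unique e2 hc)
        have := m3 x
        omega
      rw [v3 x hx] at hv
      have := ((lab hc).1 (hall x hx (by rw [hv]; exact hh.2))).2
      rw [hv] at this
      exact this.elim hh.1 (fun e ↦ hx e.symm)
    · rintro k hk hk' ⟨w, x, rfl, hx, hw⟩
      obtain ⟨hh, hc⟩ := place_eq_two_iff.1 hw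
      have hu : D.place a b x u < 2 := by
        refine lt_of_le_of_ne (hw ▸ place_le_of_position_le hx hk.le) fun e ↦ ?_
        exact hk.ne' (position_eq_of_place_eq hx hh (hw.trans e.symm))
      have hv : D.place a b x v = 3 := by
        have l1 := hw ▸ place_le_of_position_le hx hk'.le
        have l2 : D.place a b x v ≠ 2 := fun e ↦
          hk'.ne (position_eq_of_place_eq hx hh (hw.trans e.symm))
        have := m3 x
        omega
      have hv' := (v3 x hx).1 hv
      have huc : D.dir (Sum.inr x) (Sum.inl u) ≠ D.dir (Sum.inr x) (Sum.inl w) := by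
        intro e
        have : D.place a b x u = D.place a b x w := by unfold place; rw [e]
        omega
      have hne : D.dir (Sum.inr x) (Sum.inl u) ≠ D.dir (Sum.inr x) (Sum.inl v) := by
        intro e
        have : D.place a b x u = D.place a b x v := by unfold place; rw [e]
        omega
      have := ((lab hc).1 (hall x hx hne)).2
      rw [hv'] at this
      exact this.elim huc hh.2.symm
  · rintro ⟨hadj, hact, hreset⟩ x hx hne
    rcases h.type x with hc | ⟨c, hc⟩
    · rw [hc]
      exact ⟨adj_dir (by simp), adj_dir (by simp), hne⟩
    rw [lab hc]
    refine ⟨hne, ?_⟩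
    by_contra! hcon
    obtain ⟨hcu, hcv⟩ := hcon
    have nu : D.place a b x u ≠ 2 := fun e ↦ hcu (h.centre_unique ((u2 x).1 e).2 hc)
    have nv : D.place a b x v ≠ 2 := fun e ↦ hcv (h.centre_unique ((v2 x).1 e).2 hc)
    have hplace : D.place a b x u ≠ D.place a b x v := by
      intro e
      by_cases hh : D.HangsAt a b x u
      · exact hdist x hx hh e
      · have : D.place a b x u = 0 ∨ D.place a b x u = 3 := by
          rw [hangsAt_iff] at hh
          have := hle x hx
          have := m3 x
          omega
        rcases this with h0 | h0
        · exact hne (((u0 x).1 h0).trans ((v0 x).1 (e ▸ h0)).symm)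
        · exact hne (((u3 x hx).1 h0).trans ((v3 x hx).1 (e ▸ h0)).symm)
    have hlt := lt_of_le_of_ne (hle x hx) hplace
    by_cases hp1 : D.place a b x v = 1
    · have h0 := (u0 x).1 (by omega)
      exact hcu (h0.trans (hadj v x c rfl hx hp1 hc).symm)
    have hp3 : D.place a b x v = 3 := by have := m3 x; omega
    have hcb : c ≠ D.dir (Sum.inr x) (Sum.inl b) := by
      rw [← (v3 x hx).1 hp3]; exact hcv.symm
    by_cases hca : c = D.dir (Sum.inr x) (Sum.inl a)
    · have h1 : D.place a b x u = 1 := by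
        have : D.place a b x u ≠ 0 := fun e ↦ hcu (((u0 x).1 e).trans hca.symm)
        omega
      exact hact u x rfl hx h1 (hca ▸ hc)
    -- The centre is off the path, so a leaf behind it lies strictly between `u` and `v` and its
    -- position is a reset.
    · obtain ⟨w, hw⟩ := exists_leaf hc.adj
      have hpw : D.place a b x w = 2 :=
        place_eq_two_iff.2 ⟨⟨by rwa [hw], by rwa [hw]⟩, by rwa [hw]⟩
      exact hreset (D.position a b w) (position_lt_of_place_lt hx (by omega))
        (position_lt_of_place_lt hx (by omega)) ⟨w, x, rfl, hx, hpw⟩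

end IsCliqueStarTree

end GraphLabelledTree

/-! ### Attaching leaves to a tree -/

namespace SimpleGraph

section Pendant

variable {X Y : Type*}

/-- The graph obtained from an embedded copy of `T` by attaching all other vertices to the copy
of `p`. -/
def attachPendants (T : SimpleGraph X) (f : X ↪ Y) (p : X) : SimpleGraph Y :=
  T.map f ⊔ fromRel fun y z ↦ y ∉ Set.range f ∧ z = f p

variable {T : SimpleGraph X} {f : X ↪ Y} {p : X}

theorem attachPendants_adj_map {a b : X} : (T.attachPendants f p).Adj (f a) (f b) ↔ T.Adj a b := by
  simp [attachPendants]

theorem attachPendants_adj_of_notMem {y z : Y} (hy : y ∉ Set.range f) :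
    (T.attachPendants f p).Adj y z ↔ z = f p := by
  simp only [attachPendants, sup_adj, map_adj, fromRel_adj]
  constructor
  · rintro (⟨a, b, -, rfl, -⟩ | ⟨-, h | h⟩)
    · exact (hy ⟨a, rfl⟩).elim
    · exact h.2
    · exact (hy ⟨p, h.2.symm⟩).elim
  · rintro rfl
    exact .inr ⟨fun h ↦ hy ⟨p, h.symm⟩, .inl ⟨hy, rfl⟩⟩

theorem exists_of_attachPendants_adj {q : X} (hq : q ≠ p) {a : Y}
    (h : (T.attachPendants f p).Adj (f q) a) : ∃ b, a = f b ∧ T.Adj q b := by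
  by_cases ha : a ∈ Set.range f
  · obtain ⟨b, rfl⟩ := ha
    exact ⟨b, rfl, attachPendants_adj_map.1 h⟩
  · exact (hq (f.injective ((attachPendants_adj_of_notMem ha).1 h.symm))).elim

/-- Acyclicity is checked by bridges. Retracting the new vertices to `p` turns a walk avoiding an
old edge into one in `T`, and a new vertex has only one edge. -/
theorem IsTree.attachPendants (hT : T.IsTree) (f : X ↪ Y) (p : X) :
    (T.attachPendants f p).IsTree := by
  classical
  let φ : T →g T.attachPendants f p := ⟨f, fun h ↦ attachPendants_adj_map.2 h⟩
  have hp : ∀ y, (T.attachPendants f p).Reachable (f p) y := by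
    intro y
    by_cases hy : y ∈ Set.range f
    · obtain ⟨x, rfl⟩ := hy
      exact (hT.connected.preconnected p x).map φ
    · exact (Adj.reachable ((attachPendants_adj_of_notMem hy).2 rfl)).symm
  have : Nonempty Y := ⟨f p⟩
  refine ⟨⟨fun y z ↦ (hp y).symm.trans (hp z)⟩, ?_⟩
  rw [isAcyclic_iff_forall_adj_isBridge]
  have hbr := isAcyclic_iff_forall_adj_isBridge.1 hT.isAcyclic
  intro y z hyz
  have iso : ∀ {y z}, (T.attachPendants f p).Adj y z → y ∉ Set.range f →
      (T.attachPendants f p).IsBridge s(y, z) := by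
    intro y z hyz hy
    rw [isBridge_iff]
    rintro ⟨w⟩
    cases w with
    | nil => exact hyz.ne rfl
    | cons h q =>
      rw [deleteEdges_adj] at h
      have h1 := (attachPendants_adj_of_notMem hy).1 h.1
      have h2 := (attachPendants_adj_of_notMem hy).1 hyz
      refine h.2 ?_
      rw [h1, h2]
      rfl
  by_cases hy : y ∈ Set.range f
  · by_cases hz : z ∈ Set.range f
    · obtain ⟨a, rfl⟩ := hy
      obtain ⟨b, rfl⟩ := hz
      have hab := attachPendants_adj_map.1 hyz
      have hb := isBridge_iff.1 (hbr hab)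
      rw [isBridge_iff]
      rintro ⟨w⟩
      let r : Y → X := fun y ↦ if h : y ∈ Set.range f then h.choose else p
      have hr : ∀ x, r (f x) = x := fun x ↦ by
        have h : f x ∈ Set.range f := ⟨x, rfl⟩
        simp only [r, dif_pos h]
        exact f.injective h.choose_spec
      have hr' : ∀ y ∉ Set.range f, r y = p := fun y h ↦ by simp only [r, dif_neg h]
      have key : ∀ {y z} (w : ((T.attachPendants f p).deleteEdges {s(f a, f b)}).Walk y z),
          (T.deleteEdges {s(a, b)}).Reachable (r y) (r z) := by
        intro y z w
        induction w with
        | nil => rfl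
        | @cons y y' z h q ih =>
          refine Reachable.trans ?_ ih
          rw [deleteEdges_adj] at h
          by_cases hy : y ∈ Set.range f
          · by_cases hy' : y' ∈ Set.range f
            · obtain ⟨c, rfl⟩ := hy
              obtain ⟨d, rfl⟩ := hy'
              rw [hr, hr]
              refine Adj.reachable ?_
              rw [deleteEdges_adj]
              refine ⟨attachPendants_adj_map.1 h.1, fun h' ↦ h.2 ?_⟩
              exact congrArg (Sym2.map f) (show s(c, d) = s(a, b) from h')
            · rw [(attachPendants_adj_of_notMem hy').1 h.1.symm, hr, hr' _ hy']
          · rw [(attachPendants_adj_of_notMem hy).1 h.1, hr, hr' _ hy]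
      have := key w
      rw [hr, hr] at this
      exact hb this
    · rw [Sym2.eq_swap]
      exact iso hyz.symm hz
  · exact iso hyz hy

theorem IsTree.attachPendants_dir_map (hT : T.IsTree) (x z : X) :
    (hT.attachPendants f p).dir (f x) (f z) = f (hT.dir x z) := by
  let φ : T →g T.attachPendants f p := ⟨f, fun h ↦ attachPendants_adj_map.2 h⟩
  obtain ⟨w, hw⟩ := hT.exists_path x z
  have hw' : (w.map φ).IsPath := hw.map f.injective
  rw [hT.dir_eq_snd hw]
  refine ((hT.attachPendants f p).dir_eq_snd hw').trans ?_
  simp only [Walk.snd, Walk.getVert_map]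
  rfl

theorem IsTree.attachPendants_dir_of_notMem (hT : T.IsTree) {x : X} (hx : x ≠ p) {y : Y}
    (hy : y ∉ Set.range f) : (hT.attachPendants f p).dir (f x) y = f (hT.dir x p) := by
  rw [← hT.attachPendants_dir_map]
  exact (hT.attachPendants f p).dir_eq_of_adj ((attachPendants_adj_of_notMem hy).2 rfl)
    (fun h ↦ hy ⟨x, h⟩) (fun h ↦ hx (f.injective h))

theorem IsTree.attachPendants_dir_self (hT : T.IsTree) {y : Y} (hy : y ∉ Set.range f) :
    (hT.attachPendants f p).dir (f p) y = y :=
  (hT.attachPendants f p).dir_of_adj ((attachPendants_adj_of_notMem hy).2 rfl).symm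

end Pendant

/-- In a clique (`c = none`) or a star with centre `c`, distinct markers `d` and `d'` are
adjacent. -/
def MarkersAdj {X : Type*} (c : Option X) (d d' : X) : Prop :=
  d ≠ d' → c = none ∨ c = some d ∨ c = some d'

section Markers

variable {X Y : Type*}

theorem markersAdj_comm {c : Option X} {d d' : X} : MarkersAdj c d d' ↔ MarkersAdj c d' d := by
  unfold MarkersAdj; grind

theorem markersAdj_map (f : X ↪ Y) {c : Option X} {d d' : X} :
    MarkersAdj (c.map f) (f d) (f d') ↔ MarkersAdj c d d' := by
  have := f.injective
  unfold MarkersAdj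
  cases c <;> simp

theorem markersAdj_map_of_notMem {f : X ↪ Y} {c : Option X} {y : Y} {d : X}
    (hy : y ∉ Set.range f) : MarkersAdj (c.map f) y (f d) ↔ c = none ∨ c = some d := by
  unfold MarkersAdj
  have h1 : y ≠ f d := fun h ↦ hy ⟨d, h.symm⟩
  have h2 : ∀ x, f x ≠ y := fun x h ↦ hy ⟨x, h⟩
  cases c <;> simp [h1, h2]

end Markers

/-! ### Existence of split decompositions -/

variable {L : Type u}

/-- A tree with leaf set `L` all of whose nodes are cliques or stars, given by their centres, that
represents the canonical split decomposition of `G`. -/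
structure SplitTree (G : SimpleGraph L) where
  Node : Type
  finite_node : Finite Node
  tree : SimpleGraph (L ⊕ Node)
  isTree : tree.IsTree
  centre : Node → Option (L ⊕ Node)
  leaf_unique : ∀ l a b, tree.Adj (Sum.inl l) a → tree.Adj (Sum.inl l) b → a = b
  exists_third : ∀ x a b, ∃ w, tree.Adj (Sum.inr x) w ∧ w ≠ a ∧ w ≠ b
  centre_adj : ∀ x c, centre x = some c → tree.Adj (Sum.inr x) c
  clique_reduced : ∀ x y, tree.Adj (Sum.inr x) (Sum.inr y) → centre x = none → centre y ≠ none
  star_reduced : ∀ x y c, centre x = some (Sum.inr y) → centre y = some c → c = Sum.inr x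
  adj_iff : ∀ u v, u ≠ v → (G.Adj u v ↔ ∀ n, MarkersAdj (centre n)
    (isTree.dir (Sum.inr n) (Sum.inl u)) (isTree.dir (Sum.inr n) (Sum.inl v)))

namespace SplitTree

variable {G : SimpleGraph L} (S : G.SplitTree)

/-- The label of the node `x`, on all vertices of the tree. -/
def labelGraph (x : S.Node) : SimpleGraph (L ⊕ S.Node) :=
  match S.centre x with
  | none => ⊤
  | some c => starGraph c

theorem labelGraph_adj {x : S.Node} {w w' : L ⊕ S.Node} : (S.labelGraph x).Adj w w' ↔
    w ≠ w' ∧ (S.centre x = none ∨ S.centre x = some w ∨ S.centre x = some w') := by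
  unfold labelGraph
  rcases hc : S.centre x with _ | c
  · simp
  · simp [starGraph_adj, eq_comm]

theorem three_le_ncard [Finite L] (x : S.Node) :
    3 ≤ (S.tree.neighborSet (Sum.inr x)).ncard := by
  have := S.finite_node
  obtain ⟨w, hw, -⟩ := S.exists_third x (Sum.inr x) (Sum.inr x)
  obtain ⟨w', hw', h, -⟩ := S.exists_third x w w
  obtain ⟨w'', hw'', h', h''⟩ := S.exists_third x w w'
  rw [← Set.ncard_eq_three.2 ⟨w, w', w'', h.symm, h'.symm, h''.symm, rfl⟩]
  refine Set.ncard_le_ncard ?_ (Set.toFinite _)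
  rintro z (rfl | rfl | rfl)
  exacts [hw, hw', hw'']

/-- The graph-labelled tree. -/
def toGraphLabelledTree [Finite L] : GraphLabelledTree L where
  Node := S.Node
  finite_node := S.finite_node
  tree := S.tree
  isTree := S.isTree
  leaf_degree l := by
    have := S.finite_node
    exact (Set.ncard_le_one (Set.toFinite _)).2 fun a ha b hb ↦ S.leaf_unique l a b ha hb
  node_degree x := (by omega : 2 ≤ 3).trans (S.three_le_ncard x)
  label x := (S.labelGraph x).comap Subtype.val

theorem lab_iff [Finite L] {x : S.Node} {w w' : L ⊕ S.Node} :
    S.toGraphLabelledTree.Lab x w w' ↔ S.tree.Adj (Sum.inr x) w ∧ S.tree.Adj (Sum.inr x) w' ∧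
      w ≠ w' ∧ (S.centre x = none ∨ S.centre x = some w ∨ S.centre x = some w') := by
  rw [← S.labelGraph_adj]
  exact ⟨fun ⟨h, h', h2⟩ ↦ ⟨h, h', h2⟩, fun ⟨h, h', h2⟩ ↦ ⟨h, h', h2⟩⟩

theorem cliqueAt_iff [Finite L] {x : S.Node} :
    S.toGraphLabelledTree.CliqueAt x ↔ S.centre x = none := by
  constructor
  · intro h
    rcases hc : S.centre x with _ | c
    · rfl
    obtain ⟨w, hw, h1, -⟩ := S.exists_third x c c
    obtain ⟨w', hw', h2, h3⟩ := S.exists_third x c w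
    have := (S.lab_iff.1 ((h w w').2 ⟨hw, hw', h3.symm⟩)).2.2.2
    grind
  · intro h w w'
    refine S.lab_iff.trans ?_
    rw [h]
    simp [toGraphLabelledTree]

theorem starAt_iff [Finite L] {x : S.Node} {c : L ⊕ S.Node} :
    S.toGraphLabelledTree.StarAt x c ↔ S.centre x = some c := by
  have key : ∀ c, S.centre x = some c → S.toGraphLabelledTree.StarAt x c := by
    intro c hc
    refine ⟨S.centre_adj x c hc, fun w w' ↦ ?_⟩
    refine S.lab_iff.trans ⟨fun ⟨h1, h2, h3, h4⟩ ↦ ⟨h1, h2, h3, ?_⟩,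
      fun ⟨h1, h2, h3, h4⟩ ↦ ⟨h1, h2, h3, ?_⟩⟩
    · rcases h4 with h4 | h4 | h4
      · simp [hc] at h4
      · exact .inl (Option.some.inj (hc.symm.trans h4)).symm
      · exact .inr (Option.some.inj (hc.symm.trans h4)).symm
    · rcases h4 with rfl | rfl
      exacts [.inr (.inl hc), .inr (.inr hc)]
  refine ⟨fun h ↦ ?_, key c⟩
  rcases hc : S.centre x with _ | c'
  · obtain ⟨w, hw, h1, -⟩ := S.exists_third x c c
    obtain ⟨w', hw', h2, h3⟩ := S.exists_third x c w
    have := ((h.2 w w').1 ((S.cliqueAt_iff.2 hc w w').2 ⟨hw, hw', h3.symm⟩)).2.2.2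
    grind
  · rw [(key c' hc).unique h (S.exists_third x)]

theorem isSplitDecompositionOf [Finite L] : S.toGraphLabelledTree.IsSplitDecompositionOf G where
  accessibilityGraph_eq := by
    ext u v
    by_cases huv : u = v
    · subst huv; simp
    rw [GraphLabelledTree.accessibilityGraph_adj_iff, S.adj_iff u v huv]
    refine (and_iff_right huv).trans (forall_congr' fun n ↦ ?_)
    have a1 := S.isTree.adj_dir (x := Sum.inr n) (u := Sum.inl u) (by simp)
    have a2 := S.isTree.adj_dir (x := Sum.inr n) (u := Sum.inl v) (by simp)
    constructor
    · intro h hne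
      exact (S.lab_iff.1 (h (by simp) (by simp) hne)).2.2.2
    · intro h _ _ hne
      exact S.lab_iff.2 ⟨a1, a2, hne, h hne⟩
  three_le_degree := S.three_le_ncard
  label_type x := by
    rcases hc : S.centre x with _ | c
    · exact .inl (GraphLabelledTree.isClique_iff.2 (S.cliqueAt_iff.2 hc))
    · exact .inr (.inl ⟨⟨c, S.centre_adj x c hc⟩,
        GraphLabelledTree.isStarWithCentre_iff.2 (S.starAt_iff.2 hc)⟩)
  clique_reduced x y hxy hx hy := S.clique_reduced x y hxy
    (S.cliqueAt_iff.1 (GraphLabelledTree.isClique_iff.1 hx))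
    (S.cliqueAt_iff.1 (GraphLabelledTree.isClique_iff.1 hy))
  star_reduced x y c c' hx hy hc := by
    have h1 := S.starAt_iff.1 (GraphLabelledTree.isStarWithCentre_iff.1 hx)
    have h2 := S.starAt_iff.1 (GraphLabelledTree.isStarWithCentre_iff.1 hy)
    rw [hc] at h1
    exact S.star_reduced x y _ h1 h2

end SplitTree


variable {L : Type u}

/-- The retraction sending `v` to `u` maps every edge to an edge or to a single vertex. -/
theorem Connected.induce_compl_of_twins_or_pendant {G : SimpleGraph L} (h : G.Connected) {v u : L}
    (hv : G.AreTwins v u ∨ (v ≠ u ∧ ∀ w, G.Adj v w → w = u)) :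
    (G.induce {w | w ≠ v}).Connected := by
  classical
  have hne : u ≠ v := hv.elim (fun h ↦ h.1.symm) fun h ↦ h.1.symm
  let r : L → {w | w ≠ v} := fun w ↦ if hw : w ≠ v then ⟨w, hw⟩ else ⟨u, hne⟩
  have hr : ∀ w (hw : w ≠ v), r w = ⟨w, hw⟩ := fun w hw ↦ dif_pos hw
  have hrv : r v = ⟨u, hne⟩ := dif_neg (by simp)
  have hadj : ∀ w, G.Adj v w → w ≠ u → G.Adj u w := by
    intro w hw hwu
    rcases hv with ⟨-, hv⟩ | ⟨-, hv⟩
    · exact (hv w hw.ne' hwu).1 hw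
    · exact (hwu (hv w hw)).elim
  have key : ∀ {a b} (p : G.Walk a b), (G.induce {w | w ≠ v}).Reachable (r a) (r b) := by
    intro a b p
    induction p with
    | nil => rfl
    | @cons a c b hac q ih =>
      refine Reachable.trans ?_ ih
      by_cases ha : a = v
      · subst ha
        rw [hrv, hr c hac.ne']
        by_cases hc : c = u
        · subst hc; rfl
        · exact Adj.reachable (hadj c hac hc)
      · by_cases hc : c = v
        · subst hc
          rw [hrv, hr a ha]
          by_cases hau : a = u
          · subst hau; rfl
          · exact (Adj.reachable (show (G.induce {w | w ≠ c}).Adj ⟨u, hne⟩ ⟨a, ha⟩ from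
              hadj a hac.symm hau)).symm
        · rw [hr a ha, hr c hc]
          exact Adj.reachable hac
  have : Nonempty {w | w ≠ v} := ⟨⟨u, hne⟩⟩
  refine ⟨fun a b ↦ ?_⟩
  obtain ⟨p⟩ := h.preconnected a b
  have := key p
  rwa [hr _ a.2, hr _ b.2] at this

namespace SplitTree

variable {G : SimpleGraph L}

theorem dir_inl {S : G.SplitTree} {l : L} {m : L ⊕ S.Node} (h : S.tree.Adj (Sum.inl l) m)
    {s : L ⊕ S.Node} (hs : Sum.inl l ≠ s) : S.isTree.dir (Sum.inl l) s = m :=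
  S.leaf_unique l _ _ (S.isTree.adj_dir hs) h

theorem dir_ne_inl {S : G.SplitTree} {l l' : L} {m : L ⊕ S.Node} (h : S.tree.Adj m (Sum.inl l))
    (hl : l ≠ l') : S.isTree.dir m (Sum.inl l') ≠ Sum.inl l := by
  have hl : (Sum.inl l : L ⊕ S.Node) ≠ Sum.inl l' := fun h ↦ hl (Sum.inl_injective h)
  intro e
  have := S.isTree.dir_dir (x := m) (u := Sum.inl l') (by rwa [e])
  rw [e] at this
  exact this (dir_inl h.symm hl)

/-- For a symmetric relation it suffices to consider pairs of old vertices and pairs that contain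
the new vertex `v`. -/
theorem forall_pair_of {L : Type*} {P : L → L → Prop} (v : L) (hs : ∀ a b, P a b → P b a)
    (h : ∀ a b, a ≠ v → b ≠ v → a ≠ b → P a b) (h' : ∀ b, b ≠ v → P v b) :
    ∀ a b, a ≠ b → P a b := by
  intro a b hab
  by_cases ha : a = v
  · subst ha; exact h' b hab.symm
  · by_cases hb : b = v
    · subst hb; exact hs _ _ (h' a ha)
    · exact h a b ha hb hab

variable {v u : L} (huv : u ≠ v) (S : (G.induce {w | w ≠ v}).SplitTree)

/-- The embedding of the vertices of a tree when a leaf `v` is added. -/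
def addLeafEmb (v : L) (N : Type) : {w | w ≠ v} ⊕ N ↪ L ⊕ N :=
  (Function.Embedding.subtype _).sumMap (.refl _)

theorem exists_forall_map_eq {X Y : Type*} (f : X ↪ Y) (x : X) (y : Y) :
    ∃ x', ∀ z, f z = y → z = x' := by
  by_cases h : ∃ x', f x' = y
  · obtain ⟨x', rfl⟩ := h
    exact ⟨x', fun z hz ↦ f.injective hz⟩
  · exact ⟨x, fun z hz ↦ (h ⟨z, hz⟩).elim⟩

theorem inl_notMem_range_addLeafEmb (v : L) (N : Type) :
    Sum.inl v ∉ Set.range (addLeafEmb v N) := by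
  rintro ⟨w | n, h⟩
  · exact w.2 (Sum.inl_injective h)
  · cases h

/-- A leaf that is a twin of `u`, or is pendant at `u`, can be attached to the node next to `u`. -/
theorem nonempty_of_attach_leaf (x : S.Node) (hx : S.tree.Adj (Sum.inl ⟨u, huv⟩) (Sum.inr x))
    (h : (S.centre x ≠ some (Sum.inl ⟨u, huv⟩) ∧ (∀ w, w ≠ v → w ≠ u → (G.Adj v w ↔ G.Adj u w)) ∧
        (G.Adj v u ↔ S.centre x = none)) ∨
      (S.centre x = some (Sum.inl ⟨u, huv⟩) ∧ ∀ w, G.Adj v w ↔ w = u)) :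
    Nonempty G.SplitTree := by
  let f := addLeafEmb v S.Node
  have hf : Sum.inl v ∉ Set.range f := inl_notMem_range_addLeafEmb v S.Node
  have hd := fun a b ↦ S.isTree.attachPendants_dir_map (f := f) (p := Sum.inr x) a b
  have hd' : ∀ n, n ≠ x → (S.isTree.attachPendants f (Sum.inr x)).dir (f (Sum.inr n)) (Sum.inl v) =
      f (S.isTree.dir (Sum.inr n) (Sum.inl ⟨u, huv⟩)) := by
    intro n hn
    rw [S.isTree.attachPendants_dir_of_notMem (fun h ↦ hn (Sum.inr_injective h)) hf,
      S.isTree.dir_eq_of_adj hx (by simp) (fun h ↦ hn (Sum.inr_injective h))]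
  have hd'' : (S.isTree.attachPendants f (Sum.inr x)).dir (f (Sum.inr x)) (Sum.inl v) = Sum.inl v :=
    S.isTree.attachPendants_dir_self hf
  have hxu : S.isTree.dir (Sum.inr x) (Sum.inl ⟨u, huv⟩) = Sum.inl ⟨u, huv⟩ :=
    S.isTree.dir_of_adj hx.symm
  refine ⟨{
    Node := S.Node
    finite_node := S.finite_node
    tree := S.tree.attachPendants f (Sum.inr x)
    isTree := S.isTree.attachPendants f _
    centre := fun n ↦ (S.centre n).map f
    leaf_unique := ?_
    exists_third := ?_
    centre_adj := ?_
    clique_reduced := ?_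
    star_reduced := ?_
    adj_iff := ?_ }⟩
  · intro l a b ha hb
    by_cases hl : l = v
    · subst hl
      rw [attachPendants_adj_of_notMem hf] at ha hb
      rw [ha, hb]
    · obtain ⟨a, rfl, ha'⟩ := exists_of_attachPendants_adj (f := f) (q := Sum.inl ⟨l, hl⟩)
        (by simp) ha
      obtain ⟨b, rfl, hb'⟩ := exists_of_attachPendants_adj (f := f) (q := Sum.inl ⟨l, hl⟩)
        (by simp) hb
      rw [S.leaf_unique ⟨l, hl⟩ a b ha' hb']
  · intro n a b
    obtain ⟨a', ha⟩ := exists_forall_map_eq f (Sum.inr n) a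
    obtain ⟨b', hb⟩ := exists_forall_map_eq f (Sum.inr n) b
    obtain ⟨w, hw, h1, h2⟩ := S.exists_third n a' b'
    exact ⟨f w, attachPendants_adj_map.2 hw, fun h ↦ h1 (ha w h), fun h ↦ h2 (hb w h)⟩
  · intro n c hc
    obtain ⟨c, hc', rfl⟩ := Option.map_eq_some_iff.1 hc
    exact attachPendants_adj_map.2 (S.centre_adj n c hc')
  · intro n n' hnn hn hn'
    exact S.clique_reduced n n' (attachPendants_adj_map.1 hnn) (Option.map_eq_none_iff.1 hn)
      (Option.map_eq_none_iff.1 hn')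
  · intro n n' c hn hn'
    obtain ⟨d, hd, hdf⟩ := Option.map_eq_some_iff.1 hn
    obtain ⟨c, hc, rfl⟩ := Option.map_eq_some_iff.1 hn'
    have : d = Sum.inr n' := f.injective hdf
    subst this
    rw [S.star_reduced n n' c hd hc]
    rfl
  · refine forall_pair_of v (fun a b hab ↦ ?_) (fun a b ha hb hab ↦ ?_) (fun w hw ↦ ?_)
    · rw [G.adj_comm, hab]
      exact forall_congr' fun n ↦ markersAdj_comm
    · have := S.adj_iff ⟨a, ha⟩ ⟨b, hb⟩ (fun h ↦ hab (congrArg Subtype.val h))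
      refine this.trans (forall_congr' fun n ↦ ?_)
      rw [← markersAdj_map f, ← hd, ← hd]
      rfl
    -- At nodes other than `x` the new leaf lies in the direction of `u`; at `x` it has a marker of
    -- its own, which is not the centre.
    · have hall : (∀ n, MarkersAdj ((S.centre n).map f)
          ((S.isTree.attachPendants f (Sum.inr x)).dir (f (Sum.inr n)) (Sum.inl v))
          ((S.isTree.attachPendants f (Sum.inr x)).dir (f (Sum.inr n)) (f (Sum.inl ⟨w, hw⟩)))) ↔
          (∀ n, n ≠ x → MarkersAdj (S.centre n) (S.isTree.dir (Sum.inr n) (Sum.inl ⟨u, huv⟩))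
            (S.isTree.dir (Sum.inr n) (Sum.inl ⟨w, hw⟩))) ∧
          (S.centre x = none ∨ S.centre x = some (S.isTree.dir (Sum.inr x) (Sum.inl ⟨w, hw⟩))) := by
        have h1 : ∀ n, n ≠ x → (MarkersAdj ((S.centre n).map f)
            ((S.isTree.attachPendants f (Sum.inr x)).dir (f (Sum.inr n)) (Sum.inl v))
            ((S.isTree.attachPendants f (Sum.inr x)).dir (f (Sum.inr n)) (f (Sum.inl ⟨w, hw⟩))) ↔
            MarkersAdj (S.centre n) (S.isTree.dir (Sum.inr n) (Sum.inl ⟨u, huv⟩))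
            (S.isTree.dir (Sum.inr n) (Sum.inl ⟨w, hw⟩))) := by
          intro n hn
          rw [hd' n hn, hd, markersAdj_map]
        have h2 : MarkersAdj ((S.centre x).map f)
            ((S.isTree.attachPendants f (Sum.inr x)).dir (f (Sum.inr x)) (Sum.inl v))
            ((S.isTree.attachPendants f (Sum.inr x)).dir (f (Sum.inr x)) (f (Sum.inl ⟨w, hw⟩))) ↔
            S.centre x = none ∨ S.centre x = some (S.isTree.dir (Sum.inr x) (Sum.inl ⟨w, hw⟩)) := by
          rw [hd'', hd, markersAdj_map_of_notMem hf]
        constructor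
        · exact fun h ↦ ⟨fun n hn ↦ (h1 n hn).1 (h n), h2.1 (h x)⟩
        · intro h n
          by_cases hn : n = x
          · subst hn; exact h2.2 h.2
          · exact (h1 n hn).2 (h.1 n hn)
      refine Iff.trans ?_ hall.symm
      by_cases hwu : w = u
      · subst hwu
        rw [hxu]
        have : (∀ n, n ≠ x → MarkersAdj (S.centre n) (S.isTree.dir (Sum.inr n) (Sum.inl ⟨w, huv⟩))
            (S.isTree.dir (Sum.inr n) (Sum.inl ⟨w, hw⟩))) := fun n _ h ↦ (h rfl).elim
        rcases h with ⟨h1, h2, h3⟩ | ⟨h1, h2⟩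
        · rw [h3]
          exact ⟨fun h ↦ ⟨this, .inl h⟩, fun h ↦ h.2.resolve_right h1⟩
        · rw [h2]
          exact ⟨fun _ ↦ ⟨this, .inr h1⟩, fun _ ↦ rfl⟩
      · have huw : (⟨u, huv⟩ : {w | w ≠ v}) ≠ ⟨w, hw⟩ := fun h ↦ hwu (congrArg Subtype.val h).symm
        have hne : S.isTree.dir (Sum.inr x) (Sum.inl ⟨w, hw⟩) ≠ Sum.inl ⟨u, huv⟩ :=
          dir_ne_inl hx.symm huw
        rcases h with ⟨h1, h2, h3⟩ | ⟨h1, h2⟩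
        · rw [h2 w hw hwu]
          refine (S.adj_iff ⟨u, huv⟩ ⟨w, hw⟩ huw).trans ?_
          have hpx : MarkersAdj (S.centre x) (S.isTree.dir (Sum.inr x) (Sum.inl ⟨u, huv⟩))
              (S.isTree.dir (Sum.inr x) (Sum.inl ⟨w, hw⟩)) ↔ (S.centre x = none ∨
              S.centre x = some (S.isTree.dir (Sum.inr x) (Sum.inl ⟨w, hw⟩))) := by
            rw [hxu]
            exact ⟨fun h ↦ (h hne.symm).imp_right fun h ↦ h.resolve_left h1, fun h _ ↦ h.imp_right .inr⟩
          rw [← hpx]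
          exact ⟨fun h ↦ ⟨fun n _ ↦ h n, h x⟩,
            fun h n ↦ (eq_or_ne n x).elim (fun e ↦ e ▸ h.2) (h.1 n)⟩
        · rw [h2]
          refine iff_of_false hwu fun h ↦ ?_
          rw [h1] at h
          rcases h.2 with h | h
          · cases h
          · exact hne (Option.some.inj h).symm

end SplitTree


namespace SplitTree

variable {L : Type u} {G : SimpleGraph L} {v u : L}

/-- The embedding of the vertices of a tree when a new node takes the place of the leaf `u`. -/
noncomputable def replaceLeafEmb (v : L) (N : Type) (u : {w | w ≠ v}) : {w | w ≠ v} ⊕ N ↪ L ⊕ Option N where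
  toFun := by
    classical
    exact Sum.elim (fun w ↦ if w = u then Sum.inr none else Sum.inl w.1) fun n ↦ Sum.inr (some n)
  inj' := by
    rintro (w | n) (w' | n') h
    · by_cases h1 : w = u <;> by_cases h2 : w' = u
      · rw [h1, h2]
      · simp [h1, h2] at h
      · simp [h1, h2] at h
      · simp only [Sum.elim_inl, if_neg h1, if_neg h2] at h
        rw [Subtype.ext (Sum.inl_injective h)]
    · by_cases h1 : w = u <;> simp [h1] at h
    · by_cases h1 : w' = u <;> simp [h1] at h
    · simpa using h

variable {N : Type} {u' : {w | w ≠ v}}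

theorem replaceLeafEmb_self : replaceLeafEmb v N u' (Sum.inl u') = Sum.inr none := if_pos rfl

theorem replaceLeafEmb_inl {w : {w | w ≠ v}} (h : w ≠ u') :
    replaceLeafEmb v N u' (Sum.inl w) = Sum.inl w.1 := if_neg h

theorem inl_notMem_range_replaceLeafEmb {w : L} (h : w = v ∨ w = u') :
    Sum.inl w ∉ Set.range (replaceLeafEmb v N u') := by
  rintro ⟨z | n, hz⟩
  · by_cases hzu : z = u'
    · rw [hzu, replaceLeafEmb_self] at hz
      cases hz
    · rw [replaceLeafEmb_inl hzu] at hz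
      have := Sum.inl_injective hz
      rcases h with h | h
      · exact z.2 (this.trans h)
      · exact hzu (Subtype.ext (this.trans h))
  · cases hz

variable (huv : u ≠ v) (S : (G.induce {w | w ≠ v}).SplitTree)

/-- A twin of `u`, or a vertex that is pendant at `u`, can be added together with a new node. -/
theorem nonempty_of_insert_node (m : {w | w ≠ v} ⊕ S.Node)
    (hm : S.tree.Adj (Sum.inl ⟨u, huv⟩) m) (k : Option (L ⊕ Option S.Node))
    (hk : (k = none ∧ (∀ w, w ≠ v → w ≠ u → (G.Adj v w ↔ G.Adj u w)) ∧ G.Adj v u ∧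
        ∀ n, m = Sum.inr n → S.centre n ≠ none) ∨
      (k = some (replaceLeafEmb v S.Node ⟨u, huv⟩ m) ∧
        (∀ w, w ≠ v → w ≠ u → (G.Adj v w ↔ G.Adj u w)) ∧ ¬G.Adj v u ∧
        ∀ n, m = Sum.inr n → ∀ c, S.centre n = some c → c = Sum.inl ⟨u, huv⟩) ∨
      (k = some (Sum.inl u) ∧ (∀ w, G.Adj v w ↔ w = u) ∧
        ∀ n, m = Sum.inr n → S.centre n ≠ some (Sum.inl ⟨u, huv⟩))) :
    Nonempty G.SplitTree := by
  have := S.finite_node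
  -- Under `f` the place of the old leaf `u` is taken by the new node, and `u` and `v`, being
  -- outside the range, become leaves at it. The last clause in each alternative of `hk` keeps the
  -- tree reduced across the edge to `m`.
  obtain ⟨f, hf⟩ : ∃ f, f = replaceLeafEmb v S.Node ⟨u, huv⟩ := ⟨_, rfl⟩
  obtain ⟨p, hp⟩ : ∃ p : {w | w ≠ v} ⊕ S.Node, p = Sum.inl ⟨u, huv⟩ := ⟨_, rfl⟩
  have fp : f p = Sum.inr none := by rw [hf, hp, replaceLeafEmb_self]
  have fw : ∀ w (hwv : w ≠ v), w ≠ u → f (Sum.inl ⟨w, hwv⟩) = Sum.inl w := by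
    intro w hwv hwu
    rw [hf]
    exact replaceLeafEmb_inl (fun h ↦ hwu (congrArg Subtype.val h))
  have fn : ∀ n, f (Sum.inr n) = Sum.inr (some n) := fun n ↦ by rw [hf]; rfl
  have fv : Sum.inl v ∉ Set.range f := hf ▸ inl_notMem_range_replaceLeafEmb (.inl rfl)
  have fu : Sum.inl u ∉ Set.range f := hf ▸ inl_notMem_range_replaceLeafEmb (.inr rfl)
  rw [← hf, ← hp] at hk
  rw [← hp] at hm
  have hwp : ∀ w (hwv : w ≠ v), w ≠ u → p ≠ Sum.inl ⟨w, hwv⟩ := by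
    rintro w hwv hwu h
    rw [hp] at h
    exact hwu (congrArg Subtype.val (Sum.inl_injective h)).symm
  have pm : ∀ w (hwv : w ≠ v), w ≠ u → S.isTree.dir p (Sum.inl ⟨w, hwv⟩) = m := by
    intro w hwv hwu
    have := hwp w hwv hwu
    rw [hp] at hm this ⊢
    exact dir_inl hm this
  have hpn : ∀ n, Sum.inr n ≠ p := by rw [hp]; simp
  have hd := fun a b ↦ S.isTree.attachPendants_dir_map (f := f) (p := p) a b
  have hd' : ∀ n y, y ∉ Set.range f →
      (S.isTree.attachPendants f p).dir (Sum.inr (some n)) y = f (S.isTree.dir (Sum.inr n) p) := by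
    intro n y hy
    rw [← fn, S.isTree.attachPendants_dir_of_notMem (hpn n) hy]
  have hds : ∀ y, y ∉ Set.range f → (S.isTree.attachPendants f p).dir (Sum.inr none) y = y := by
    intro y hy
    rw [← fp, S.isTree.attachPendants_dir_self hy]
  have hdw : ∀ n w (hwv : w ≠ v), w ≠ u → (S.isTree.attachPendants f p).dir (Sum.inr (some n))
      (Sum.inl w) = f (S.isTree.dir (Sum.inr n) (Sum.inl ⟨w, hwv⟩)) := by
    intro n w hwv hwu
    rw [← fn, ← fw w hwv hwu, hd]
  have hdm : ∀ w, w ≠ v → w ≠ u → (S.isTree.attachPendants f p).dir (Sum.inr none) (Sum.inl w) =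
      f m := by
    intro w hwv hwu
    rw [← fp, ← fw w hwv hwu, hd, pm w hwv hwu]
  have madj : ∀ n, S.tree.Adj p (Sum.inr n) → m = Sum.inr n := by
    rw [hp] at hm ⊢
    exact fun n h ↦ S.leaf_unique _ _ _ hm h
  have fmv : f m ≠ Sum.inl v := fun h ↦ fv ⟨m, h⟩
  have fmu : f m ≠ Sum.inl u := fun h ↦ fu ⟨m, h⟩
  have fnn : ∀ n c, f c = Sum.inr (some n) → c = Sum.inr n :=
    fun n c h ↦ f.injective (h.trans (fn n).symm)
  have fnone : ∀ c, f c = Sum.inr none → c = p := fun c h ↦ f.injective (h.trans fp.symm)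
  refine ⟨{
    Node := Option S.Node
    finite_node := inferInstance
    tree := S.tree.attachPendants f p
    isTree := S.isTree.attachPendants f _
    centre := fun n ↦ n.elim k fun n ↦ (S.centre n).map f
    leaf_unique := ?_
    exists_third := ?_
    centre_adj := ?_
    clique_reduced := ?_
    star_reduced := ?_
    adj_iff := ?_ }⟩
  · intro l a b ha hb
    by_cases hl : Sum.inl l ∈ Set.range f
    · have hlv : l ≠ v := by rintro rfl; exact fv hl
      have hlu : l ≠ u := by rintro rfl; exact fu hl
      rw [← fw l hlv hlu] at ha hb
      obtain ⟨a, rfl, ha'⟩ := exists_of_attachPendants_adj (hwp l hlv hlu).symm ha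
      obtain ⟨b, rfl, hb'⟩ := exists_of_attachPendants_adj (hwp l hlv hlu).symm hb
      rw [S.leaf_unique ⟨l, hlv⟩ a b ha' hb']
    · rw [attachPendants_adj_of_notMem hl] at ha hb
      rw [ha, hb]
  · rintro (_ | n) a b
    · have h1 : (S.tree.attachPendants f p).Adj (Sum.inr none) (Sum.inl u) := by
        rw [← fp]
        exact ((attachPendants_adj_of_notMem fu).2 rfl).symm
      have h2 : (S.tree.attachPendants f p).Adj (Sum.inr none) (Sum.inl v) := by
        rw [← fp]
        exact ((attachPendants_adj_of_notMem fv).2 rfl).symm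
      have h3 : (S.tree.attachPendants f p).Adj (Sum.inr none) (f m) := by
        rw [← fp]
        exact attachPendants_adj_map.2 hm
      have h4 : (Sum.inl u : L ⊕ Option S.Node) ≠ Sum.inl v := fun h ↦ huv (Sum.inl_injective h)
      by_cases e1 : Sum.inl u ≠ a ∧ Sum.inl u ≠ b
      · exact ⟨_, h1, e1⟩
      by_cases e2 : Sum.inl v ≠ a ∧ Sum.inl v ≠ b
      · exact ⟨_, h2, e2⟩
      · exact ⟨_, h3, by grind, by grind⟩
    · obtain ⟨a', ha⟩ := exists_forall_map_eq f (Sum.inr n) a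
      obtain ⟨b', hb⟩ := exists_forall_map_eq f (Sum.inr n) b
      obtain ⟨w, hw, h1, h2⟩ := S.exists_third n a' b'
      rw [← fn]
      exact ⟨f w, attachPendants_adj_map.2 hw, fun h ↦ h1 (ha w h), fun h ↦ h2 (hb w h)⟩
  · rintro (_ | n) c hc
    · have hc : k = some c := hc
      rw [← fp]
      rcases hk with ⟨h, -⟩ | ⟨h, -⟩ | ⟨h, -⟩
      · rw [h] at hc; cases hc
      · rw [h] at hc; cases hc
        exact attachPendants_adj_map.2 hm
      · rw [h] at hc; cases hc
        exact ((attachPendants_adj_of_notMem fu).2 rfl).symm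
    · obtain ⟨c, hc', rfl⟩ := Option.map_eq_some_iff.1 hc
      rw [← fn]
      exact attachPendants_adj_map.2 (S.centre_adj n c hc')
  · have key : ∀ n, (S.tree.attachPendants f p).Adj (Sum.inr none) (Sum.inr (some n)) → k = none →
        S.centre n ≠ none := by
      intro n hn hk0
      rw [← fp, ← fn, attachPendants_adj_map] at hn
      rcases hk with ⟨-, -, -, h⟩ | ⟨h, -⟩ | ⟨h, -⟩
      · exact h n (madj n hn)
      · rw [h] at hk0; cases hk0
      · rw [h] at hk0; cases hk0
    rintro (_ | n) (_ | n') hnn hn hn'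
    · exact hnn.ne rfl
    · exact key n' hnn hn (Option.map_eq_none_iff.1 hn')
    · exact key n hnn.symm hn' (Option.map_eq_none_iff.1 hn)
    · rw [← fn, ← fn, attachPendants_adj_map] at hnn
      exact S.clique_reduced n n' hnn (Option.map_eq_none_iff.1 hn) (Option.map_eq_none_iff.1 hn')
  · rintro (_ | n) (_ | n') c hn hn'
    · have hn : k = some (Sum.inr none) := hn
      rcases hk with ⟨h, -⟩ | ⟨h, -⟩ | ⟨h, -⟩
      · rw [h] at hn; cases hn
      · rw [h] at hn
        have := fnone m (Option.some.inj hn)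
        exact (hm.ne this.symm).elim
      · rw [h] at hn; cases hn
    · have hn : k = some (Sum.inr (some n')) := hn
      obtain ⟨d, hd, rfl⟩ := Option.map_eq_some_iff.1 hn'
      rcases hk with ⟨h, -⟩ | ⟨h, -, -, h'⟩ | ⟨h, -⟩
      · rw [h] at hn; cases hn
      · rw [h] at hn
        rw [h' n' (fnn _ _ (Option.some.inj hn)) d hd, fp]
      · rw [h] at hn; cases hn
    · obtain ⟨d, hd, hdf⟩ := Option.map_eq_some_iff.1 hn
      have hn' : k = some c := hn'
      have hdp := fnone d hdf
      rw [hdp] at hd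
      have hmn := madj n (S.centre_adj n _ hd).symm
      rcases hk with ⟨h, -⟩ | ⟨h, -⟩ | ⟨h, -, h'⟩
      · rw [h] at hn'; cases hn'
      · rw [h] at hn'
        rw [← Option.some.inj hn', hmn, fn]
      · exact (h' n hmn (hp ▸ hd)).elim
    · obtain ⟨d, hd, hdf⟩ := Option.map_eq_some_iff.1 hn
      obtain ⟨c, hc, rfl⟩ := Option.map_eq_some_iff.1 hn'
      rw [fnn _ _ hdf] at hd
      rw [S.star_reduced n n' c hd hc, fn]
  · have hold : ∀ w (hwv : w ≠ v), w ≠ u → ∀ y, y ∉ Set.range f →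
        ((∀ n, MarkersAdj ((S.centre n).map f)
          ((S.isTree.attachPendants f p).dir (Sum.inr (some n)) y)
          ((S.isTree.attachPendants f p).dir (Sum.inr (some n)) (Sum.inl w))) ↔ G.Adj u w) := by
      intro w hwv hwu y hy
      refine Iff.trans ?_ (S.adj_iff ⟨u, huv⟩ ⟨w, hwv⟩
        fun h ↦ hwu (congrArg Subtype.val h).symm).symm
      rw [← hp]
      exact forall_congr' fun n ↦ by rw [hd' n y hy, hdw n w hwv hwu, markersAdj_map]
    have hsplit : ∀ y z, (∀ n : Option S.Node, MarkersAdj (n.elim k fun n ↦ (S.centre n).map f)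
          ((S.isTree.attachPendants f p).dir (Sum.inr n) y)
          ((S.isTree.attachPendants f p).dir (Sum.inr n) z)) ↔
        MarkersAdj k ((S.isTree.attachPendants f p).dir (Sum.inr none) y)
          ((S.isTree.attachPendants f p).dir (Sum.inr none) z) ∧
        ∀ n, MarkersAdj ((S.centre n).map f)
          ((S.isTree.attachPendants f p).dir (Sum.inr (some n)) y)
          ((S.isTree.attachPendants f p).dir (Sum.inr (some n)) z) := fun y z ↦ Option.forall
    have hsymm : ∀ a b, (G.Adj a b ↔ ∀ n : Option S.Node, MarkersAdj (n.elim k fun n ↦ (S.centre n).map f)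
          ((S.isTree.attachPendants f p).dir (Sum.inr n) (Sum.inl a))
          ((S.isTree.attachPendants f p).dir (Sum.inr n) (Sum.inl b))) →
        (G.Adj b a ↔ ∀ n : Option S.Node, MarkersAdj (n.elim k fun n ↦ (S.centre n).map f)
          ((S.isTree.attachPendants f p).dir (Sum.inr n) (Sum.inl b))
          ((S.isTree.attachPendants f p).dir (Sum.inr n) (Sum.inl a))) := by
      intro a b hab
      rw [G.adj_comm, hab]
      exact forall_congr' fun n ↦ markersAdj_comm
    have hvw : ∀ w, w ≠ v → w ≠ u → (G.Adj v w ↔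
        MarkersAdj k (Sum.inl v) (f m) ∧ G.Adj u w) := by
      intro w hwv hwu
      rcases hk with ⟨h, h', -⟩ | ⟨h, h', -⟩ | ⟨h, h', -⟩
      · rw [h' w hwv hwu, h]
        exact (and_iff_right fun _ ↦ .inl rfl).symm
      · rw [h' w hwv hwu, h]
        exact (and_iff_right fun _ ↦ .inr (.inr rfl)).symm
      · rw [h', h]
        refine iff_of_false hwu fun h ↦ ?_
        rcases h.1 fmv.symm with h | h | h
        · cases h
        · exact huv (Sum.inl_injective (Option.some.inj h))
        · exact fmu (Option.some.inj h).symm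
    have huw : MarkersAdj k (Sum.inl u) (f m) := by
      intro _
      rcases hk with ⟨h, -⟩ | ⟨h, -⟩ | ⟨h, -⟩
      exacts [.inl h, .inr (.inr h), .inr (.inl h)]
    have hvu : G.Adj v u ↔ MarkersAdj k (Sum.inl v) (Sum.inl u) := by
      rcases hk with ⟨h, -, h', -⟩ | ⟨h, -, h', -⟩ | ⟨h, h', -⟩
      · exact iff_of_true h' fun _ ↦ .inl h
      · refine iff_of_false h' fun h2 ↦ ?_
        rw [h] at h2
        rcases h2 (fun e ↦ huv (Sum.inl_injective e).symm) with e | e | e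
        · cases e
        · exact fmv (Option.some.inj e)
        · exact fmu (Option.some.inj e)
      · exact iff_of_true ((h' u).2 rfl) fun _ ↦ .inr (.inr h)
    refine forall_pair_of v hsymm (fun a b ha hb hab ↦ ?_) (fun w hwv ↦ ?_)
    · refine forall_pair_of (L := {w // w ≠ v}) ⟨u, huv⟩ (P := fun a b ↦ G.Adj a b ↔ ∀ n : Option S.Node,
          MarkersAdj (n.elim k fun n ↦ (S.centre n).map f)
          ((S.isTree.attachPendants f p).dir (Sum.inr n) (Sum.inl a.1))
          ((S.isTree.attachPendants f p).dir (Sum.inr n) (Sum.inl b.1)))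
        (fun a b ↦ hsymm a b) (fun ⟨a, ha⟩ ⟨b, hb⟩ hau hbu hab ↦ ?_) (fun ⟨b, hb⟩ hbu ↦ ?_)
        ⟨a, ha⟩ ⟨b, hb⟩ (fun h ↦ hab (congrArg Subtype.val h))
      · have hau : a ≠ u := fun h ↦ hau (Subtype.ext h)
        have hbu : b ≠ u := fun h ↦ hbu (Subtype.ext h)
        rw [hsplit, hdm a ha hau, hdm b hb hbu]
        refine ((S.adj_iff ⟨a, ha⟩ ⟨b, hb⟩ (fun h ↦ hab (Subtype.ext (congrArg Subtype.val h)))).trans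
          (forall_congr' fun n ↦ ?_)).trans (and_iff_right fun h ↦ (h rfl).elim).symm
        rw [hdw n a ha hau, hdw n b hb hbu, markersAdj_map]
      · have hbu : b ≠ u := fun h ↦ hbu (Subtype.ext h)
        rw [hsplit, hds _ fu, hdm b hb hbu, hold b hb hbu _ fu]
        exact (and_iff_right huw).symm
    · by_cases hwu : w = u
      · subst hwu
        rw [hsplit, hds _ fu, hds _ fv, hvu]
        refine (and_iff_left fun n h ↦ (h ?_).elim).symm
        rw [hd' n _ fv, hd' n _ fu]
      · rw [hsplit, hds _ fv, hdm w hwv hwu, hold w hwv hwu _ fv]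
        exact hvw w hwv hwu

/-- If the node next to `u` already has the label that the new leaf needs, the leaf is attached
there. Otherwise a new node is inserted, and exactly because the former case fails the tree stays
reduced. -/
theorem nonempty_of_twins_or_pendant [Nontrivial {w | w ≠ v}] (S : (G.induce {w | w ≠ v}).SplitTree)
    (hv : G.AreTwins v u ∨ (v ≠ u ∧ ∀ w, G.Adj v w ↔ w = u)) : Nonempty G.SplitTree := by
  have huv : u ≠ v := hv.elim (fun h ↦ h.1.symm) fun h ↦ h.1.symm
  obtain ⟨w, hw⟩ := exists_ne (⟨u, huv⟩ : {w | w ≠ v})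
  have hm := S.isTree.adj_dir (x := Sum.inl ⟨u, huv⟩) (u := Sum.inl w)
    (fun h ↦ hw (Sum.inl_injective h).symm)
  generalize S.isTree.dir _ _ = m at hm
  have uniq : ∀ n, m = Sum.inr n → S.tree.Adj (Sum.inl ⟨u, huv⟩) (Sum.inr n) := fun n h ↦ h ▸ hm
  rcases hv with ⟨-, ht⟩ | ⟨-, hp⟩
  · by_cases hadj : G.Adj v u
    · by_cases hx : ∃ n, m = Sum.inr n ∧ S.centre n = none
      · obtain ⟨n, hn, hc⟩ := hx
        exact nonempty_of_attach_leaf huv S n (uniq n hn)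
          (.inl ⟨by rw [hc]; simp, ht, iff_of_true hadj hc⟩)
      · push Not at hx
        exact nonempty_of_insert_node huv S m hm none (.inl ⟨rfl, ht, hadj, hx⟩)
    · by_cases hx : ∃ n c, m = Sum.inr n ∧ S.centre n = some c ∧ c ≠ Sum.inl ⟨u, huv⟩
      · obtain ⟨n, c, hn, hc, hcu⟩ := hx
        exact nonempty_of_attach_leaf huv S n (uniq n hn)
          (.inl ⟨by rw [hc]; simpa using hcu, ht, iff_of_false hadj (by rw [hc]; simp)⟩)
      · push Not at hx
        exact nonempty_of_insert_node huv S m hm _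
          (.inr (.inl ⟨rfl, ht, hadj, fun n h c ↦ hx n c h⟩))
  · by_cases hx : ∃ n, m = Sum.inr n ∧ S.centre n = some (Sum.inl ⟨u, huv⟩)
    · obtain ⟨n, hn, hc⟩ := hx
      exact nonempty_of_attach_leaf huv S n (uniq n hn) (.inr ⟨hc, hp⟩)
    · push Not at hx
      exact nonempty_of_insert_node huv S m hm _ (.inr (.inr ⟨rfl, hp, hx⟩))

theorem nonempty_of_subsingleton [Subsingleton L] [Nonempty L] : Nonempty G.SplitTree := by
  have : Subsingleton (L ⊕ Empty) := ⟨by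
    rintro (a | a) (b | b)
    · rw [Subsingleton.elim a b]
    all_goals first | exact a.elim | exact b.elim⟩
  exact ⟨{
    Node := Empty
    finite_node := inferInstance
    tree := ⊥
    isTree := ⟨⟨fun a b ↦ Subsingleton.elim a b ▸ Reachable.refl a⟩, isAcyclic_bot⟩
    centre := Empty.elim
    leaf_unique := fun l a b _ _ ↦ Subsingleton.elim a b
    exists_third := fun x ↦ x.elim
    centre_adj := fun x ↦ x.elim
    clique_reduced := fun x ↦ x.elim
    star_reduced := fun x ↦ x.elim
    adj_iff := fun a b hab ↦ (hab (Subsingleton.elim a b)).elim }⟩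

theorem nonempty_of_adj (hL : ∀ w, w = u ∨ w = v) (h : G.Adj u v) : Nonempty G.SplitTree := by
  have : Subsingleton {w | w ≠ v} := ⟨fun a b ↦ Subtype.ext
    (((hL a).resolve_right a.2).trans ((hL b).resolve_right b.2).symm)⟩
  have : Nonempty {w | w ≠ v} := ⟨⟨u, h.ne⟩⟩
  have hbot : (⊥ : SimpleGraph {w | w ≠ v}).IsTree :=
    ⟨⟨fun a b ↦ Subsingleton.elim a b ▸ Reachable.refl a⟩, isAcyclic_bot⟩
  let f : {w | w ≠ v} ↪ L ⊕ Empty := (Function.Embedding.subtype _).trans .inl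
  have hf : Sum.inl v ∉ Set.range f := by
    rintro ⟨w, hw⟩
    exact w.2 (Sum.inl_injective hw)
  have hadj : ∀ l, l ≠ v → ∀ a, ((⊥ : SimpleGraph {w | w ≠ v}).attachPendants f ⟨u, h.ne⟩).Adj
      (Sum.inl l) a → a = Sum.inl v := by
    rintro l hl (a | a) hla
    · rcases hL a with rfl | rfl
      · have : l = a := (hL l).resolve_right hl
        exact (hla.ne (by rw [this])).elim
      · rfl
    · exact a.elim
  exact ⟨{
    Node := Empty
    finite_node := inferInstance
    tree := (⊥ : SimpleGraph {w | w ≠ v}).attachPendants f ⟨u, h.ne⟩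
    isTree := hbot.attachPendants f _
    centre := Empty.elim
    leaf_unique := by
      intro l a b ha hb
      by_cases hl : l = v
      · subst hl
        rw [attachPendants_adj_of_notMem hf] at ha hb
        rw [ha, hb]
      · rw [hadj l hl a ha, hadj l hl b hb]
    exists_third := fun x ↦ x.elim
    centre_adj := fun x ↦ x.elim
    clique_reduced := fun x ↦ x.elim
    star_reduced := fun x ↦ x.elim
    adj_iff := by
      intro a b hab
      refine iff_of_true ?_ fun n ↦ n.elim
      rcases hL a with rfl | rfl <;> rcases hL b with rfl | rfl
      exacts [(hab rfl).elim, h, h.symm, (hab rfl).elim] }⟩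

theorem nonempty [Finite L] (hG : G.IsDistanceHereditary) (hc : G.Connected) :
    Nonempty G.SplitTree := by
  induction hn : Nat.card L using Nat.strong_induction_on generalizing L with
  | _ n ih =>
    have := hc.nonempty
    rcases subsingleton_or_nontrivial L with hL | hL
    · exact nonempty_of_subsingleton
    obtain ⟨v, u, hvu⟩ := hG.exists_twins_or_pendant
    have huv : u ≠ v := hvu.elim (fun h ↦ h.1.symm) fun h ↦ h.1.symm
    have hvu' : G.AreTwins v u ∨ (v ≠ u ∧ ∀ w, G.Adj v w ↔ w = u) := by
      refine hvu.imp_right fun ⟨h1, h2⟩ ↦ ⟨h1, fun w ↦ ⟨h2 w, ?_⟩⟩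
      rintro rfl
      obtain ⟨z, hz⟩ := hc.preconnected.exists_adj_of_nontrivial v
      exact h2 z hz ▸ hz
    have hc' := hc.induce_compl_of_twins_or_pendant hvu
    rcases subsingleton_or_nontrivial {w | w ≠ v} with hs | hs
    · have hall : ∀ w, w = u ∨ w = v := by
        intro w
        by_cases hw : w = v
        · exact .inr hw
        · exact .inl (congrArg Subtype.val (hs.elim ⟨w, hw⟩ ⟨u, huv⟩))
      obtain ⟨z, hz⟩ := hc.preconnected.exists_adj_of_nontrivial v
      have : z = u := (hall z).resolve_right hz.ne'
      subst this
      exact nonempty_of_adj hall hz.symm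
    · have hlt : Nat.card {w | w ≠ v} < n := by
        rw [← hn, Nat.card_coe_set_eq, ← Set.ncard_univ]
        exact Set.ncard_lt_ncard (Set.ssubset_univ_iff.2 fun h ↦ (h ▸ Set.mem_univ v : v ∈ {w | w ≠ v}) rfl)
          (Set.toFinite _)
      obtain ⟨S⟩ := ih _ hlt (hG.induce _) hc' rfl
      exact nonempty_of_twins_or_pendant S hvu'

end SplitTree


/-! ### Components and the value of the twin-width -/

variable {V : Type u} {G : SimpleGraph V}

/-- The threads are laid out in consecutive blocks of length `M + 1`. Position `M` of a block is
occupied by no vertex and is a reset, so there are no edges between blocks. -/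
theorem IsThread.of_components [Finite V] (h : ∀ C : G.ConnectedComponent, C.toSimpleGraph.IsThread) :
    G.IsThread := by
  choose f act adj reset hblob hadj using h
  obtain ⟨k, ⟨e⟩⟩ := Finite.exists_equiv_fin G.ConnectedComponent
  let g : V → ℕ := fun v ↦ f (G.connectedComponentMk v) ⟨v, rfl⟩
  have hg : ∀ (C : G.ConnectedComponent) (v : C), f C v = g v := by
    rintro C ⟨v, rfl⟩; rfl
  have hne : ∃ M, ∀ v, g v < M := by
    obtain ⟨M, hM⟩ := (Set.finite_range g).bddAbove
    exact ⟨M + 1, fun v ↦ Nat.lt_succ_of_le (hM ⟨v, rfl⟩)⟩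
  obtain ⟨M, hM⟩ := hne
  let F : V → ℕ := fun v ↦ (M + 1) * e (G.connectedComponentMk v) + g v
  have hdiv : ∀ v, F v / (M + 1) = e (G.connectedComponentMk v) := fun v ↦ by
    rw [Nat.mul_add_div (by omega), Nat.div_eq_of_lt (by have := hM v; omega), add_zero]
  have hmod : ∀ v, F v % (M + 1) = g v := fun v ↦ by
    rw [Nat.mul_add_mod, Nat.mod_eq_of_lt (by have := hM v; omega)]
  have hcomp : ∀ {u v}, (e (G.connectedComponentMk u) : ℕ) = e (G.connectedComponentMk v) →
      G.connectedComponentMk u = G.connectedComponentMk v := fun h ↦ e.injective (Fin.ext h)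
  refine ⟨F, fun n ↦ ∃ C, (e C : ℕ) = n / (M + 1) ∧ act C (n % (M + 1)),
    fun n ↦ ∃ C, (e C : ℕ) = n / (M + 1) ∧ adj C (n % (M + 1)),
    fun n ↦ n % (M + 1) = M ∨ ∃ C, (e C : ℕ) = n / (M + 1) ∧ reset C (n % (M + 1)),
    fun i ↦ ?_, fun u v huv ↦ ?_⟩
  · intro a ha b hb c hc d hd hp
    have key : ∀ v, F v = i → ∀ C, (e C : ℕ) = i / (M + 1) →
        ∃ h : v ∈ C.supp, f C ⟨v, h⟩ = i % (M + 1) := by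
      intro v hv C hC
      have h : G.connectedComponentMk v = C := by
        refine e.injective (Fin.ext ?_)
        rw [hC, ← hv, hdiv]
      exact ⟨h, by rw [hg, ← hmod, hv]⟩
    have hC : (e (G.connectedComponentMk a) : ℕ) = i / (M + 1) := by
      rw [← hdiv, show F a = i from ha]
    obtain ⟨ha, ha'⟩ := key a ha _ hC
    obtain ⟨hb, hb'⟩ := key b hb _ hC
    obtain ⟨hc, hc'⟩ := key c hc _ hC
    obtain ⟨hd, hd'⟩ := key d hd _ hC
    exact hblob _ _ ⟨a, ha⟩ ha' ⟨b, hb⟩ hb' ⟨c, hc⟩ hc' ⟨d, hd⟩ hd' hp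
  · by_cases hC : G.connectedComponentMk u = G.connectedComponentMk v
    · obtain ⟨C, hCu⟩ : ∃ C, G.connectedComponentMk u = C := ⟨_, rfl⟩
      have hCv : G.connectedComponentMk v = C := hC ▸ hCu
      have hgu : f C ⟨u, hCu⟩ = g u := hg C ⟨u, hCu⟩
      have hgv : f C ⟨v, hCv⟩ = g v := hg C ⟨v, hCv⟩
      have hFu : F u = (M + 1) * e C + g u := by simp only [F, hCu]
      have hFv : F v = (M + 1) * e C + g v := by simp only [F, hCv]
      have hdu := hdiv u
      have hdv := hdiv v
      rw [hCu] at hdu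
      rw [hCv] at hdv
      have hlt : g u < g v := by omega
      have hex : ∀ (P : G.ConnectedComponent → ℕ → Prop) {n : ℕ}, n / (M + 1) = e C →
          ((∃ C', (e C' : ℕ) = n / (M + 1) ∧ P C' (n % (M + 1))) ↔ P C (n % (M + 1))) := by
        intro P n hn
        rw [hn]
        refine ⟨fun ⟨C', h1, h2⟩ ↦ ?_, fun h ↦ ⟨C, rfl, h⟩⟩
        rwa [← e.injective (Fin.ext h1)]
      have := hadj C ⟨u, hCu⟩ ⟨v, hCv⟩ (by rwa [hgu, hgv])
      rw [hgu, hgv] at this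
      beta_reduce
      rw [hex act hdu, hex adj hdv, hmod, hmod]
      refine this.trans (and_congr Iff.rfl (and_congr Iff.rfl ⟨fun h n hn hn' ↦ ?_, fun h n hn hn' hr ↦ ?_⟩))
      · obtain ⟨j, rfl⟩ : ∃ j, n = (M + 1) * e C + j := ⟨n - (M + 1) * e C, by omega⟩
        have hj : j < M := by have := hM v; omega
        have h1 : ((M + 1) * (e C : ℕ) + j) / (M + 1) = e C := by
          rw [Nat.mul_add_div (by omega), Nat.div_eq_of_lt (by omega), add_zero]
        have h2 : ((M + 1) * (e C : ℕ) + j) % (M + 1) = j := by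
          rw [Nat.mul_add_mod, Nat.mod_eq_of_lt (by omega)]
        rw [hex reset h1, h2]
        rintro (hj' | hr)
        · omega
        · exact h j (by omega) (by omega) hr
      · have hj : n < M := hn'.trans (hM v)
        have h1 : ((M + 1) * (e C : ℕ) + n) / (M + 1) = e C := by
          rw [Nat.mul_add_div (by omega), Nat.div_eq_of_lt (by omega), add_zero]
        have h2 : ((M + 1) * (e C : ℕ) + n) % (M + 1) = n := by
          rw [Nat.mul_add_mod, Nat.mod_eq_of_lt (by omega)]
        refine h ((M + 1) * e C + n) (by omega) (by omega) (.inr ?_)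
        rw [hex reset h1, h2]
        exact hr
    · refine iff_of_false (fun h ↦ hC (ConnectedComponent.sound h.reachable)) fun h ↦ ?_
      have hlt : (e (G.connectedComponentMk u) : ℕ) < e (G.connectedComponentMk v) := by
        refine lt_of_le_of_ne ?_ fun h ↦ hC (hcomp h)
        rw [← hdiv, ← hdiv]
        exact Nat.div_le_div_right huv.le
      refine h.2.2 ((M + 1) * e (G.connectedComponentMk u) + M) ?_ ?_ (.inl ?_)
      · have := hM u
        simp only [F]
        omega
      · have := Nat.mul_le_mul_left (M + 1) (Nat.succ_le_of_lt hlt)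
        rw [Nat.mul_succ] at this
        simp only [F]
        omega
      · rw [Nat.mul_add_mod, Nat.mod_eq_of_lt (by omega)]

theorem IsPathFour.exists_component {a b c d : V} (h : G.IsPathFour a b c d) :
    ∃ (C : G.ConnectedComponent) (a' b' c' d' : C), C.toSimpleGraph.IsPathFour a' b' c' d' := by
  refine ⟨G.connectedComponentMk a, ⟨a, rfl⟩, ⟨b, ?_⟩, ⟨c, ?_⟩, ⟨d, ?_⟩, h⟩
  · exact ConnectedComponent.sound h.1.symm.reachable
  · exact ConnectedComponent.sound (h.2.1.symm.reachable.trans h.1.symm.reachable)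
  · exact ConnectedComponent.sound (h.2.2.1.symm.reachable.trans
      (h.2.1.symm.reachable.trans h.1.symm.reachable))

section Components

variable [Finite V] (hG : G.IsDistanceHereditary)
include hG

theorem IsDistanceHereditary.exists_isSplitDecompositionOf (C : G.ConnectedComponent) :
    ∃ D : GraphLabelledTree C, D.IsSplitDecompositionOf C.toSimpleGraph := by
  obtain ⟨S⟩ := SplitTree.nonempty (hG.induce C.supp) C.connected_toSimpleGraph
  exact ⟨S.toGraphLabelledTree, S.isSplitDecompositionOf⟩

variable {D : (C : G.ConnectedComponent) → GraphLabelledTree C}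
  (hD : ∀ C, (D C).IsSplitDecompositionOf C.toSimpleGraph)
include hD

theorem IsDistanceHereditary.isCliqueStarTree (C : G.ConnectedComponent) :
    (D C).IsCliqueStarTree :=
  (hD C).isCliqueStarTree (hG.induce C.supp) C.connected_toSimpleGraph

/-- Both sides say that no tree has an away pair. A component with one vertex has no tree edge to
point to, whence the restriction to nontrivial ones. -/
theorem IsDistanceHereditary.starsPointToEdge_iff :
    (∀ C : G.ConnectedComponent, C.supp.Nontrivial → (D C).StarsPointToEdge) ↔ G.IsCograph := by
  rw [isCograph_iff]
  constructor
  · intro h a b c d hp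
    obtain ⟨C, a, b, c, d, hp⟩ := hp.exists_component
    rw [← (hD C).accessibilityGraph_eq] at hp
    obtain ⟨x, z, y, z', haw, -⟩ := (hG.isCliqueStarTree hD C).exists_awayPair_of_isPathFour hp
    refine (h C ⟨a, a.2, b, b.2, fun e ↦ ?_⟩).not_awayPair haw
    exact hp.1.ne (Subtype.ext e)
  · rintro h C ⟨a, ha, b, hb, hab⟩
    have hne : (Sum.inl ⟨a, ha⟩ : C ⊕ (D C).Node) ≠ Sum.inl ⟨b, hb⟩ :=
      fun e ↦ hab (congrArg Subtype.val (Sum.inl_injective e))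
    refine (hG.isCliqueStarTree hD C).starsPointToEdge (fun x c y c' haw ↦ ?_)
      (GraphLabelledTree.adj_dir hne)
    obtain ⟨p, q, r, s, hp⟩ := (hG.isCliqueStarTree hD C).exists_isPathFour_of_awayPair haw
    rw [(hD C).accessibilityGraph_eq] at hp
    exact h p q r s hp

theorem IsDistanceHereditary.isThread (h : ∀ C, (D C).StarsPointToPath) : G.IsThread := by
  refine .of_components fun C ↦ ?_
  obtain ⟨a, b, hab⟩ := GraphLabelledTree.starsPointToPath_iff.1 (h C)
  rw [← (hD C).accessibilityGraph_eq]
  exact (hG.isCliqueStarTree hD C).isThread hab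

theorem IsDistanceHereditary.hasAsteroid (h : ¬∀ C, (D C).StarsPointToPath) : G.HasAsteroid := by
  obtain ⟨C, hC⟩ := not_forall.1 h
  have := (hG.isCliqueStarTree hD C).hasAsteroid_of_not_starsPointToPath hC
  rw [(hD C).accessibilityGraph_eq] at this
  exact this.of_embedding (Embedding.induce C.supp)

end Components

theorem IsDistanceHereditary.isThread_or_hasAsteroid [Finite V] (hG : G.IsDistanceHereditary) :
    G.IsThread ∨ G.HasAsteroid := by
  choose D hD using hG.exists_isSplitDecompositionOf
  by_cases h : ∀ C, (D C).StarsPointToPath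
  · exact .inl (hG.isThread hD h)
  · exact .inr (hG.hasAsteroid hD h)

section TwinWidth

variable [Finite V] [Nonempty V]

theorem IsCograph.twinWidth_eq_zero (h : G.IsCograph) : G.twinWidth = 0 :=
  twinWidth_eq h.reducible (by simp)

theorem IsThread.twinWidth_eq_one (h : G.IsThread) (h' : ¬G.IsCograph) : G.twinWidth = 1 :=
  twinWidth_eq h.reducible_one fun e he ↦ by
    obtain rfl : e = 0 := by omega
    exact not_reducible_zero_of_not_isCograph h'

theorem HasAsteroid.twinWidth_eq_two (h : G.HasAsteroid) (hG : G.IsDistanceHereditary) :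
    G.twinWidth = 2 :=
  twinWidth_eq hG.reducible_two fun _ he hr ↦ h.not_reducible_one (hr.mono (by omega))

end TwinWidth

end SimpleGraph

open SimpleGraph in
theorem mainTheorem7 {V : Type*} [Finite V] [Nonempty V] (G : SimpleGraph V)
    (hG : G.IsDistanceHereditary) :
    -- the value of the twin-width in terms of graph classes
    ((G.IsCograph → G.twinWidth = 0) ∧
      (G.IsATFree ↔ G.IsPermutationGraph) ∧
      (¬G.IsCograph → G.IsATFree → G.twinWidth = 1) ∧
      (¬G.IsCograph → ¬G.IsATFree → G.twinWidth = 2)) ∧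
    -- the components have canonical split decompositions, and these give the value as well
    (∀ C : G.ConnectedComponent,
      ∃ D : GraphLabelledTree C, D.IsSplitDecompositionOf C.toSimpleGraph) ∧
    ∀ D : (C : G.ConnectedComponent) → GraphLabelledTree C,
      (∀ C, (D C).IsSplitDecompositionOf C.toSimpleGraph) →
      ((∀ C, C.supp.Nontrivial → (D C).StarsPointToEdge) → G.twinWidth = 0) ∧
      (¬(∀ C, C.supp.Nontrivial → (D C).StarsPointToEdge) →
        (∀ C, (D C).StarsPointToPath) → G.twinWidth = 1) ∧
      (¬(∀ C, C.supp.Nontrivial → (D C).StarsPointToEdge) →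
        ¬(∀ C, (D C).StarsPointToPath) → G.twinWidth = 2) := by
  refine ⟨⟨fun h ↦ h.twinWidth_eq_zero, ⟨fun h ↦ ?_, fun h ↦ h.isATFree⟩, fun h h' ↦ ?_,
    fun h h' ↦ ?_⟩, hG.exists_isSplitDecompositionOf, fun D hD ↦ ?_⟩
  · rcases hG.isThread_or_hasAsteroid with ht | ha
    · exact ht.isPermutationGraph
    · exact (ha.not_isATFree h).elim
  · rcases hG.isThread_or_hasAsteroid with ht | ha
    · exact ht.twinWidth_eq_one h
    · exact (ha.not_isATFree h').elim
  · rcases hG.isThread_or_hasAsteroid with ht | ha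
    · exact (h' ht.isPermutationGraph.isATFree).elim
    · exact ha.twinWidth_eq_two hG
  · rw [hG.starsPointToEdge_iff hD]
    exact ⟨fun h ↦ h.twinWidth_eq_zero, fun h h' ↦ (hG.isThread hD h').twinWidth_eq_one h,
      fun _ h' ↦ (hG.hasAsteroid hD h').twinWidth_eq_two hG⟩
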